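/- Let $\mathbb T=\mathbb R/2\pi\mathbb Z$, $e_n(x)=(2\pi)^{-1/2}e^{inx}$, and for $1\le\alpha\le\infty$ let $\mathfrak S^\alpha$ be the Schatten class of bounded operators $A$ on $L^2(\mathbb T)$ with $\|A\|_{\mathfrak S^\alpha}=(\operatorname{Tr}|A|^\alpha)^{1/\alpha}<\infty$ (the operator norm if $\alpha=\infty$). The density of $A\in\mathfrak S^1$ with singular value decomposition $A=\sum_k a_k|\varphi_k\rangle\langle\psi_k|$ is $\rho_A=\sum_k a_k\varphi_k\overline{\psi_k}\in L^1(\mathbb T)$. For $R>0$ put $E_R^\alpha=\{\gamma_0=\gamma_0^*:\ \|\gamma_0\|_{\mathfrak S^\alpha}\le R\}$. For real $V\in L^2([0,T]\times\mathbb T)$ let $U_V(t)\phi=u(t)$, $0\le t\le T$, where $u\in C([0,T];L^2(\mathbb T))\cap L^4([0,T]\times\mathbb T)$ is the solution, in the sense of Duhamel's formula, of $i\partial_tu=-\Delta u+Vu$, $u(0)=\phi\in L^2(\mathbb T)$. Fix a sign $\pm$. For self-adjoint $\gamma_0\in\mathfrak S^1$, a solution on $[0,T]$ of the cubic system $$i\partial_t\gamma=[-\Delta\pm\rho_\gamma,\gamma],\qquad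 \gamma(0)=\gamma_0 \qquad\text{(NLSS)}$$ is a $\gamma\in C([0,T];\mathfrak S^1)$ with $\rho_\gamma\in L^2([0,T];L^2(\mathbb T))$ and $\gamma(t)=U_{\pm\rho_\gamma}(t)\,\gamma_0\,U_{\pm\rho_\gamma}(t)^*$ for all $t\in[0,T]$. **(i) Well-posedness.** For every $R>0$ there is $T=T(R)>0$ such that for every $\gamma_0\in E_R^1$ there is a solution on $[0,T]$, and the data-to-solution map $E_R^1\ni\gamma_0\mapsto(\gamma,\rho_\gamma)\in C([0,T];\mathfrak S^1)\times L^2([0,T];L^2(\mathbb T))$ is Lipschitz continuous for the $\mathfrak S^1$-norm on $E_R^1$. For every self-adjoint $\gamma_0\in\mathfrak S^1$ and every $T>0$ there is at most one solution on $[0,T]$. If $T_{\max}\in(0,\infty]$ denotes the supremum of the times $T$ such that a solution exists on $[0,T]$, then $T_{\max}<\infty$ implies $\lim_{t\nearrow T_{\max}}\|\gamma(t)\|_{\mathfrak S^1}=\infty$ for the maximal solution $\gamma$. In fact the solution is global: it exists on $[0,T]$ for every $T>0$. **(ii) Ill-posedness.** Let $1<\alpha\le\infty$, $R>0$ and $T>0$.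 The data-to-density map $E_R^1\ni\gamma_0\mapsto\rho_\gamma\in L^2([0,T];L^2(\mathbb T))$ has no extension to a map $E_R^\alpha\to L^2([0,T];L^2(\mathbb T))$ that is continuous for the $\mathfrak S^\alpha$-norm on $E_R^\alpha$. Moreover, if $0<\varepsilon<1-1/\alpha$ (with $1/\infty=0$), then $\gamma_N=N^{-1/\alpha-\varepsilon}\sum_{n=1}^N|e_n\rangle\langle e_n|$ is a stationary solution of (NLSS) for every $N\geq 1$, and, as $N\to\infty$, $\|\gamma_N\|_{\mathfrak S^\alpha}\to0$ while $\|\rho_{\gamma_N}\|_{L^2([0,T];L^2(\mathbb T))}\to\infty$ for every $T>0$. -/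

import Mathlib

open MeasureTheory Filter Topology
open scoped ENNReal NNReal

namespace NLSS

instance factTwoPiPos : Fact (0 < 2 * Real.pi) := ⟨Real.two_pi_pos⟩

/-- The circle `ℝ / 2πℤ`; its `volume` is Lebesgue measure, of total mass `2π`. -/
abbrev Circ : Type := AddCircle (2 * Real.pi)

/-- The complex Hilbert space `L²(𝕋)`. -/
abbrev L2 : Type := Lp ℂ 2 (volume : Measure Circ)

/-- Bounded operators on `L²(𝕋)`. -/
abbrev Op : Type := L2 →L[ℂ] L2

/-- The basis functions `e_n(x) = (2π)^{-1/2} e^{inx}`, as elements of `L²(𝕋)`. -/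
noncomputable def e (n : ℤ) : L2 :=
  ((1 / Real.sqrt (2 * Real.pi) : ℝ) : ℂ) •
    ContinuousMap.toLp 2 (volume : Measure Circ) ℂ (fourier n)

/-- The rank-one operator `|φ⟩⟨ψ|`, that is `f ↦ ⟨ψ, f⟩ φ` (the inner product is antilinear in
its first argument). -/
noncomputable def ketBra (φ ψ : L2) : Op := InnerProductSpace.rankOne ℂ φ ψ

/-! ### Schatten classes -/

/-- The operator `|A|^p`, where `|A| = √(A* A)`, through the continuous functional calculus of the
C⋆-algebra of bounded operators. -/
noncomputable def absPow {H : Type*} [NormedAddCommGroup H] [InnerProductSpace ℂ H]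
    [CompleteSpace H] (A : H →L[ℂ] H) (p : ℝ) : H →L[ℂ] H :=
  CFC.abs A ^ p

/-- The trace `∑ₙ ⟨e_n, B e_n⟩ ∈ [0, ∞]` of a nonnegative operator `B`. -/
noncomputable def posTrace (B : Op) : ℝ≥0∞ :=
  ∑' n : ℤ, ENNReal.ofReal (RCLike.re (inner ℂ (e n) (B (e n))))

/-- The Schatten norm `(Tr |A|^α)^{1/α}`, where `|A| = √(A* A)`, for `1 ≤ α < ∞`, and the operator
norm (the maximum of the spectrum of `|A|`) for `α = ∞`. Its value is `∞` exactly when the bounded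
operator `A` is not in the Schatten class `𝔖^α`. -/
noncomputable def schattenNorm (α : ℝ≥0∞) (A : Op) : ℝ≥0∞ :=
  if α = ⊤ then ‖A‖ₑ else (posTrace (absPow A α.toReal)) ^ (1 / α.toReal)

/-- The ball `E_R^α` of the self-adjoint operators with `‖A‖_{𝔖^α} ≤ R`. -/
def schattenBall (α : ℝ≥0∞) (R : ℝ) : Set Op :=
  {A | IsSelfAdjoint A ∧ schattenNorm α A ≤ ENNReal.ofReal R}

/-- `γ ∈ C([0,T]; 𝔖^α)`. -/
def SchattenContinuous (α : ℝ≥0∞) (T : ℝ) (γ : ℝ → Op) : Prop :=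
  ∀ t ∈ Set.Icc 0 T, schattenNorm α (γ t) < ⊤ ∧
    Tendsto (fun s => schattenNorm α (γ s - γ t)) (𝓝[Set.Icc 0 T] t) (𝓝 0)

/-! ### The density of a trace-class operator -/

/-- `ρ` is the density `ρ_A` of the trace-class operator `A`: for a singular value decomposition
`A = ∑ₖ aₖ |φₖ⟩⟨ψₖ|`, with orthonormal systems `(φₖ)`, `(ψₖ)` and summable singular values
`aₖ ≥ 0`, one has `ρ(x) = ∑ₖ aₖ φₖ(x) conj (ψₖ(x))` for almost every `x`. (The series converge
absolutely, so the order in which the singular values are listed is immaterial.) -/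
def IsDensity (A : Op) (ρ : Circ → ℂ) : Prop :=
  ∃ (a : ℕ → ℝ) (φ ψ : ℕ → L2),
    (∀ k, 0 ≤ a k) ∧ Summable a ∧ Orthonormal ℂ φ ∧ Orthonormal ℂ ψ ∧
    HasSum (fun k => ((a k : ℝ) : ℂ) • ketBra (φ k) (ψ k)) A ∧
    ∀ᵐ x, HasSum (fun k => ((a k : ℝ) : ℂ) * φ k x * (starRingEnd ℂ) (ψ k x)) (ρ x)

/-! ### The linear Schrödinger equation with a time-dependent potential -/

/-- Lebesgue measure on the time interval `[0,T]`. -/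
noncomputable abbrev timeMeasure (T : ℝ) : Measure ℝ := volume.restrict (Set.Icc 0 T)

/-- `u` is the solution on `[0,T]` of `i ∂ₜ u = -Δu + V u`, `u(0) = φ`, in the Strichartz class
`C([0,T]; L²(𝕋)) ∩ L⁴([0,T] × 𝕋)`. The equation is Duhamel's formula
`u(t) = e^{itΔ} φ - i ∫₀ᵗ e^{i(t-s)Δ} V(s) u(s) ds`, written for every Fourier coefficient:
`e^{itΔ}` multiplies the coefficient of index `n` by `e^{-itn²}`, and the coefficient of `V(s) u(s)`
is `∫ conj(e_n) V(s) u(s) dx`. -/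
structure IsLinearSolution (T : ℝ) (V : ℝ → L2) (φ : L2) (u : ℝ → L2) : Prop where
  continuousOn : ContinuousOn u (Set.Icc 0 T)
  strichartz : ∫⁻ t in Set.Icc 0 T, ∫⁻ x : Circ, ‖u t x‖ₑ ^ 4 < ⊤
  duhamel : ∀ t ∈ Set.Icc 0 T, ∀ n : ℤ,
    inner ℂ (e n) (u t) =
      Complex.exp (-Complex.I * t * n ^ 2) * inner ℂ (e n) φ -
        Complex.I * ∫ s in (0 : ℝ)..t, Complex.exp (-Complex.I * (t - s) * n ^ 2) *
          ∫ x : Circ, (starRingEnd ℂ) (e n x) * (V s x * u s x)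

/-- `U(t) = U_V(t)`, `0 ≤ t ≤ T`, is the propagator of the linear Schrödinger equation with
potential `V`: `U(t) φ` is the value at time `t` of the solution with initial value `φ`. -/
def IsPropagator (T : ℝ) (V : ℝ → L2) (U : ℝ → Op) : Prop :=
  ∀ φ : L2, IsLinearSolution T V φ (fun t => U t φ)

/-! ### The nonlinear Schrödinger system -/

/-- `γ`, with density `ϱ = ρ_γ`, is a solution on `[0,T]` of `i ∂ₜ γ = [-Δ + σ ρ_γ, γ]`,
`γ(0) = γ₀`: `γ ∈ C([0,T]; 𝔖¹)`, `ϱ ∈ L²([0,T]; L²(𝕋))`,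
`γ(t) = U_{σϱ}(t) γ₀ U_{σϱ}(t)*` for all `t ∈ [0,T]`, and `ϱ = ρ_γ`.
Only the values on `[0,T]` matter. -/
structure IsSolution (σ T : ℝ) (γ₀ : Op) (γ : ℝ → Op) (ϱ : ℝ → L2) : Prop where
  continuous : SchattenContinuous 1 T γ
  memLp : MemLp ϱ 2 (timeMeasure T)
  density : ∀ᵐ t ∂(timeMeasure T), IsDensity (γ t) (ϱ t)
  evolution : ∃ U : ℝ → Op, IsPropagator T (fun t => (σ : ℂ) • ϱ t) U ∧
    ∀ t ∈ Set.Icc 0 T, γ t = U t * γ₀ * star (U t)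

/-- The maximal time of existence: the supremum of the `T > 0` such that a solution exists on
`[0,T]`. -/
noncomputable def maximalTime (σ : ℝ) (γ₀ : Op) : ℝ≥0∞ :=
  ⨆ (T : ℝ) (_ : 0 < T ∧ ∃ γ ϱ, IsSolution σ T γ₀ γ ϱ), ENNReal.ofReal T

/-- `F`, a map from the set `E` of operators to `L²([0,T]; L²(𝕋))`, is continuous for the distance
`‖A - B‖_{𝔖^α}` on `E`. -/
def SchattenContinuousOn (α : ℝ≥0∞) (T : ℝ) (E : Set Op)
    (F : Op → Lp L2 2 (timeMeasure T)) : Prop :=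
  ∀ A ∈ E, ∀ ε > (0 : ℝ), ∃ δ > (0 : ℝ), ∀ B ∈ E,
    schattenNorm α (B - A) < ENNReal.ofReal δ → ‖F B - F A‖ < ε

/-- The operators `N^{-1/α-ε} ∑_{n=1}^N |e_n⟩⟨e_n|` (with `1/α = 0` for `α = ∞`). -/
noncomputable def gammaN (α : ℝ≥0∞) (ε : ℝ) (N : ℕ) : Op :=
  (((N : ℝ) ^ (-(α⁻¹).toReal - ε) : ℝ) : ℂ) • ∑ n ∈ Finset.Icc 1 N, ketBra (e n) (e n)

end NLSS

namespace NLSS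

/-! ### The orthonormal basis `e_n` -/

/-! Write γ₀ = ∑ lₖ|φₖ⟩⟨φₖ|. The density of U γ₀ U* is ∑ lₖ|Uφₖ|², and its space-time L² norm is at
most ∑ |lₖ| times the squared L⁴ norm of Uφₖ. At α = 1 the L⁴ Strichartz estimate for a single
function and the triangle inequality therefore bound the density by the trace norm. On the circle
this estimate goes back to Zygmund: the L⁴ norm of a wave u is governed by the L² norm of |u|², and
for k ≠ 0 the k-th coefficient of |u|² is a sum of exponentials in t that are orthogonal over a time
π/|k|. On an interval of length h the constant is O(h^(1/8)) (`strichartz`, `n4_free_le`), and this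
gain makes every later map a contraction.

The linear equation is studied through the profile v(t) = e^{-itΔ}u(t). Duality bounds the
increments of Duhamel's integral, and a dyadic argument (`n4_profile_le`) turns increments bounded
by a measure into the retarded estimate (`exists_duhamel`). Picard iteration and short steps then
give existence and uniqueness. For a real potential the L² norm is conserved (`IsProfile.norm_eq`),
so the propagator is isometric.

On the operator side, the trace norm of a self-adjoint operator is the sum of its absolute
eigenvalues, and it is at most ∑ ‖fₖ‖‖gₖ‖ for every expansion ∑ |fₖ⟩⟨gₖ| (`posTrace_abs_le`).
Densities are compared through their Fourier coefficients, which are sums along the diagonals of the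
operator (`DensC`).

The nonlinear problem is a fixed point for the density in the unit ball of L² over a time interval
(`IsDensityFlow.extend`). The admissible length depends on the trace norm of γ₀ only, so the same
step can be repeated forever: solutions are global, and the blowup alternative holds because its
premise fails. The difference estimate `IsFlow.n2_density_sub_le` yields contraction, uniqueness and
Lipschitz dependence alike.

Ill-posedness comes from |e_n|² = 1/(2π) for every n. The operator c∑_{n≤N}|e_n⟩⟨e_n| has the
constant density cN/(2π); a constant potential only rotates the phase of each e_n, so the state is
stationary. Its 𝔖^α norm is cN^(1/α), which for α > 1 can tend to 0 while cN does not. -/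

theorem volume_circ : (volume : Measure Circ) =
    ENNReal.ofReal (2 * Real.pi) • AddCircle.haarAddCircle :=
  AddCircle.volume_eq_smul_haarAddCircle

theorem integral_fourier (k : ℤ) :
    ∫ x : Circ, fourier k x = if k = 0 then (2 * Real.pi : ℂ) else 0 := by
  rw [volume_circ, integral_smul_measure]
  split_ifs with h
  · subst h
    simp [Real.pi_pos.le]
  · have := integral_eq_zero_of_add_right_eq_neg (μ := AddCircle.haarAddCircle)
      (fourier_add_half_inv_index h Real.two_pi_pos)
    rw [this, smul_zero]

theorem e_ae (n : ℤ) : (e n : Circ → ℂ) =ᵐ[volume]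
    fun x => ((1 / Real.sqrt (2 * Real.pi) : ℝ) : ℂ) * fourier n x := by
  unfold e
  filter_upwards [Lp.coeFn_smul ((1 / Real.sqrt (2 * Real.pi) : ℝ) : ℂ)
    (ContinuousMap.toLp 2 (volume : Measure Circ) ℂ (fourier n)),
    ContinuousMap.coeFn_toLp (p := 2) (𝕜 := ℂ) (volume : Measure Circ) (fourier n)] with x h1 h2
  rw [h1, Pi.smul_apply, h2, smul_eq_mul]

theorem inv_sqrt_two_pi_sq :
    ((1 / Real.sqrt (2 * Real.pi) : ℝ) : ℂ) * ((1 / Real.sqrt (2 * Real.pi) : ℝ) : ℂ)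
      = (2 * Real.pi : ℂ)⁻¹ := by
  rw [← Complex.ofReal_mul, ← sq, div_pow, Real.sq_sqrt Real.two_pi_pos.le]
  push_cast; simp

theorem orthonormal_e : Orthonormal ℂ e := by
  rw [orthonormal_iff_ite]
  intro i j
  rw [L2.inner_def]
  have : ∀ᵐ x : Circ, inner ℂ (e i x) (e j x) = (2 * Real.pi : ℂ)⁻¹ * fourier (j - i) x := by
    filter_upwards [e_ae i, e_ae j] with x h1 h2
    rw [h1, h2, RCLike.inner_apply, map_mul, Complex.conj_ofReal, sub_eq_add_neg, fourier_add,
      fourier_neg, ← inv_sqrt_two_pi_sq]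
    ring
  rw [integral_congr_ae this, integral_const_mul, integral_fourier]
  have hpi : (2 * Real.pi : ℂ) ≠ 0 := by exact_mod_cast Real.two_pi_pos.ne'
  by_cases h : i = j
  · subst h; rw [if_pos rfl, if_pos (sub_self i), inv_mul_cancel₀ hpi]
  · rw [if_neg h, if_neg (fun h' => h (sub_eq_zero.mp h').symm), mul_zero]

theorem dense_span_e : ⊤ ≤ (Submodule.span ℂ (Set.range e)).topologicalClosure := by
  have h := (ContinuousMap.toLp_denseRange ℂ (volume : Measure Circ) ℂ
    (p := 2) (by simp)).topologicalClosure_map_submodule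
      (span_fourier_closure_eq_top (T := 2 * Real.pi))
  rw [← h, Submodule.map_span]
  apply Submodule.topologicalClosure_mono
  rw [Submodule.span_le]
  rintro _ ⟨_, ⟨n, rfl⟩, rfl⟩
  have hc : ((1 / Real.sqrt (2 * Real.pi) : ℝ) : ℂ) ≠ 0 := by
    simpa using (Real.sqrt_pos.mpr Real.pi_pos).ne'
  have : (ContinuousMap.toLp 2 (volume : Measure Circ) ℂ (fourier n) : L2) =
      ((1 / Real.sqrt (2 * Real.pi) : ℝ) : ℂ)⁻¹ • e n := by
    unfold e; rw [smul_smul, inv_mul_cancel₀ hc, one_smul]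
  change (ContinuousMap.toLp 2 (volume : Measure Circ) ℂ (fourier n) : L2) ∈ _
  rw [this]
  exact Submodule.smul_mem _ _ (Submodule.subset_span ⟨n, rfl⟩)

/-- The Hilbert basis `(e_n)`. -/
noncomputable def eb : HilbertBasis ℤ ℂ L2 := HilbertBasis.mk orthonormal_e dense_span_e

theorem eb_apply (n : ℤ) : eb n = e n := by
  unfold eb; rw [HilbertBasis.coe_mk]

theorem eb_repr (f : L2) (n : ℤ) : eb.repr f n = inner ℂ (e n) f := by
  rw [HilbertBasis.repr_apply_apply, eb_apply]

theorem ext_coef {f g : L2} (h : ∀ n, inner ℂ (e n) f = inner ℂ (e n) g) : f = g := by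
  apply eb.repr.injective
  ext n
  rw [eb_repr, eb_repr, h]

theorem hasSum_norm_coef_sq (f : L2) :
    HasSum (fun n => ‖inner ℂ (e n) f‖ ^ 2) (‖f‖ ^ 2) := by
  have h := lp.hasSum_norm (p := 2) (by norm_num) (eb.repr f)
  simp only [eb_repr, LinearIsometryEquiv.norm_map] at h
  simpa using h

theorem hasSum_coef_smul (f : L2) : HasSum (fun n => inner ℂ (e n) f • e n) f := by
  have h := eb.hasSum_repr f
  simpa only [eb_repr, eb_apply] using h

/-- An element of `L²` with given square-summable coefficients. -/
theorem exists_of_coef (c : ℤ → ℂ) (M : ℝ) (hM : 0 ≤ M)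
    (h : ∀ s : Finset ℤ, ∑ n ∈ s, ‖c n‖ ^ 2 ≤ M ^ 2) :
    ∃ f : L2, (∀ n, inner ℂ (e n) f = c n) ∧ ‖f‖ ≤ M := by
  have hs : Summable fun n => ‖c n‖ ^ 2 :=
    summable_of_sum_le (fun _ => by positivity) h
  have hmem : Memℓp c 2 := by
    rw [memℓp_gen_iff (by norm_num)]
    simpa using hs
  have hc : ∀ n, inner ℂ (e n) (eb.repr.symm ⟨c, hmem⟩) = c n := by
    intro n
    rw [← eb_repr, LinearIsometryEquiv.apply_symm_apply]
  refine ⟨eb.repr.symm ⟨c, hmem⟩, hc, ?_⟩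
  have h1 := hasSum_norm_coef_sq (eb.repr.symm ⟨c, hmem⟩)
  simp only [hc] at h1
  have h2 : ‖eb.repr.symm ⟨c, hmem⟩‖ ^ 2 ≤ M ^ 2 :=
    hasSum_le_of_sum_le h1 h
  exact abs_le_of_sq_le_sq' h2 hM |>.2

/-! ### The free evolution -/

/-- The phase `e^{-itn²}`. -/
noncomputable def phase (t : ℝ) (n : ℤ) : ℂ := Complex.exp (-Complex.I * t * n ^ 2)

theorem phase_eq (t : ℝ) (n : ℤ) : phase t n = Complex.exp ((-(t * n ^ 2) : ℝ) * Complex.I) := by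
  unfold phase; congr 1; push_cast; ring

theorem norm_phase (t : ℝ) (n : ℤ) : ‖phase t n‖ = 1 := by
  rw [phase_eq, Complex.norm_exp_ofReal_mul_I]

theorem phase_add (s t : ℝ) (n : ℤ) : phase (s + t) n = phase s n * phase t n := by
  unfold phase; rw [← Complex.exp_add]; congr 1; push_cast; ring

theorem phase_zero (n : ℤ) : phase 0 n = 1 := by simp [phase]

theorem phase_neg_mul (t : ℝ) (n : ℤ) : phase (-t) n * phase t n = 1 := by
  rw [← phase_add, neg_add_cancel, phase_zero]

theorem conj_phase (t : ℝ) (n : ℤ) : (starRingEnd ℂ) (phase t n) = phase (-t) n := by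
  rw [phase_eq, phase_eq, ← Complex.exp_conj, map_mul, Complex.conj_ofReal, Complex.conj_I]
  congr 1; push_cast; ring

theorem continuous_phase (n : ℤ) : Continuous fun t => phase t n := by
  unfold phase; fun_prop

theorem exists_free (t : ℝ) (φ : L2) :
    ∃ f : L2, ∀ n, inner ℂ (e n) f = phase t n * inner ℂ (e n) φ := by
  obtain ⟨f, hf, -⟩ := exists_of_coef (fun n => phase t n * inner ℂ (e n) φ) ‖φ‖
    (norm_nonneg _) (fun s => by
      simp only [norm_mul, norm_phase, one_mul]
      exact sum_le_hasSum s (fun _ _ => by positivity) (hasSum_norm_coef_sq φ))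
  exact ⟨f, hf⟩

/-- The free Schrödinger evolution `e^{itΔ}`. -/
noncomputable def free (t : ℝ) : L2 →ₗᵢ[ℂ] L2 where
  toFun φ := (exists_free t φ).choose
  map_add' φ ψ := by
    apply ext_coef
    intro n
    rw [inner_add_right, (exists_free t (φ + ψ)).choose_spec n, (exists_free t φ).choose_spec n,
      (exists_free t ψ).choose_spec n, inner_add_right]
    ring
  map_smul' c φ := by
    apply ext_coef
    intro n
    rw [RingHom.id_apply, inner_smul_right, (exists_free t (c • φ)).choose_spec n,
      (exists_free t φ).choose_spec n, inner_smul_right]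
    ring
  norm_map' φ := by
    have h1 := hasSum_norm_coef_sq ((exists_free t φ).choose)
    simp only [(exists_free t _).choose_spec, norm_mul, norm_phase, one_mul] at h1
    have := h1.unique (hasSum_norm_coef_sq φ)
    exact (sq_eq_sq₀ (norm_nonneg _) (norm_nonneg _)).mp this

theorem coef_free (t : ℝ) (φ : L2) (n : ℤ) :
    inner ℂ (e n) (free t φ) = phase t n * inner ℂ (e n) φ :=
  (exists_free t φ).choose_spec n

theorem free_zero (φ : L2) : free 0 φ = φ :=
  ext_coef fun n => by rw [coef_free, phase_zero, one_mul]

theorem free_add (s t : ℝ) (φ : L2) : free (s + t) φ = free s (free t φ) :=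
  ext_coef fun n => by rw [coef_free, coef_free, coef_free, phase_add, mul_assoc]

theorem free_neg_free (t : ℝ) (φ : L2) : free (-t) (free t φ) = φ := by
  rw [← free_add, neg_add_cancel, free_zero]

theorem free_free_neg (t : ℝ) (φ : L2) : free t (free (-t) φ) = φ := by
  rw [← free_add, add_neg_cancel, free_zero]

/-- Dominated convergence in Parseval's sum: each phase is continuous, and two phases differ by at
most 2, whence the majorant with factor 4. -/
theorem continuous_free_apply (φ : L2) : Continuous fun t => free t φ := by
  rw [continuous_iff_continuousAt]
  intro s
  rw [ContinuousAt, tendsto_iff_norm_sub_tendsto_zero]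
  have key : Tendsto (fun t => ∑' n, ‖inner ℂ (e n) (free t φ - free s φ)‖ ^ 2) (𝓝 s)
      (𝓝 (∑' _ : ℤ, (0 : ℝ))) := by
    apply tendsto_tsum_of_dominated_convergence
      (bound := fun n => 4 * ‖inner ℂ (e n) φ‖ ^ 2)
    · exact (hasSum_norm_coef_sq φ).summable.mul_left 4
    · intro n
      have h1 : Continuous fun t => ‖inner ℂ (e n) (free t φ - free s φ)‖ ^ 2 := by
        simp only [inner_sub_right, coef_free]
        have := continuous_phase n
        fun_prop
      have h2 := h1.tendsto s
      simpa using h2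
    · refine Eventually.of_forall fun t n => ?_
      rw [inner_sub_right, coef_free, coef_free, ← sub_mul, norm_pow, norm_norm, norm_mul, mul_pow]
      gcongr
      have : ‖phase t n - phase s n‖ ≤ 2 := by
        refine (norm_sub_le _ _).trans ?_
        rw [norm_phase, norm_phase]; norm_num
      nlinarith [norm_nonneg (phase t n - phase s n)]
  simp only [(hasSum_norm_coef_sq _).tsum_eq, tsum_zero] at key
  have := key.sqrt
  simpa using this

theorem continuous_free : Continuous fun p : ℝ × L2 => free p.1 p.2 := by
  rw [continuous_iff_continuousAt]
  rintro ⟨s, φ⟩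
  rw [ContinuousAt, tendsto_iff_norm_sub_tendsto_zero]
  have h1 : Tendsto (fun p : ℝ × L2 => ‖p.2 - φ‖ + ‖free p.1 φ - free s φ‖) (𝓝 (s, φ)) (𝓝 0) := by
    have : Continuous fun p : ℝ × L2 => ‖p.2 - φ‖ + ‖free p.1 φ - free s φ‖ := by
      have := (continuous_free_apply φ).comp (continuous_fst (X := ℝ) (Y := L2))
      have h3 : Continuous fun p : ℝ × L2 => free p.1 φ := this
      fun_prop
    simpa using this.tendsto (s, φ)
  refine squeeze_zero (fun _ => norm_nonneg _) (fun p => ?_) h1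
  have : free p.1 p.2 - free s φ = free p.1 (p.2 - φ) + (free p.1 φ - free s φ) := by
    rw [map_sub]; abel
  calc ‖free p.1 p.2 - free s φ‖ ≤ ‖free p.1 (p.2 - φ)‖ + ‖free p.1 φ - free s φ‖ := by
        rw [this]; exact norm_add_le _ _
    _ = _ := by rw [LinearIsometry.norm_map]

/-! ### The fourth power of the `L⁴` norm on `L²` -/

/-- `∫ |f|⁴`, possibly infinite. -/
noncomputable def quart (f : L2) : ℝ≥0∞ := ∫⁻ x : Circ, ‖f x‖ₑ ^ 4

theorem exists_seq_ae_tendsto {f : L2} {g : ℕ → L2} (h : Tendsto g atTop (𝓝 f)) :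
    ∃ ns : ℕ → ℕ, StrictMono ns ∧ ∀ᵐ x : Circ, Tendsto (fun i => g (ns i) x) atTop (𝓝 (f x)) :=
  (tendstoInMeasure_of_tendsto_Lp h).exists_seq_tendsto_ae

/-- Fatou's lemma along a subsequence that converges almost everywhere. As `quart` is infinite on
part of L², this substitutes for continuity: it makes `quart` Borel and lets L⁴ bounds pass to L²
limits. -/
theorem lowerSemicontinuous_quart : LowerSemicontinuous quart := by
  rw [lowerSemicontinuous_iff_le_liminf]
  intro f
  obtain ⟨g, hgl, hg⟩ := exists_seq_tendsto_liminf (f := 𝓝 f) (u := quart)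
  obtain ⟨ns, hns, hae⟩ := exists_seq_ae_tendsto hg
  have h1 := hgl.comp hns.tendsto_atTop
  rw [← h1.liminf_eq]
  calc quart f = ∫⁻ x : Circ, liminf (fun i => ‖g (ns i) x‖ₑ ^ 4) atTop := by
        refine lintegral_congr_ae ?_
        filter_upwards [hae] with x hx
        exact ((ENNReal.continuous_pow 4).tendsto _ |>.comp hx.enorm).liminf_eq.symm
    _ ≤ _ := lintegral_liminf_le' fun i => by
        exact ((Lp.aestronglyMeasurable (g (ns i))).enorm.pow_const 4)

theorem aemeasurable_quart {μ : Measure ℝ} {u : ℝ → L2} (hu : AEStronglyMeasurable u μ) :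
    AEMeasurable (fun t => quart (u t)) μ := by
  borelize L2
  exact lowerSemicontinuous_quart.measurable.comp_aemeasurable hu.aemeasurable

theorem quart_zero : quart 0 = 0 := by
  unfold quart
  rw [lintegral_congr_ae (g := fun _ => 0), lintegral_zero]
  simp

theorem quart_smul (c : ℂ) (f : L2) : quart (c • f) = ‖c‖ₑ ^ 4 * quart f := by
  unfold quart
  rw [← lintegral_const_mul' _ _ (by simp)]
  refine lintegral_congr_ae ?_
  filter_upwards [Lp.coeFn_smul c f] with x hx
  rw [hx, Pi.smul_apply, enorm_smul, mul_pow]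

/-! ### Free waves with finitely many frequencies -/

/-- The finite sum `∑ aₙ eₙ`, as a continuous function. -/
noncomputable def trigPoly (F : Finset ℤ) (a : ℤ → ℂ) : C(Circ, ℂ) :=
  ∑ n ∈ F, (a n * ((1 / Real.sqrt (2 * Real.pi) : ℝ) : ℂ)) • (fourier n : C(Circ, ℂ))

theorem toLp_trigPoly (F : Finset ℤ) (a : ℤ → ℂ) :
    ContinuousMap.toLp 2 (volume : Measure Circ) ℂ (trigPoly F a) = ∑ n ∈ F, a n • e n := by
  unfold trigPoly e
  rw [map_sum]
  refine Finset.sum_congr rfl fun n _ => ?_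
  rw [map_smul, smul_smul]

/-- Only the pairs m = n + k survive integration against `e k`. When n + k leaves `F`, the vanishing
of `a` off `F` makes the formula correct. -/
theorem coef_mul_conj (F : Finset ℤ) (a : ℤ → ℂ) (ha : ∀ n ∉ F, a n = 0) (k : ℤ) :
    inner ℂ (e k) (ContinuousMap.toLp 2 (volume : Measure Circ) ℂ
      (trigPoly F a * star (trigPoly F a))) =
    ((1 / Real.sqrt (2 * Real.pi) : ℝ) : ℂ) *
      ∑ n ∈ F, a (n + k) * (starRingEnd ℂ) (a n) := by
  set κ : ℂ := ((1 / Real.sqrt (2 * Real.pi) : ℝ) : ℂ) with hκ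
  rw [L2.inner_def]
  have h1 : ∀ᵐ x : Circ, inner ℂ (e k x) (ContinuousMap.toLp 2 (volume : Measure Circ) ℂ
      (trigPoly F a * star (trigPoly F a)) x) = ∑ n ∈ F, ∑ m ∈ F,
        κ * (2 * Real.pi : ℂ)⁻¹ * (a m * (starRingEnd ℂ) (a n)) * fourier (m - n - k) x := by
    filter_upwards [e_ae k, ContinuousMap.coeFn_toLp (p := 2) (𝕜 := ℂ) (volume : Measure Circ)
      (trigPoly F a * star (trigPoly F a))] with x h1 h2
    rw [h1, h2, RCLike.inner_apply, map_mul, Complex.conj_ofReal]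
    have h3 : (trigPoly F a * star (trigPoly F a)) x =
        ∑ n ∈ F, ∑ m ∈ F, (a m * κ * fourier m x) * (starRingEnd ℂ) (a n * κ * fourier n x) := by
      simp only [trigPoly, ContinuousMap.mul_apply, ContinuousMap.star_apply,
        ContinuousMap.sum_apply, ContinuousMap.smul_apply, smul_eq_mul, RCLike.star_def, map_sum]
      rw [Finset.sum_mul_sum, Finset.sum_comm]
    rw [h3, Finset.sum_mul]
    refine Finset.sum_congr rfl fun n _ => ?_
    rw [Finset.sum_mul]
    refine Finset.sum_congr rfl fun m _ => ?_
    rw [sub_eq_add_neg, sub_eq_add_neg, fourier_add, fourier_add, fourier_neg, fourier_neg,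
      ← inv_sqrt_two_pi_sq, map_mul, map_mul, Complex.conj_ofReal]
    ring
  rw [integral_congr_ae h1]
  have hint : ∀ (c : ℂ) (j : ℤ), Integrable (fun x : Circ => c * fourier j x) := fun c j =>
    ((map_continuous (fourier j : C(Circ, ℂ))).integrable_of_hasCompactSupport
      (HasCompactSupport.of_compactSpace _)).const_mul c
  rw [integral_finsetSum _ fun n _ => integrable_finsetSum _ fun m _ => hint _ _, Finset.mul_sum]
  refine Finset.sum_congr rfl fun n _ => ?_
  rw [integral_finsetSum _ fun m _ => hint _ _]
  have hpi : (2 * Real.pi : ℂ) ≠ 0 := by exact_mod_cast Real.two_pi_pos.ne'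
  rw [Finset.sum_eq_single (n + k)]
  · rw [integral_const_mul, integral_fourier, if_pos (by ring)]
    field_simp
  · intro m _ hm
    rw [integral_const_mul, integral_fourier, if_neg (fun h => hm (by linarith)), mul_zero]
  · intro hm
    rw [ha _ hm]; simp

/-- Parseval's identity for |f|², whose squared L² norm is `quart f`. -/
theorem quart_trigPoly (F : Finset ℤ) (a : ℤ → ℂ) (ha : ∀ n ∉ F, a n = 0) :
    quart (∑ n ∈ F, a n • e n) ≤ ∑' k : ℤ, ‖∑ n ∈ F, a (n + k) * (starRingEnd ℂ) (a n)‖ₑ ^ 2 := by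
  set P := trigPoly F a
  set f : L2 := ContinuousMap.toLp 2 (volume : Measure Circ) ℂ (P * star P)
  have h1 : quart (∑ n ∈ F, a n • e n) = ‖f‖ₑ ^ 2 := by
    have h2 : ‖f‖ₑ = (∫⁻ x, ‖f x‖ₑ ^ (2 : ℝ)) ^ (1 / (2 : ℝ)) := by
      rw [Lp.enorm_def, eLpNorm_eq_lintegral_rpow_enorm_toReal (by norm_num) (by norm_num)]
      simp
    rw [h2, ← ENNReal.rpow_natCast, ← ENNReal.rpow_mul]
    norm_num
    unfold quart
    rw [← toLp_trigPoly]
    refine lintegral_congr_ae ?_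
    filter_upwards [ContinuousMap.coeFn_toLp (p := 2) (𝕜 := ℂ) (volume : Measure Circ) P,
      ContinuousMap.coeFn_toLp (p := 2) (𝕜 := ℂ) (volume : Measure Circ) (P * star P)] with x h1 h2
    rw [h1, h2, ContinuousMap.mul_apply, ContinuousMap.star_apply, enorm_mul,
      ← ofReal_norm (star (P x)), norm_star, ofReal_norm, mul_pow, ← pow_add]
  have h3 : ‖f‖ₑ ^ 2 = ∑' k : ℤ, ‖inner ℂ (e k) f‖ₑ ^ 2 := by
    have := hasSum_norm_coef_sq f
    have h4 := ENNReal.ofReal_tsum_of_nonneg (fun n => by positivity) this.summable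
    rw [this.tsum_eq] at h4
    simpa only [ENNReal.ofReal_pow (norm_nonneg _), ofReal_norm] using h4
  rw [h1, h3]
  refine ENNReal.tsum_le_tsum fun k => ?_
  rw [coef_mul_conj F a ha k, enorm_mul, mul_pow]
  -- The squared factor (2π)^(-1/2) from `coef_mul_conj` is at most 1 and is dropped.
  refine mul_le_of_le_one_left (by positivity) ?_
  refine pow_le_one₀ (by positivity) ?_
  rw [← ofReal_norm, ENNReal.ofReal_le_one, Complex.norm_real, Real.norm_of_nonneg
    (by positivity), div_le_one (Real.sqrt_pos.mpr Real.two_pi_pos)]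
  rw [Real.one_le_sqrt]
  linarith [Real.pi_gt_three]

/-! ### The `L⁴` Strichartz estimate on short time intervals -/

theorem free_e (t : ℝ) (n : ℤ) : free t (e n) = phase t n • e n := by
  apply ext_coef
  intro m
  rw [coef_free, inner_smul_right, orthonormal_iff_ite.mp orthonormal_e m n]
  split_ifs with h
  · rw [h]
  · simp

theorem integral_exp_period (w : ℝ) (hw : w ≠ 0) (a L : ℝ) (j : ℤ) (hL : w * L = 2 * Real.pi * j) :
    ∫ t in a..(a + L), Complex.exp ((w * t : ℝ) * Complex.I) = 0 := by
  have hw' : (w * Complex.I : ℂ) ≠ 0 := by simp [hw]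
  have h1 : ∀ t : ℝ, Complex.exp ((w * t : ℝ) * Complex.I) =
      Complex.exp ((w * Complex.I) * t) := fun t => by congr 1; push_cast; ring
  simp only [h1]
  rw [integral_exp_mul_complex hw']
  have : Complex.exp (w * Complex.I * (a + L : ℝ)) = Complex.exp (w * Complex.I * a) := by
    have h2 : (w * Complex.I * (a + L : ℝ) : ℂ) =
        w * Complex.I * a + j * (2 * Real.pi * Complex.I) := by
      have : (w * L : ℂ) = 2 * Real.pi * j := by exact_mod_cast hL
      push_cast
      linear_combination Complex.I * this
    rw [h2, Complex.exp_add, Complex.exp_int_mul_two_pi_mul_I, mul_one]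
  rw [this, sub_self, zero_div]

theorem integral_normSq_trig (F : Finset ℤ) (c : ℤ → ℂ) (k : ℤ) (hk : k ≠ 0) (a : ℝ) (N : ℕ) :
    ∫ t in a..(a + N * (Real.pi / |(k : ℝ)|)),
      ‖∑ n ∈ F, c n * Complex.exp ((-(2 * k * n) * t : ℝ) * Complex.I)‖ ^ 2 =
    N * (Real.pi / |(k : ℝ)|) * ∑ n ∈ F, ‖c n‖ ^ 2 := by
  set L : ℝ := N * (Real.pi / |(k : ℝ)|) with hLdef
  have hk' : (k : ℝ) ≠ 0 := by exact_mod_cast hk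
  have h1 : ∀ t : ℝ, ((‖∑ n ∈ F, c n * Complex.exp ((-(2 * k * n) * t : ℝ) * Complex.I)‖ ^ 2 : ℝ) : ℂ)
      = ∑ n ∈ F, ∑ m ∈ F, (c n * (starRingEnd ℂ) (c m)) *
        Complex.exp (((2 * k * (m - n)) * t : ℝ) * Complex.I) := by
    intro t
    rw [Complex.ofReal_pow, ← Complex.mul_conj', map_sum, Finset.sum_mul_sum]
    refine Finset.sum_congr rfl fun n _ => Finset.sum_congr rfl fun m _ => ?_
    rw [map_mul, ← Complex.exp_conj, map_mul, Complex.conj_ofReal, Complex.conj_I]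
    have : Complex.exp (((2 * k * (m - n)) * t : ℝ) * Complex.I) =
        Complex.exp ((-(2 * k * n) * t : ℝ) * Complex.I) *
        Complex.exp ((-(2 * k * m) * t : ℝ) * -Complex.I) := by
      rw [← Complex.exp_add]; congr 1; push_cast; ring
    rw [this]; ring
  apply Complex.ofReal_injective
  rw [← intervalIntegral.integral_ofReal]
  simp only [h1]
  have hint : ∀ (z : ℂ) (w : ℝ), IntervalIntegrable
      (fun t : ℝ => z * Complex.exp ((w * t : ℝ) * Complex.I)) volume a (a + L) := fun z w =>
    Continuous.intervalIntegrable (by fun_prop) _ _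
  have h2 : ∀ n ∈ F, ∫ t in a..(a + L), ∑ m ∈ F, (c n * (starRingEnd ℂ) (c m)) *
        Complex.exp (((2 * k * (m - n)) * t : ℝ) * Complex.I) = L * (‖c n‖ ^ 2 : ℝ) := by
    intro n hn
    rw [intervalIntegral.integral_finsetSum fun m _ => hint _ _, Finset.sum_eq_single n]
    · simp [Complex.mul_conj']
    · intro m _ hm
      have hmn : (m : ℝ) - n ≠ 0 := sub_ne_zero.mpr (by exact_mod_cast hm)
      -- During N periods of length π/|k| the frequency 2k(m − n) makes (m − n)·N·sign k full turns.
      rw [intervalIntegral.integral_const_mul,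
        integral_exp_period _ (by positivity) a L ((m - n) * N * k.sign), mul_zero]
      rw [hLdef]
      have hs : (k : ℝ) = |(k : ℝ)| * (k.sign : ℝ) := by
        have := Int.sign_mul_abs k
        have h3 : ((k.sign * |k| : ℤ) : ℝ) = (k : ℝ) := by rw [this]
        push_cast at h3
        linarith
      have habs : |(k : ℝ)| ≠ 0 := abs_ne_zero.mpr hk'
      push_cast
      calc 2 * (k : ℝ) * (m - n) * (N * (Real.pi / |(k : ℝ)|))
          = 2 * (|(k : ℝ)| * (k.sign : ℝ)) * (m - n) * (N * (Real.pi / |(k : ℝ)|)) := by rw [← hs]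
        _ = _ := by field_simp
    · exact fun h => absurd hn h
  rw [intervalIntegral.integral_finsetSum fun n _ =>
    Continuous.intervalIntegrable (by fun_prop) _ _, Finset.sum_congr rfl h2]
  push_cast
  rw [Finset.mul_sum]

theorem lintegral_le_of_integral_le {f : ℝ → ℝ} (hf : Continuous f) (h0 : ∀ t, 0 ≤ f t)
    {a h L C : ℝ} (hh : 0 ≤ h) (hL : h ≤ L) (hC : ∫ t in a..(a + L), f t ≤ C) :
    ∫⁻ t in Set.Ioc a (a + h), ENNReal.ofReal (f t) ≤ ENNReal.ofReal C := by
  have h1 : ∫⁻ t in Set.Ioc a (a + h), ENNReal.ofReal (f t) ≤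
      ∫⁻ t in Set.Ioc a (a + L), ENNReal.ofReal (f t) :=
    lintegral_mono_set (Set.Ioc_subset_Ioc_right (by linarith))
  refine h1.trans ?_
  rw [← ofReal_integral_eq_lintegral_ofReal]
  · rw [← intervalIntegral.integral_of_le (by linarith)]
    exact ENNReal.ofReal_le_ofReal hC
  · exact (intervalIntegrable_iff_integrableOn_Ioc_of_le (by linarith)).mp
      (hf.intervalIntegrable _ _)
  · exact Eventually.of_forall h0

/-- The `k`-th coefficient of the square of a free wave, and its mean square in time. -/
theorem lintegral_coef_le (F : Finset ℤ) (a : ℤ → ℂ) (k : ℤ) (hk : k ≠ 0) (t₀ h : ℝ)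
    (hh : 0 ≤ h) :
    ∫⁻ t in Set.Ioc t₀ (t₀ + h), ‖∑ n ∈ F, phase t (n + k) * a (n + k) *
      (starRingEnd ℂ) (phase t n * a n)‖ₑ ^ 2 ≤
    ENNReal.ofReal (h + Real.pi / |(k : ℝ)|) * ∑ n ∈ F, ‖a (n + k)‖ₑ ^ 2 * ‖a n‖ₑ ^ 2 := by
  have hk' : 0 < |(k : ℝ)| := abs_pos.mpr (by exact_mod_cast hk)
  set p : ℝ := Real.pi / |(k : ℝ)| with hp
  have hp0 : 0 < p := by positivity
  set c : ℤ → ℂ := fun n => a (n + k) * (starRingEnd ℂ) (a n)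
  have h1 : ∀ t : ℝ, ‖∑ n ∈ F, phase t (n + k) * a (n + k) *
      (starRingEnd ℂ) (phase t n * a n)‖ₑ ^ 2 = ENNReal.ofReal
      (‖∑ n ∈ F, c n * Complex.exp ((-(2 * k * n) * t : ℝ) * Complex.I)‖ ^ 2) := by
    intro t
    -- Since (n + k)² − n² = k² + 2kn, the quadratic part of the phase leaves the sum with modulus
    -- one and the remainder is linear in n.
    have h2 : ∑ n ∈ F, phase t (n + k) * a (n + k) * (starRingEnd ℂ) (phase t n * a n) =
        phase t k * ∑ n ∈ F, c n * Complex.exp ((-(2 * k * n) * t : ℝ) * Complex.I) := by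
      rw [Finset.mul_sum]
      refine Finset.sum_congr rfl fun n _ => ?_
      have h3 : phase t (n + k) * phase (-t) n =
          phase t k * Complex.exp ((-(2 * k * n) * t : ℝ) * Complex.I) := by
        rw [phase_eq, phase_eq, phase_eq, ← Complex.exp_add, ← Complex.exp_add]
        congr 1; push_cast; ring
      rw [map_mul, conj_phase]
      linear_combination (a (n + k) * (starRingEnd ℂ) (a n)) * h3
    rw [h2, enorm_mul, ← ofReal_norm (phase t k), norm_phase, ENNReal.ofReal_one, one_mul,
      ENNReal.ofReal_pow (norm_nonneg _), ofReal_norm]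
  simp only [h1]
  -- The interval is enlarged to the least number of full periods that covers it, which costs at
  -- most one period: h + p.
  set N := ⌈h / p⌉₊
  have hN : h ≤ N * p := by
    have := Nat.le_ceil (h / p)
    rwa [div_le_iff₀ hp0] at this
  have hN2 : N * p ≤ h + p := by
    have := (Nat.ceil_lt_add_one (div_nonneg hh hp0.le)).le
    have h4 := mul_le_mul_of_nonneg_right this hp0.le
    rwa [add_mul, div_mul_cancel₀ _ hp0.ne', one_mul] at h4
  refine (lintegral_le_of_integral_le (by fun_prop) (fun t => by positivity) hh hN
    (integral_normSq_trig F c k hk t₀ N).le).trans ?_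
  rw [ENNReal.ofReal_mul (by positivity), ENNReal.ofReal_sum_of_nonneg (fun _ _ => by positivity)]
  gcongr with n hn
  rw [← mul_pow, norm_mul, RCLike.norm_conj, ENNReal.ofReal_pow (by positivity),
    ENNReal.ofReal_mul (by positivity), ofReal_norm, ofReal_norm]

/-- The trivial bound for the mean square in time of a coefficient. -/
theorem lintegral_coef_le_trivial (F : Finset ℤ) (a : ℤ → ℂ) (ha : ∀ n ∉ F, a n = 0) (k : ℤ)
    (t₀ h : ℝ) :
    ∫⁻ t in Set.Ioc t₀ (t₀ + h), ‖∑ n ∈ F, phase t (n + k) * a (n + k) *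
      (starRingEnd ℂ) (phase t n * a n)‖ₑ ^ 2 ≤
    ENNReal.ofReal h * (∑ n ∈ F, ‖a n‖ₑ ^ 2) ^ 2 := by
  have h1 : ∀ t : ℝ, ‖∑ n ∈ F, phase t (n + k) * a (n + k) *
      (starRingEnd ℂ) (phase t n * a n)‖ₑ ^ 2 ≤ (∑ n ∈ F, ‖a n‖ₑ ^ 2) ^ 2 := by
    intro t
    have h2 : ‖∑ n ∈ F, phase t (n + k) * a (n + k) *
      (starRingEnd ℂ) (phase t n * a n)‖ ≤ ∑ n ∈ F, ‖a n‖ ^ 2 := by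
      have h3 : ∑ n ∈ F, ‖a (n + k)‖ ^ 2 ≤ ∑ n ∈ F, ‖a n‖ ^ 2 := by
        rw [← Finset.sum_filter_add_sum_filter_not F (fun n => n + k ∈ F)]
        rw [Finset.sum_eq_zero (s := F.filter fun n => ¬ (n + k ∈ F)), add_zero]
        · have := Finset.sum_map (F.filter fun n => n + k ∈ F) (addRightEmbedding k)
            (fun n => ‖a n‖ ^ 2)
          simp only [addRightEmbedding_apply] at this
          rw [← this]
          apply Finset.sum_le_sum_of_subset_of_nonneg
          · intro n hn
            simp only [Finset.mem_map, Finset.mem_filter, addRightEmbedding_apply] at hn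
            obtain ⟨m, ⟨_, h⟩, rfl⟩ := hn
            exact h
          · intros; positivity
        · intro n hn
          rw [ha _ (Finset.mem_filter.mp hn).2]; simp
      calc _ ≤ ∑ n ∈ F, ‖phase t (n + k) * a (n + k) * (starRingEnd ℂ) (phase t n * a n)‖ :=
            norm_sum_le _ _
        _ ≤ ∑ n ∈ F, (‖a (n + k)‖ ^ 2 / 2 + ‖a n‖ ^ 2 / 2) := by
            refine Finset.sum_le_sum fun n _ => ?_
            rw [norm_mul, norm_mul, RCLike.norm_conj, norm_mul, norm_phase, norm_phase]
            nlinarith [sq_nonneg (‖a (n + k)‖ - ‖a n‖)]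
        _ ≤ _ := by
            rw [Finset.sum_add_distrib, ← Finset.sum_div, ← Finset.sum_div]
            linarith
    gcongr
    rw [← ofReal_norm]
    refine (ENNReal.ofReal_le_ofReal h2).trans ?_
    rw [ENNReal.ofReal_sum_of_nonneg (fun _ _ => by positivity)]
    gcongr with n hn
    rw [ENNReal.ofReal_pow (by positivity), ofReal_norm]
  refine (lintegral_mono h1).trans ?_
  rw [lintegral_const, Measure.restrict_apply_univ, Real.volume_Ioc, add_sub_cancel_left, mul_comm]

theorem tsum_shift_le (F : Finset ℤ) (a : ℤ → ℂ) (ha : ∀ n ∉ F, a n = 0) :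
    ∑' k : ℤ, ∑ n ∈ F, ‖a (n + k)‖ₑ ^ 2 * ‖a n‖ₑ ^ 2 = (∑ n ∈ F, ‖a n‖ₑ ^ 2) ^ 2 := by
  rw [Summable.tsum_finsetSum fun _ _ => ENNReal.summable]
  have h1 : ∀ n : ℤ, ∑' k : ℤ, ‖a (n + k)‖ₑ ^ 2 = ∑ m ∈ F, ‖a m‖ₑ ^ 2 := by
    intro n
    refine ((Equiv.addLeft n).tsum_eq (fun m => ‖a m‖ₑ ^ 2)).trans ?_
    exact tsum_eq_sum fun m hm => by rw [ha m hm]; simp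
  simp only [ENNReal.tsum_mul_right, h1]
  rw [← Finset.mul_sum, sq]

/-- The square-root gain in h comes from splitting the frequencies k of |u|²: low ones see no
oscillation but are few, high ones have a short period and are estimated by orthogonality in time.
-/
theorem strichartz_finite (F : Finset ℤ) (a : ℤ → ℂ) (ha : ∀ n ∉ F, a n = 0) (t₀ h : ℝ)
    (hh : 0 < h) (hh1 : h ≤ 1) :
    ∫⁻ t in Set.Ioc t₀ (t₀ + h), quart (∑ n ∈ F, (phase t n * a n) • e n) ≤
      ENNReal.ofReal (10 * √h) * (∑ n ∈ F, ‖a n‖ₑ ^ 2) ^ 2 := by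
  set M := ∑ n ∈ F, ‖a n‖ₑ ^ 2
  -- Frequencies |k| ≤ K cost (2K + 1)h, the others h + π/K; the choice K ≈ h^(-1/2) makes both of
  -- order √h.
  set K := ⌈(√h)⁻¹⌉₊
  have hs : 0 < √h := Real.sqrt_pos.mpr hh
  have hs1 : √h ≤ 1 := Real.sqrt_le_one.mpr hh1
  have hss : √h * √h = h := Real.mul_self_sqrt hh.le
  have hK1 : (√h)⁻¹ ≤ K := Nat.le_ceil _
  have hK2 : (K : ℝ) ≤ (√h)⁻¹ + 1 := (Nat.ceil_lt_add_one (by positivity)).le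
  have hK0 : 0 < (K : ℝ) := lt_of_lt_of_le (by positivity) hK1
  set g : ℤ → ℝ → ℝ≥0∞ := fun k t => ‖∑ n ∈ F, phase t (n + k) * a (n + k) *
      (starRingEnd ℂ) (phase t n * a n)‖ₑ ^ 2
  have hgm : ∀ k, Measurable (g k) := fun k => by
    have : Continuous (g k) := by
      have := continuous_phase
      apply (ENNReal.continuous_pow 2).comp
      apply Continuous.enorm
      refine continuous_finsetSum _ fun n _ => ?_
      have h1 := this (n + k)
      have h2 := this n
      fun_prop
    exact this.measurable
  calc ∫⁻ t in Set.Ioc t₀ (t₀ + h), quart (∑ n ∈ F, (phase t n * a n) • e n)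
      ≤ ∫⁻ t in Set.Ioc t₀ (t₀ + h), ∑' k, g k t :=
        lintegral_mono fun t => quart_trigPoly F (fun n => phase t n * a n)
          (fun n hn => by rw [ha n hn, mul_zero])
    _ = ∑' k, ∫⁻ t in Set.Ioc t₀ (t₀ + h), g k t := lintegral_tsum fun k => (hgm k).aemeasurable
    _ ≤ ∑' k : ℤ, ((if k ∈ Finset.Icc (-(K : ℤ)) K then ENNReal.ofReal h * M ^ 2 else 0) +
          ENNReal.ofReal (h + Real.pi / K) * ∑ n ∈ F, ‖a (n + k)‖ₑ ^ 2 * ‖a n‖ₑ ^ 2) := by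
        refine ENNReal.tsum_le_tsum fun k => ?_
        split_ifs with hk
        · exact (lintegral_coef_le_trivial F a ha k t₀ h).trans le_self_add
        · rw [zero_add]
          have hkK : (K : ℤ) < |k| := by
            by_contra hcon
            exact hk (Finset.mem_Icc.mpr (abs_le.mp (not_lt.mp hcon)))
          have hk0 : k ≠ 0 := by
            rintro rfl
            rw [abs_zero] at hkK
            omega
          have hkK' : (K : ℝ) ≤ |(k : ℝ)| := by exact_mod_cast hkK.le
          refine (lintegral_coef_le F a k hk0 t₀ h hh.le).trans ?_
          gcongr
    _ = (2 * K + 1) * (ENNReal.ofReal h * M ^ 2) + ENNReal.ofReal (h + Real.pi / K) * M ^ 2 := by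
        rw [ENNReal.tsum_add, ENNReal.tsum_mul_left, tsum_shift_le F a ha,
          tsum_eq_sum (s := Finset.Icc (-(K : ℤ)) K) (fun k hk => if_neg hk),
          Finset.sum_congr rfl (fun k hk => if_pos hk), Finset.sum_const, Int.card_Icc,
          nsmul_eq_mul]
        congr 2
        have : ((K : ℤ) + 1 - -(K : ℤ)).toNat = 2 * K + 1 := by omega
        rw [this]; push_cast; rfl
    _ = ENNReal.ofReal ((2 * K + 1) * h + (h + Real.pi / K)) * M ^ 2 := by
        rw [ENNReal.ofReal_add (p := (2 * K + 1) * h) (by positivity) (by positivity),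
          ENNReal.ofReal_mul (by positivity), ENNReal.ofReal_add (by positivity) zero_le_one,
          ENNReal.ofReal_mul zero_le_two]
        simp only [ENNReal.ofReal_natCast, ENNReal.ofReal_one, ENNReal.ofReal_ofNat]
        ring
    _ ≤ _ := by
        gcongr
        -- In total the factor is at most (2 + π)√h + 4h ≤ (6 + π)√h < 10√h.
        have h1 : Real.pi / K ≤ Real.pi * √h := by
          rw [div_eq_mul_inv]
          gcongr
          exact inv_le_of_inv_le₀ hs hK1
        have h2 : (K : ℝ) * h ≤ √h + h := by
          calc (K : ℝ) * h ≤ ((√h)⁻¹ + 1) * h := by gcongr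
            _ = √h + h := by
              rw [add_mul, one_mul]; congr 1
              rw [inv_mul_eq_div, Real.div_sqrt]
        have h3 : h ≤ √h := by nlinarith
        have := Real.pi_lt_d2
        nlinarith

/-- **Strichartz estimate** on a time interval of length `h ≤ 1`. -/
theorem strichartz (φ : L2) (t₀ h : ℝ) (hh : 0 < h) (hh1 : h ≤ 1) :
    ∫⁻ t in Set.Ioc t₀ (t₀ + h), quart (free t φ) ≤ ENNReal.ofReal (10 * √h) * ‖φ‖ₑ ^ 4 := by
  classical
  obtain ⟨s, hs⟩ := exists_seq_tendsto (atTop : Filter (Finset ℤ))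
  set ψ : ℕ → L2 := fun i => ∑ n ∈ s i, inner ℂ (e n) φ • e n
  have hψ : Tendsto ψ atTop (𝓝 φ) := (hasSum_coef_smul φ).comp hs
  have hfree : ∀ i t, free t (ψ i) =
      ∑ n ∈ s i, (phase t n * (if n ∈ s i then inner ℂ (e n) φ else 0)) • e n := by
    intro i t
    rw [map_sum]
    refine Finset.sum_congr rfl fun n hn => ?_
    rw [if_pos hn, map_smul, free_e, smul_smul, mul_comm (phase t n)]
  have hb : ∀ i, ∫⁻ t in Set.Ioc t₀ (t₀ + h), quart (free t (ψ i)) ≤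
      ENNReal.ofReal (10 * √h) * ‖φ‖ₑ ^ 4 := by
    intro i
    simp only [hfree]
    refine (strichartz_finite (s i) _ (fun n hn => if_neg hn) t₀ h hh hh1).trans ?_
    have h1 : ∑ n ∈ s i, ‖(if n ∈ s i then inner ℂ (e n) φ else 0 : ℂ)‖ₑ ^ 2 ≤ ‖φ‖ₑ ^ 2 := by
      rw [Finset.sum_congr rfl fun n hn => by rw [if_pos hn]]
      have h2 := sum_le_hasSum (s i) (fun _ _ => by positivity) (hasSum_norm_coef_sq φ)
      have h3 := ENNReal.ofReal_le_ofReal h2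
      rw [ENNReal.ofReal_sum_of_nonneg (fun _ _ => by positivity)] at h3
      simpa only [ENNReal.ofReal_pow (norm_nonneg _), ofReal_norm] using h3
    calc _ ≤ ENNReal.ofReal (10 * √h) * (‖φ‖ₑ ^ 2) ^ 2 := by gcongr
      _ = _ := by rw [← pow_mul]
  -- The bound is uniform over Fourier truncations; Fatou's lemma, in space and then in time,
  -- carries it to φ.
  calc ∫⁻ t in Set.Ioc t₀ (t₀ + h), quart (free t φ)
      ≤ ∫⁻ t in Set.Ioc t₀ (t₀ + h), liminf (fun i => quart (free t (ψ i))) atTop := by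
        refine lintegral_mono fun t => ?_
        have h1 : Tendsto (fun i => free t (ψ i)) atTop (𝓝 (free t φ)) :=
          ((free t).continuous.tendsto φ).comp hψ
        exact ((lowerSemicontinuous_iff_le_liminf.mp lowerSemicontinuous_quart _).trans
          (Filter.liminf_le_liminf_of_le h1))
    _ ≤ liminf (fun i => ∫⁻ t in Set.Ioc t₀ (t₀ + h), quart (free t (ψ i))) atTop :=
        lintegral_liminf_le' fun i =>
          aemeasurable_quart (continuous_free_apply (ψ i)).aestronglyMeasurable
    _ ≤ _ := by
        refine (liminf_le_liminf (Eventually.of_forall hb)).trans ?_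
        simp

/-! ### Space-time norms -/

/-- The norm of `u` in `L⁴((a,b] × 𝕋)`. -/
noncomputable def n4 (a b : ℝ) (u : ℝ → L2) : ℝ≥0∞ :=
  (∫⁻ t in Set.Ioc a b, quart (u t)) ^ (1 / 4 : ℝ)

/-- The norm of `V` in `L²((a,b] × 𝕋)`. -/
noncomputable def n2 (a b : ℝ) (V : ℝ → L2) : ℝ≥0∞ :=
  (∫⁻ t in Set.Ioc a b, ‖V t‖ₑ ^ 2) ^ (1 / 2 : ℝ)

theorem rpow_quarter_pow (x : ℝ≥0∞) : (x ^ (1 / 4 : ℝ)) ^ 4 = x := by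
  rw [← ENNReal.rpow_natCast, ← ENNReal.rpow_mul]; norm_num

theorem pow_rpow_quarter (x : ℝ≥0∞) : (x ^ 4) ^ (1 / 4 : ℝ) = x := by
  rw [← ENNReal.rpow_natCast, ← ENNReal.rpow_mul]; norm_num

theorem rpow_half_sq (x : ℝ≥0∞) : (x ^ (1 / 2 : ℝ)) ^ 2 = x := by
  rw [← ENNReal.rpow_natCast, ← ENNReal.rpow_mul]; norm_num

theorem n4_pow (a b : ℝ) (u : ℝ → L2) :
    n4 a b u ^ 4 = ∫⁻ t in Set.Ioc a b, quart (u t) := rpow_quarter_pow _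

theorem n2_sq (a b : ℝ) (V : ℝ → L2) :
    n2 a b V ^ 2 = ∫⁻ t in Set.Ioc a b, ‖V t‖ₑ ^ 2 := rpow_half_sq _

theorem quart_add_le (f g : L2) :
    quart (f + g) ^ (1 / 4 : ℝ) ≤ quart f ^ (1 / 4 : ℝ) + quart g ^ (1 / 4 : ℝ) := by
  have h := ENNReal.lintegral_Lp_add_le (μ := (volume : Measure Circ)) (p := 4)
    (Lp.aestronglyMeasurable f).enorm (Lp.aestronglyMeasurable g).enorm (by norm_num)
  simp only [ENNReal.rpow_ofNat] at h
  refine le_trans ?_ h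
  refine ENNReal.rpow_le_rpow ?_ (by norm_num)
  refine lintegral_mono_ae ?_
  filter_upwards [Lp.coeFn_add f g] with x hx
  rw [hx]
  exact pow_le_pow_left' (enorm_add_le _ _) 4

theorem n4_mono {a b a' b' : ℝ} (ha : a ≤ a') (hb : b' ≤ b) (u : ℝ → L2) :
    n4 a' b' u ≤ n4 a b u :=
  ENNReal.rpow_le_rpow (lintegral_mono_set (Set.Ioc_subset_Ioc ha hb)) (by norm_num)

theorem n2_mono {a b a' b' : ℝ} (ha : a ≤ a') (hb : b' ≤ b) (V : ℝ → L2) :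
    n2 a' b' V ≤ n2 a b V :=
  ENNReal.rpow_le_rpow (lintegral_mono_set (Set.Ioc_subset_Ioc ha hb)) (by norm_num)

theorem n4_congr {a b : ℝ} {u w : ℝ → L2} (h : ∀ t ∈ Set.Ioc a b, u t = w t) :
    n4 a b u = n4 a b w := by
  unfold n4
  rw [setLIntegral_congr_fun measurableSet_Ioc (fun t ht => by rw [h t ht])]

theorem n2_congr {a b : ℝ} {V W : ℝ → L2}
    (h : ∀ᵐ t ∂(volume.restrict (Set.Ioc a b)), V t = W t) : n2 a b V = n2 a b W := by
  unfold n2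
  rw [lintegral_congr_ae (h.mono fun t ht => by rw [ht])]

theorem n4_zero (a b : ℝ) : n4 a b (fun _ => 0) = 0 := by
  simp [n4, quart_zero]

theorem n4_smul (a b : ℝ) (c : ℂ) (u : ℝ → L2) :
    n4 a b (fun t => c • u t) = ‖c‖ₑ * n4 a b u := by
  unfold n4
  simp only [quart_smul]
  rw [lintegral_const_mul' _ _ (by simp), ENNReal.mul_rpow_of_nonneg _ _ (by norm_num),
    pow_rpow_quarter]

theorem n2_smul (a b : ℝ) (c : ℂ) (V : ℝ → L2) :
    n2 a b (fun t => c • V t) = ‖c‖ₑ * n2 a b V := by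
  unfold n2
  simp only [enorm_smul, mul_pow]
  rw [lintegral_const_mul' _ _ (by simp), ENNReal.mul_rpow_of_nonneg _ _ (by norm_num),
    ← ENNReal.rpow_natCast, ← ENNReal.rpow_mul]
  norm_num

theorem n4_add_le {a b : ℝ} {u w : ℝ → L2}
    (hu : AEStronglyMeasurable u (volume.restrict (Set.Ioc a b)))
    (hw : AEStronglyMeasurable w (volume.restrict (Set.Ioc a b))) :
    n4 a b (fun t => u t + w t) ≤ n4 a b u + n4 a b w := by
  have h := ENNReal.lintegral_Lp_add_le (p := 4)
    ((aemeasurable_quart hu).pow_const (1 / 4 : ℝ)) ((aemeasurable_quart hw).pow_const (1 / 4 : ℝ))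
    (by norm_num)
  simp only [ENNReal.rpow_ofNat, rpow_quarter_pow] at h
  refine le_trans ?_ h
  refine ENNReal.rpow_le_rpow (lintegral_mono fun t => ?_) (by norm_num)
  calc quart (u t + w t) = (quart (u t + w t) ^ (1 / 4 : ℝ)) ^ 4 := (rpow_quarter_pow _).symm
    _ ≤ _ := pow_le_pow_left' (quart_add_le _ _) 4

theorem n2_add_le {a b : ℝ} {u w : ℝ → L2}
    (hu : AEStronglyMeasurable u (volume.restrict (Set.Ioc a b)))
    (hw : AEStronglyMeasurable w (volume.restrict (Set.Ioc a b))) :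
    n2 a b (fun t => u t + w t) ≤ n2 a b u + n2 a b w := by
  have h := ENNReal.lintegral_Lp_add_le (p := 2) hu.enorm hw.enorm (by norm_num)
  simp only [ENNReal.rpow_ofNat] at h
  refine le_trans ?_ h
  refine ENNReal.rpow_le_rpow (lintegral_mono fun t => ?_) (by norm_num)
  exact pow_le_pow_left' (enorm_add_le _ _) 2

theorem n4_le_liminf {a b : ℝ} {u : ℝ → L2} {w : ℕ → ℝ → L2}
    (hw : ∀ j, AEStronglyMeasurable (w j) (volume.restrict (Set.Ioc a b)))
    (h : ∀ t ∈ Set.Ioc a b, Tendsto (fun j => w j t) atTop (𝓝 (u t))) {C : ℝ≥0∞}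
    (hC : ∀ j, n4 a b (w j) ≤ C) : n4 a b u ≤ C := by
  have h1 : ∫⁻ t in Set.Ioc a b, quart (u t) ≤ C ^ 4 := by
    calc ∫⁻ t in Set.Ioc a b, quart (u t)
        ≤ ∫⁻ t in Set.Ioc a b, liminf (fun j => quart (w j t)) atTop :=
          setLIntegral_mono' measurableSet_Ioc fun t ht =>
            (lowerSemicontinuous_iff_le_liminf.mp lowerSemicontinuous_quart _).trans
              (Filter.liminf_le_liminf_of_le (h t ht))
      _ ≤ liminf (fun j => ∫⁻ t in Set.Ioc a b, quart (w j t)) atTop :=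
          lintegral_liminf_le' fun j => aemeasurable_quart (hw j)
      _ ≤ liminf (fun _ : ℕ => C ^ 4) atTop :=
          liminf_le_liminf (Eventually.of_forall fun j => by
            rw [← n4_pow]; exact pow_le_pow_left' (hC j) 4)
      _ ≤ C ^ 4 := by simp
  calc n4 a b u ≤ (C ^ 4) ^ (1 / 4 : ℝ) := ENNReal.rpow_le_rpow h1 (by norm_num)
    _ = C := pow_rpow_quarter C

/-- Minkowski's inequality for the partial sums, Fatou's lemma for the limit. -/
theorem n4_tsum_le {a b : ℝ} {u : ℝ → L2} {d : ℕ → ℝ → L2}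
    (hd : ∀ j, AEStronglyMeasurable (d j) (volume.restrict (Set.Ioc a b)))
    (h : ∀ t ∈ Set.Ioc a b, HasSum (fun j => d j t) (u t)) :
    n4 a b u ≤ ∑' j, n4 a b (d j) := by
  have hm : ∀ j, AEStronglyMeasurable (fun t => ∑ i ∈ Finset.range j, d i t)
      (volume.restrict (Set.Ioc a b)) := fun j => by
    have := Finset.aestronglyMeasurable_sum (Finset.range j) fun i _ => hd i
    refine this.congr (Eventually.of_forall fun t => ?_)
    simp
  refine n4_le_liminf hm (fun t ht => (h t ht).tendsto_sum_nat) fun j => ?_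
  refine le_trans ?_ (ENNReal.sum_le_tsum (Finset.range j))
  induction j with
  | zero => simp [n4_zero]
  | succ j ih =>
    simp only [Finset.sum_range_succ]
    exact (n4_add_le (hm j) (hd j)).trans (by gcongr)

/-- Hölder's inequality in space. -/
theorem lintegral_mul_mul_le (f V g : L2) :
    ∫⁻ x : Circ, ‖f x‖ₑ * ‖V x‖ₑ * ‖g x‖ₑ ≤
      quart f ^ (1 / 4 : ℝ) * ‖V‖ₑ * quart g ^ (1 / 4 : ℝ) := by
  have h := ENNReal.lintegral_prod_norm_pow_le (μ := (volume : Measure Circ)) (Finset.univ : Finset (Fin 3))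
    (f := ![fun x => ‖f x‖ₑ ^ 4, fun x => ‖V x‖ₑ ^ 2, fun x => ‖g x‖ₑ ^ 4])
    (p := ![1 / 4, 1 / 2, 1 / 4])
    (fun i _ => by
      fin_cases i
      · exact (Lp.aestronglyMeasurable f).enorm.pow_const 4
      · exact (Lp.aestronglyMeasurable V).enorm.pow_const 2
      · exact (Lp.aestronglyMeasurable g).enorm.pow_const 4)
    (by simp [Fin.sum_univ_three]; norm_num) (fun i _ => by fin_cases i <;> norm_num)
  simp only [Fin.prod_univ_three, Matrix.cons_val_zero, Matrix.cons_val_one, Matrix.cons_val] at h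
  have hV : ‖V‖ₑ = (∫⁻ x, ‖V x‖ₑ ^ 2) ^ (1 / (2 : ℝ)) := by
    rw [Lp.enorm_def, eLpNorm_eq_lintegral_rpow_enorm_toReal (by norm_num) (by norm_num)]
    simp
  rw [hV]
  refine le_trans (le_of_eq ?_) h
  refine lintegral_congr fun x => ?_
  rw [pow_rpow_quarter, pow_rpow_quarter, ← ENNReal.rpow_natCast, ← ENNReal.rpow_mul]
  norm_num

/-- Hölder's inequality in time. -/
theorem lintegral_quart_mul_le {a b : ℝ} {f V g : ℝ → L2}
    (hf : AEStronglyMeasurable f (volume.restrict (Set.Ioc a b)))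
    (hV : AEStronglyMeasurable V (volume.restrict (Set.Ioc a b)))
    (hg : AEStronglyMeasurable g (volume.restrict (Set.Ioc a b))) :
    ∫⁻ t in Set.Ioc a b, quart (f t) ^ (1 / 4 : ℝ) * ‖V t‖ₑ * quart (g t) ^ (1 / 4 : ℝ) ≤
      n4 a b f * n2 a b V * n4 a b g := by
  have h := ENNReal.lintegral_prod_norm_pow_le (μ := volume.restrict (Set.Ioc a b))
    (Finset.univ : Finset (Fin 3))
    (f := ![fun t => quart (f t), fun t => ‖V t‖ₑ ^ 2, fun t => quart (g t)])
    (p := ![1 / 4, 1 / 2, 1 / 4])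
    (fun i _ => by
      fin_cases i
      · exact aemeasurable_quart hf
      · exact hV.enorm.pow_const 2
      · exact aemeasurable_quart hg)
    (by simp [Fin.sum_univ_three]; norm_num) (fun i _ => by fin_cases i <;> norm_num)
  simp only [Fin.prod_univ_three, Matrix.cons_val_zero, Matrix.cons_val_one, Matrix.cons_val] at h
  refine le_trans (le_of_eq ?_) h
  refine lintegral_congr fun t => ?_
  congr 2
  rw [← ENNReal.rpow_natCast, ← ENNReal.rpow_mul]
  norm_num

/-! ### Strichartz estimates for free waves and for waves with a moving profile -/

/-- The constant in the Strichartz estimate on an interval of length `h ≤ 1`. -/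
noncomputable def strC (h : ℝ) : ℝ≥0∞ := ENNReal.ofReal (2 * h ^ (1 / 8 : ℝ))

theorem strC_mono {h h' : ℝ} (h0 : 0 ≤ h) (hh : h ≤ h') : strC h ≤ strC h' := by
  unfold strC; gcongr

theorem strC_lt_top (h : ℝ) : strC h < ⊤ := ENNReal.ofReal_lt_top

/-- This closes the induction in `n4_dyadic_le`: halving the interval gains 2^(-1/8) ≤ 12/13,
because (13/12)⁸ < 2. -/
theorem strC_half (h : ℝ) (hh : 0 ≤ h) : 13 * strC (h / 2) ≤ 12 * strC h := by
  unfold strC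
  rw [← ENNReal.ofReal_ofNat 13, ← ENNReal.ofReal_ofNat 12, ← ENNReal.ofReal_mul (by norm_num),
    ← ENNReal.ofReal_mul (by norm_num)]
  apply ENNReal.ofReal_le_ofReal
  rw [Real.div_rpow hh (by norm_num)]
  have h1 : (13 / 12 : ℝ) ≤ 2 ^ (1 / 8 : ℝ) := by
    have : (13 / 12 : ℝ) = ((13 / 12 : ℝ) ^ (8 : ℝ)) ^ (1 / 8 : ℝ) := by
      rw [← Real.rpow_mul (by norm_num)]; norm_num
    rw [this]
    apply Real.rpow_le_rpow (by positivity) _ (by norm_num)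
    norm_num
  have h2 : 0 ≤ h ^ (1 / 8 : ℝ) := by positivity
  rw [mul_div_assoc', mul_div_assoc', div_le_iff₀ (by positivity)]
  nlinarith

theorem tendsto_strC : Tendsto strC (𝓝 0) (𝓝 0) := by
  have h1 : Continuous fun h : ℝ => 2 * h ^ (1 / 8 : ℝ) :=
    continuous_const.mul (Real.continuous_rpow_const (by norm_num))
  have h2 := (ENNReal.continuous_ofReal.comp h1).tendsto 0
  rwa [Function.comp_apply, Real.zero_rpow (by norm_num), mul_zero, ENNReal.ofReal_zero] at h2

theorem n4_free_le (φ : L2) (a b : ℝ) (h1 : b - a ≤ 1) :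
    n4 a b (fun t => free t φ) ≤ strC (b - a) * ‖φ‖ₑ := by
  rcases le_or_gt b a with hab | hab
  · simp [n4, Set.Ioc_eq_empty_of_le hab]
  have h := strichartz φ a (b - a) (sub_pos.mpr hab) h1
  rw [add_sub_cancel] at h
  -- The factor 2 in `strC` serves because 10 ≤ 2⁴.
  have h2 : ENNReal.ofReal (10 * √(b - a)) ≤ strC (b - a) ^ 4 := by
    unfold strC
    rw [← ENNReal.ofReal_pow (by have := hab.le; have : 0 ≤ b - a := by linarith
                                 positivity)]
    apply ENNReal.ofReal_le_ofReal
    rw [mul_pow, ← Real.rpow_natCast, ← Real.rpow_natCast, ← Real.rpow_mul (by linarith),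
      Real.sqrt_eq_rpow]
    norm_num
    gcongr
    norm_num
  calc n4 a b (fun t => free t φ) ≤ ((strC (b - a) * ‖φ‖ₑ) ^ 4) ^ (1 / 4 : ℝ) := by
        refine ENNReal.rpow_le_rpow (h.trans ?_) (by norm_num)
        rw [mul_pow]; gcongr
    _ = _ := pow_rpow_quarter _

/-- The left end of the dyadic subinterval of level `j` of `(a,b]` that contains `t`. -/
noncomputable def dyadic : ℕ → ℝ → ℝ → ℝ → ℝ
  | 0, a, _, _ => a
  | j + 1, a, b, t =>
    if t ≤ (a + b) / 2 then dyadic j a ((a + b) / 2) t else dyadic j ((a + b) / 2) b t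

theorem dyadic_mem (j : ℕ) : ∀ a b t : ℝ, t ∈ Set.Icc a b →
    dyadic j a b t ∈ Set.Icc a b ∧ |dyadic j a b t - t| ≤ (b - a) / 2 ^ j := by
  induction j with
  | zero =>
    intro a b t ht
    simp only [dyadic, pow_zero, div_one]
    exact ⟨⟨le_rfl, ht.1.trans ht.2⟩, by rw [abs_le]; constructor <;> linarith [ht.1, ht.2]⟩
  | succ j ih =>
    intro a b t ht
    have hab : a ≤ b := ht.1.trans ht.2
    simp only [dyadic]
    split_ifs with h
    · obtain ⟨h1, h2⟩ := ih a ((a + b) / 2) t ⟨ht.1, h⟩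
      refine ⟨⟨h1.1, by linarith [h1.2]⟩, h2.trans (le_of_eq ?_)⟩
      rw [pow_succ]; field_simp; ring
    · obtain ⟨h1, h2⟩ := ih ((a + b) / 2) b t ⟨by linarith, ht.2⟩
      refine ⟨⟨by linarith [h1.1], h1.2⟩, h2.trans (le_of_eq ?_)⟩
      rw [pow_succ]; field_simp; ring

theorem stronglyMeasurable_dyadic (v : ℝ → L2) (j : ℕ) :
    ∀ a b : ℝ, StronglyMeasurable fun t => v (dyadic j a b t) := by
  induction j with
  | zero => exact fun a b => stronglyMeasurable_const (b := v a)
  | succ j ih =>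
    intro a b
    have : (fun t => v (dyadic (j + 1) a b t)) = fun t => if t ∈ Set.Iic ((a + b) / 2) then
        v (dyadic j a ((a + b) / 2) t) else v (dyadic j ((a + b) / 2) b t) := by
      funext t
      simp only [dyadic, Set.mem_Iic]
      split_ifs <;> rfl
    rw [this]
    exact StronglyMeasurable.ite measurableSet_Iic (ih a _) (ih _ b)

theorem stronglyMeasurable_free {v : ℝ → L2} (hv : StronglyMeasurable v) :
    StronglyMeasurable fun t => free t (v t) := by
  have h : StronglyMeasurable fun t : ℝ => (t, v t) := stronglyMeasurable_id.prodMk hv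
  have h2 : StronglyMeasurable ((fun p : ℝ × L2 => free p.1 p.2) ∘ fun t => (t, v t)) :=
    continuous_free.comp_stronglyMeasurable h
  simpa only [Function.comp_def] using h2

theorem lintegral_Ioc_add {a b c : ℝ} (hac : a ≤ c) (hcb : c ≤ b) (f : ℝ → ℝ≥0∞) :
    ∫⁻ t in Set.Ioc a b, f t = (∫⁻ t in Set.Ioc a c, f t) + ∫⁻ t in Set.Ioc c b, f t := by
  rw [← Set.Ioc_union_Ioc_eq_Ioc hac hcb, lintegral_union measurableSet_Ioc]
  exact Set.Ioc_disjoint_Ioc_of_le le_rfl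

/-- Halve (a, b] at c. On the left half induction applies directly; on the right half it applies
relative to `v c`, and the free wave with datum `v c - v a` is left over. Fourth powers of L⁴ norms
add over the two halves, and so does μ, so the inductive parts recombine without loss. The free wave
adds one more S·m, and the resulting 13·S is brought back to 12·`strC (b - a)` by `strC_half`. The
constant is thus independent of the level j. -/
theorem n4_dyadic_le {a₀ b₀ : ℝ} {v : ℝ → L2} {μ : Measure ℝ}
    (hv : ∀ s t, a₀ ≤ s → s ≤ t → t ≤ b₀ → ‖v t - v s‖ₑ ^ 4 ≤ μ (Set.Ioc s t)) (j : ℕ) :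
    ∀ a b : ℝ, a₀ ≤ a → a ≤ b → b ≤ b₀ → b - a ≤ 1 →
      n4 a b (fun t => free t (v (dyadic j a b t) - v a)) ≤
        12 * strC (b - a) * μ (Set.Ioc a b) ^ (1 / 4 : ℝ) := by
  induction j with
  | zero =>
    intro a b _ _ _ _
    simp [dyadic, n4_zero]
  | succ j ih =>
    intro a b ha hab hb h1
    set c := (a + b) / 2 with hc
    have hac : a ≤ c := by linarith
    have hcb : c ≤ b := by linarith
    have hlen1 : c - a = (b - a) / 2 := by rw [hc]; ring
    have hlen2 : b - c = (b - a) / 2 := by rw [hc]; ring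
    set m := μ (Set.Ioc a b) ^ (1 / 4 : ℝ) with hm
    set S := strC ((b - a) / 2) with hS
    set A : ℝ → L2 := fun t => free t (v (dyadic j a c t) - v a)
    set A' : ℝ → L2 := fun t => free t (v (dyadic j c b t) - v c)
    set D : ℝ → L2 := fun t => free t (v c - v a)
    have hA : StronglyMeasurable A :=
      stronglyMeasurable_free ((stronglyMeasurable_dyadic v j a c).sub stronglyMeasurable_const)
    have hA' : StronglyMeasurable A' :=
      stronglyMeasurable_free ((stronglyMeasurable_dyadic v j c b).sub stronglyMeasurable_const)
    have hD : StronglyMeasurable D := (continuous_free_apply _).stronglyMeasurable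
    set F1 : ℝ → L2 := fun t => if t ∈ Set.Iic c then A t else A' t
    set F2 : ℝ → L2 := fun t => if t ∈ Set.Iic c then 0 else D t
    have hF1 : StronglyMeasurable F1 := StronglyMeasurable.ite measurableSet_Iic hA hA'
    have hF2 : StronglyMeasurable F2 :=
      StronglyMeasurable.ite measurableSet_Iic stronglyMeasurable_const hD
    have hsplit : ∀ t ∈ Set.Ioc a b,
        free t (v (dyadic (j + 1) a b t) - v a) = F1 t + F2 t := by
      intro t _
      simp only [F1, F2, A, A', D, dyadic, Set.mem_Iic, ← hc]
      split_ifs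
      · simp
      · rw [← map_add]; congr 1; abel
    have e1 : n4 a b F1 ≤ 12 * S * m := by
      have hl : ∫⁻ t in Set.Ioc a c, quart (F1 t) ≤ (12 * S) ^ 4 * μ (Set.Ioc a c) := by
        rw [setLIntegral_congr_fun (g := fun t => quart (A t)) measurableSet_Ioc
          (fun t ht => by simp only [F1]; rw [if_pos (Set.mem_Iic.mpr ht.2)]), ← n4_pow]
        have := ih a c ha hac (hcb.trans hb) (by linarith)
        rw [hlen1] at this
        calc n4 a c A ^ 4 ≤ (12 * S * μ (Set.Ioc a c) ^ (1 / 4 : ℝ)) ^ 4 :=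
              pow_le_pow_left' this 4
          _ = _ := by rw [mul_pow, rpow_quarter_pow]
      have hr : ∫⁻ t in Set.Ioc c b, quart (F1 t) ≤ (12 * S) ^ 4 * μ (Set.Ioc c b) := by
        rw [setLIntegral_congr_fun (g := fun t => quart (A' t)) measurableSet_Ioc
          (fun t ht => by simp only [F1]; rw [if_neg (by simpa using ht.1)]), ← n4_pow]
        have := ih c b (ha.trans hac) hcb hb (by linarith)
        rw [hlen2] at this
        calc n4 c b A' ^ 4 ≤ (12 * S * μ (Set.Ioc c b) ^ (1 / 4 : ℝ)) ^ 4 :=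
              pow_le_pow_left' this 4
          _ = _ := by rw [mul_pow, rpow_quarter_pow]
      have hμ : μ (Set.Ioc a c) + μ (Set.Ioc c b) = μ (Set.Ioc a b) := by
        rw [← Set.Ioc_union_Ioc_eq_Ioc hac hcb, measure_union
          (Set.Ioc_disjoint_Ioc_of_le le_rfl) measurableSet_Ioc]
      calc n4 a b F1 ≤ ((12 * S * m) ^ 4) ^ (1 / 4 : ℝ) := by
            refine ENNReal.rpow_le_rpow ?_ (by norm_num)
            rw [lintegral_Ioc_add hac hcb, mul_pow, hm, rpow_quarter_pow, ← hμ, mul_add]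
            exact add_le_add hl hr
        _ = _ := pow_rpow_quarter _
    have e2 : n4 a b F2 ≤ S * m := by
      have h3 : n4 a b F2 = n4 c b D := by
        unfold n4
        rw [lintegral_Ioc_add hac hcb, setLIntegral_congr_fun (g := fun t => 0) measurableSet_Ioc
          (fun t ht => by simp only [F2]; rw [if_pos (Set.mem_Iic.mpr ht.2), quart_zero]),
          setLIntegral_congr_fun (s := Set.Ioc c b) (g := fun t => quart (D t)) measurableSet_Ioc
          (fun t ht => by simp only [F2]; rw [if_neg (by simpa using ht.1)])]
        simp
      have h4 : ‖v c - v a‖ₑ ≤ m := by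
        rw [← pow_rpow_quarter ‖v c - v a‖ₑ]
        refine ENNReal.rpow_le_rpow ?_ (by norm_num)
        exact (hv a c ha hac (hcb.trans hb)).trans (measure_mono (Set.Ioc_subset_Ioc_right hcb))
      rw [h3]
      refine (n4_free_le _ c b (by linarith)).trans ?_
      rw [hlen2]; gcongr
    calc _ = n4 a b (fun t => F1 t + F2 t) := n4_congr hsplit
      _ ≤ n4 a b F1 + n4 a b F2 := n4_add_le hF1.aestronglyMeasurable hF2.aestronglyMeasurable
      _ ≤ 12 * S * m + S * m := add_le_add e1 e2
      _ = 13 * S * m := by ring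
      _ ≤ _ := by gcongr ?_ * m; exact strC_half _ (by linarith)

/-- A wave whose profile has increments controlled by a measure is in `L⁴`. -/
theorem n4_profile_le {a b : ℝ} {v : ℝ → L2} {μ : Measure ℝ} (hab : a ≤ b) (h1 : b - a ≤ 1)
    (hc : ContinuousOn v (Set.Icc a b))
    (hv : ∀ s t, a ≤ s → s ≤ t → t ≤ b → ‖v t - v s‖ₑ ^ 4 ≤ μ (Set.Ioc s t)) :
    n4 a b (fun t => free t (v t - v a)) ≤ 12 * strC (b - a) * μ (Set.Ioc a b) ^ (1 / 4 : ℝ) := by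
  -- The profile frozen at dyadic left ends converges to `v t` by continuity, and the bound is
  -- uniform in the level.
  refine n4_le_liminf (w := fun j t => free t (v (dyadic j a b t) - v a)) (fun j =>
    (stronglyMeasurable_free
      ((stronglyMeasurable_dyadic v j a b).sub stronglyMeasurable_const)).aestronglyMeasurable)
    (fun t ht => ?_) (fun j => n4_dyadic_le hv j a b le_rfl hab le_rfl h1)
  have ht' : t ∈ Set.Icc a b := Set.Ioc_subset_Icc_self ht
  have h2 : Tendsto (fun j => dyadic j a b t) atTop (𝓝[Set.Icc a b] t) := by
    rw [tendsto_nhdsWithin_iff]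
    refine ⟨?_, Eventually.of_forall fun j => (dyadic_mem j a b t ht').1⟩
    rw [tendsto_iff_norm_sub_tendsto_zero]
    refine squeeze_zero (fun _ => norm_nonneg _) (fun j => (dyadic_mem j a b t ht').2) ?_
    have := (tendsto_pow_atTop_nhds_zero_of_lt_one (r := (1 / 2 : ℝ)) (by norm_num)
      (by norm_num)).const_mul (b - a)
    simpa [div_eq_mul_inv] using this
  exact ((free t).continuous.tendsto _).comp (((hc t ht').tendsto.comp h2).sub_const _)

/-! ### Fourier coefficients of products -/

/-- The bounded function `conj e_n`. -/
noncomputable def conjE (n : ℤ) : Lp ℂ ∞ (volume : Measure Circ) :=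
  ((1 / Real.sqrt (2 * Real.pi) : ℝ) : ℂ) •
    ContinuousMap.toLp ∞ (volume : Measure Circ) ℂ (fourier (-n))

theorem conjE_ae (n : ℤ) : (conjE n : Circ → ℂ) =ᵐ[volume]
    fun x => (starRingEnd ℂ) (e n x) := by
  unfold conjE
  filter_upwards [Lp.coeFn_smul ((1 / Real.sqrt (2 * Real.pi) : ℝ) : ℂ)
    (ContinuousMap.toLp ∞ (volume : Measure Circ) ℂ (fourier (-n))),
    ContinuousMap.coeFn_toLp (p := ∞) (𝕜 := ℂ) (volume : Measure Circ) (fourier (-n)),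
    e_ae n] with x h1 h2 h3
  rw [h1, Pi.smul_apply, h2, h3, smul_eq_mul, map_mul, Complex.conj_ofReal, fourier_neg]

/-- The `n`-th Fourier coefficient of the product `V u`, as a bounded bilinear form. -/
noncomputable def prodCoef (n : ℤ) : L2 →L[ℂ] L2 →L[ℂ] ℂ :=
  (ContinuousLinearMap.compL ℂ L2 (Lp ℂ 1 (volume : Measure Circ)) ℂ
    ((ContinuousLinearMap.mul ℂ ℂ).lpPairing volume ∞ 1 (conjE n))) ∘L
    ((ContinuousLinearMap.mul ℂ ℂ).holderL volume 2 2 1)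

theorem prodCoef_apply (n : ℤ) (V u : L2) :
    prodCoef n V u = ∫ x : Circ, (starRingEnd ℂ) (e n x) * (V x * u x) := by
  unfold prodCoef
  rw [ContinuousLinearMap.comp_apply, ContinuousLinearMap.compL_apply,
    ContinuousLinearMap.comp_apply, ContinuousLinearMap.lpPairing_eq_integral]
  refine integral_congr_ae ?_
  filter_upwards [conjE_ae n, (ContinuousLinearMap.mul ℂ ℂ).coeFn_holder (r := 1) V u] with x h1 h2
  rw [h1, ContinuousLinearMap.mul_apply']
  exact congrArg _ h2

theorem integrable_mul_L2 (V u : L2) : Integrable (fun x : Circ => V x * u x) :=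
  MemLp.integrable_mul (Lp.memLp V) (Lp.memLp u)

theorem free_sum_ae (F : Finset ℤ) (c : ℤ → ℂ) (r : ℝ) :
    (free r (∑ n ∈ F, c n • e n) : Circ → ℂ) =ᵐ[volume]
      fun x => ∑ n ∈ F, c n * phase r n * e n x := by
  have h1 : free r (∑ n ∈ F, c n • e n) = ∑ n ∈ F, (c n * phase r n) • e n := by
    rw [map_sum]
    refine Finset.sum_congr rfl fun n _ => ?_
    rw [map_smul, free_e, smul_smul]
  rw [h1]
  have h2 := Lp.coeFn_finsetSum F fun n => (c n * phase r n) • e n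
  have h3 : ∀ᵐ x : Circ, ∀ n ∈ F, ((c n * phase r n) • e n : L2) x = c n * phase r n * e n x := by
    rw [Filter.eventually_all_finset]
    intro n _
    filter_upwards [Lp.coeFn_smul (c n * phase r n) (e n)] with x hx
    rw [hx, Pi.smul_apply, smul_eq_mul]
  filter_upwards [h2, h3] with x h4 h5
  rw [h4, Finset.sum_apply, Finset.sum_congr rfl h5]

/-- Duality: pairing with the coefficients of a trigonometric polynomial gives a space integral
against a free wave, which Hölder's inequality can bound. In this way L⁴ norms control a product `V
u` that is a priori only in L¹. -/
theorem sum_prodCoef (F : Finset ℤ) (c : ℤ → ℂ) (r : ℝ) (V u : L2) :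
    ∑ n ∈ F, (starRingEnd ℂ) (c n) * (phase (-r) n * prodCoef n V u) =
      ∫ x : Circ, (starRingEnd ℂ) (free r (∑ n ∈ F, c n • e n) x) * (V x * u x) := by
  have h1 : ∀ᵐ x : Circ, (starRingEnd ℂ) (free r (∑ n ∈ F, c n • e n) x) * (V x * u x) =
      ∑ n ∈ F, (starRingEnd ℂ) (c n) * phase (-r) n *
        ((starRingEnd ℂ) (e n x) * (V x * u x)) := by
    filter_upwards [free_sum_ae F c r] with x hx
    rw [hx, map_sum, Finset.sum_mul]
    refine Finset.sum_congr rfl fun n _ => ?_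
    rw [map_mul, map_mul, conj_phase]; ring
  have hint : ∀ n, Integrable fun x : Circ => (starRingEnd ℂ) (e n x) * (V x * u x) := by
    intro n
    refine (integrable_mul_L2 V u).bdd_mul (c := 1 / Real.sqrt (2 * Real.pi))
      (Complex.continuous_conj.comp_aestronglyMeasurable (Lp.aestronglyMeasurable _)) ?_
    filter_upwards [e_ae n] with x hx
    rw [hx, RCLike.norm_conj, norm_mul, Complex.norm_real, Real.norm_of_nonneg (by positivity)]
    have : ‖(fourier n x : ℂ)‖ = 1 := by rw [fourier_apply]; exact Circle.norm_coe _
    rw [this, mul_one]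
  rw [integral_congr_ae h1, integral_finsetSum _ fun n _ => (hint n).const_mul _]
  refine Finset.sum_congr rfl fun n _ => ?_
  rw [integral_const_mul, prodCoef_apply, mul_assoc]

theorem enorm_sum_prodCoef_le (F : Finset ℤ) (c : ℤ → ℂ) (r : ℝ) (V u : L2) :
    ‖∑ n ∈ F, (starRingEnd ℂ) (c n) * (phase (-r) n * prodCoef n V u)‖ₑ ≤
      quart (free r (∑ n ∈ F, c n • e n)) ^ (1 / 4 : ℝ) * ‖V‖ₑ * quart u ^ (1 / 4 : ℝ) := by
  rw [sum_prodCoef]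
  refine (enorm_integral_le_lintegral_enorm _).trans ((le_of_eq ?_).trans
    (lintegral_mul_mul_le _ V u))
  refine lintegral_congr fun x => ?_
  rw [enorm_mul, enorm_mul, ← mul_assoc, ← ofReal_norm ((starRingEnd ℂ) _), RCLike.norm_conj,
    ofReal_norm]

/-! ### Duhamel's integral -/

theorem n2_eq_eLpNorm (a b : ℝ) (V : ℝ → L2) :
    n2 a b V = eLpNorm V 2 (volume.restrict (Set.Ioc a b)) := by
  rw [eLpNorm_eq_lintegral_rpow_enorm_toReal (by norm_num) (by norm_num)]
  simp [n2]

theorem n2_lt_top {a b : ℝ} {V : ℝ → L2} (hV : MemLp V 2 (volume.restrict (Set.Ioc a b))) :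
    n2 a b V < ⊤ := by
  rw [n2_eq_eLpNorm]; exact hV.2

/-- The `n`-th coefficient of `∫ₛᵗ e^{-irΔ} V(r) u(r) dr`. -/
noncomputable def duh (V u : ℝ → L2) (n : ℤ) (s t : ℝ) : ℂ :=
  ∫ r in s..t, phase (-r) n * prodCoef n (V r) (u r)

theorem integrableOn_duh {a b : ℝ} {V u : ℝ → L2}
    (hV : MemLp V 2 (volume.restrict (Set.Ioc a b))) (hu : ContinuousOn u (Set.Icc a b)) (n : ℤ) :
    IntegrableOn (fun r => phase (-r) n * prodCoef n (V r) (u r)) (Set.Ioc a b) := by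
  have hum : AEStronglyMeasurable u (volume.restrict (Set.Ioc a b)) :=
    (hu.mono Set.Ioc_subset_Icc_self).aestronglyMeasurable measurableSet_Ioc
  obtain ⟨C, hC⟩ := isCompact_Icc.exists_bound_of_continuousOn hu
  have hV1 : Integrable V (volume.restrict (Set.Ioc a b)) := hV.integrable (by norm_num)
  refine Integrable.mono' (hV1.norm.const_mul (‖prodCoef n‖ * C)) ?_ ?_
  · have h1 : Continuous fun p : L2 × L2 => prodCoef n p.1 p.2 := by fun_prop
    have h2 : AEStronglyMeasurable (fun r => prodCoef n (V r) (u r))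
        (volume.restrict (Set.Ioc a b)) := by
      have := h1.comp_aestronglyMeasurable (hV.1.prodMk hum)
      simpa only [Function.comp_def] using this
    exact (((continuous_phase n).comp continuous_neg).aestronglyMeasurable).mul h2
  · refine (ae_restrict_iff' measurableSet_Ioc).mpr (Eventually.of_forall fun r hr => ?_)
    rw [norm_mul, norm_phase, one_mul]
    calc ‖prodCoef n (V r) (u r)‖ ≤ ‖prodCoef n‖ * ‖V r‖ * ‖u r‖ :=
          (prodCoef n).le_opNorm₂ _ _
      _ ≤ ‖prodCoef n‖ * ‖V r‖ * C := by
          gcongr; exact hC r (Set.Ioc_subset_Icc_self hr)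
      _ = _ := by ring

theorem intervalIntegrable_duh {a b : ℝ} {V u : ℝ → L2}
    (hV : MemLp V 2 (volume.restrict (Set.Ioc a b))) (hu : ContinuousOn u (Set.Icc a b)) (n : ℤ)
    {s t : ℝ} (hs : a ≤ s) (hst : s ≤ t) (ht : t ≤ b) :
    IntervalIntegrable (fun r => phase (-r) n * prodCoef n (V r) (u r)) volume s t := by
  rw [intervalIntegrable_iff_integrableOn_Ioc_of_le hst]
  exact (integrableOn_duh hV hu n).mono_set (Set.Ioc_subset_Ioc hs ht)

theorem duh_add {a b : ℝ} {V u : ℝ → L2}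
    (hV : MemLp V 2 (volume.restrict (Set.Ioc a b))) (hu : ContinuousOn u (Set.Icc a b)) (n : ℤ)
    {r s t : ℝ} (hr : a ≤ r) (hrs : r ≤ s) (hst : s ≤ t) (ht : t ≤ b) :
    duh V u n r s + duh V u n s t = duh V u n r t :=
  intervalIntegral.integral_add_adjacent_intervals
    (intervalIntegrable_duh hV hu n hr hrs (hst.trans ht))
    (intervalIntegrable_duh hV hu n (hr.trans hrs) hst ht)

theorem enorm_sum_duh_le {a b : ℝ} {V u : ℝ → L2}
    (hV : MemLp V 2 (volume.restrict (Set.Ioc a b))) (hu : ContinuousOn u (Set.Icc a b))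
    {s t : ℝ} (hs : a ≤ s) (hst : s ≤ t) (ht : t ≤ b) (F : Finset ℤ) (c : ℤ → ℂ) :
    ‖∑ n ∈ F, (starRingEnd ℂ) (c n) * duh V u n s t‖ₑ ≤
      n4 s t (fun r => free r (∑ n ∈ F, c n • e n)) * n2 s t V * n4 s t u := by
  have hsub : Set.Ioc s t ⊆ Set.Ioc a b := Set.Ioc_subset_Ioc hs ht
  have hum : AEStronglyMeasurable u (volume.restrict (Set.Ioc s t)) :=
    (hu.mono (hsub.trans Set.Ioc_subset_Icc_self)).aestronglyMeasurable measurableSet_Ioc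
  have h1 : ∑ n ∈ F, (starRingEnd ℂ) (c n) * duh V u n s t =
      ∫ r in Set.Ioc s t, ∑ n ∈ F, (starRingEnd ℂ) (c n) *
        (phase (-r) n * prodCoef n (V r) (u r)) := by
    rw [integral_finsetSum _ fun n _ => ((integrableOn_duh hV hu n).mono_set hsub).const_mul _]
    refine Finset.sum_congr rfl fun n _ => ?_
    rw [integral_const_mul, duh, intervalIntegral.integral_of_le hst]
  rw [h1]
  refine (enorm_integral_le_lintegral_enorm _).trans
    ((lintegral_mono fun r => enorm_sum_prodCoef_le F c r (V r) (u r)).trans ?_)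
  exact lintegral_quart_mul_le (continuous_free_apply _).aestronglyMeasurable
    (hV.1.mono_measure (Measure.restrict_mono hsub le_rfl)) hum

theorem enorm_sum_smul_e (F : Finset ℤ) (c : ℤ → ℂ) :
    ‖∑ n ∈ F, c n • e n‖ ^ 2 = ∑ n ∈ F, ‖c n‖ ^ 2 := by
  have h := orthonormal_e.inner_sum c c F
  rw [inner_self_eq_norm_sq_to_K] at h
  have h2 : ((‖∑ n ∈ F, c n • e n‖ ^ 2 : ℝ) : ℂ) = ((∑ n ∈ F, ‖c n‖ ^ 2 : ℝ) : ℂ) := by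
    push_cast
    refine h.trans (Finset.sum_congr rfl fun n _ => ?_)
    rw [mul_comm, Complex.mul_conj']
  exact_mod_cast h2

/-- The dual Strichartz estimate. -/
theorem sum_norm_duh_sq_le {a b : ℝ} {V u : ℝ → L2} (h1 : b - a ≤ 1)
    (hV : MemLp V 2 (volume.restrict (Set.Ioc a b))) (hu : ContinuousOn u (Set.Icc a b))
    (hu4 : n4 a b u < ⊤) {s t : ℝ} (hs : a ≤ s) (hst : s ≤ t) (ht : t ≤ b) (F : Finset ℤ) :
    ∑ n ∈ F, ‖duh V u n s t‖ ^ 2 ≤ (strC (t - s) * n2 s t V * n4 s t u).toReal ^ 2 := by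
  set X := strC (t - s) * n2 s t V * n4 s t u with hX
  have hXtop : X < ⊤ := ENNReal.mul_lt_top (ENNReal.mul_lt_top (strC_lt_top _)
    ((n2_mono hs ht V).trans_lt (n2_lt_top hV))) ((n4_mono hs ht u).trans_lt hu4)
  -- Testing against the coefficients themselves gives Y² ≤ X·Y, hence Y ≤ X.
  set c : ℤ → ℂ := fun n => duh V u n s t
  set Y := ‖∑ n ∈ F, c n • e n‖ with hY
  have hY2 : Y ^ 2 = ∑ n ∈ F, ‖c n‖ ^ 2 := enorm_sum_smul_e F c
  have h2 : ‖∑ n ∈ F, (starRingEnd ℂ) (c n) * duh V u n s t‖ₑ ≤ X * ENNReal.ofReal Y := by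
    refine (enorm_sum_duh_le hV hu hs hst ht F c).trans ?_
    have h3 := n4_free_le (∑ n ∈ F, c n • e n) s t (by linarith)
    rw [hY, ofReal_norm, hX]
    calc _ ≤ (strC (t - s) * ‖∑ n ∈ F, c n • e n‖ₑ) * n2 s t V * n4 s t u := by gcongr
      _ = _ := by ring
  have h3 : ∑ n ∈ F, (starRingEnd ℂ) (c n) * duh V u n s t = ((Y ^ 2 : ℝ) : ℂ) := by
    rw [hY2]
    push_cast
    refine Finset.sum_congr rfl fun n _ => ?_
    rw [mul_comm, Complex.mul_conj']
  rw [h3, ← ofReal_norm, Complex.norm_real, Real.norm_of_nonneg (by positivity),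
    ← ENNReal.ofReal_toReal hXtop.ne, ← ENNReal.ofReal_mul ENNReal.toReal_nonneg,
    ENNReal.ofReal_le_ofReal_iff (by positivity)] at h2
  have hY0 : 0 ≤ Y := norm_nonneg _
  have h4 : Y ≤ X.toReal := by
    rcases hY0.eq_or_lt with h | h
    · rw [← h]; exact ENNReal.toReal_nonneg
    · nlinarith
  change ∑ n ∈ F, ‖c n‖ ^ 2 ≤ _
  rw [← hY2]
  gcongr

/-- Duhamel's integral, with the (inhomogeneous, retarded) Strichartz estimates. -/
theorem exists_duhamel {a b : ℝ} {V u : ℝ → L2} (h1 : b - a ≤ 1)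
    (hV : MemLp V 2 (volume.restrict (Set.Ioc a b))) (hu : ContinuousOn u (Set.Icc a b))
    (hu4 : n4 a b u < ⊤) :
    ∃ v : ℝ → L2, (∀ t ∈ Set.Icc a b, ∀ n, inner ℂ (e n) (v t) = duh V u n a t) ∧
      ContinuousOn v (Set.Icc a b) ∧
      (∀ s t, a ≤ s → s ≤ t → t ≤ b → ‖v t - v s‖ₑ ≤ strC (t - s) * n2 s t V * n4 s t u) ∧
      ∀ s t, a ≤ s → s ≤ t → t ≤ b → n4 s t (fun r => free r (v r - v s)) ≤
        12 * strC (t - s) ^ 2 * n2 s t V * n4 s t u := by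
  have hex : ∀ t : ℝ, ∃ f : L2, t ∈ Set.Icc a b → ∀ n, inner ℂ (e n) f = duh V u n a t := by
    intro t
    by_cases ht : t ∈ Set.Icc a b
    · obtain ⟨f, hf, -⟩ := exists_of_coef (fun n => duh V u n a t) _ ENNReal.toReal_nonneg
        (sum_norm_duh_sq_le h1 hV hu hu4 le_rfl ht.1 ht.2)
      exact ⟨f, fun _ => hf⟩
    · exact ⟨0, fun h => absurd h ht⟩
  choose v hv using hex
  have hbound : ∀ s t, a ≤ s → s ≤ t → t ≤ b →
      ‖v t - v s‖ₑ ≤ strC (t - s) * n2 s t V * n4 s t u := by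
    intro s t hs hst ht
    have hXtop : strC (t - s) * n2 s t V * n4 s t u < ⊤ :=
      ENNReal.mul_lt_top (ENNReal.mul_lt_top (strC_lt_top _)
        ((n2_mono hs ht V).trans_lt (n2_lt_top hV))) ((n4_mono hs ht u).trans_lt hu4)
    obtain ⟨f, hf, hfn⟩ := exists_of_coef (fun n => duh V u n s t) _ ENNReal.toReal_nonneg
        (sum_norm_duh_sq_le h1 hV hu hu4 hs hst ht)
    have : v t - v s = f := by
      apply ext_coef
      intro n
      rw [inner_sub_right, hv t ⟨hs.trans hst, ht⟩, hv s ⟨hs, hst.trans ht⟩, hf,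
        ← duh_add hV hu n le_rfl hs hst ht]
      ring
    rw [this, ← ofReal_norm]
    exact (ENNReal.ofReal_le_ofReal hfn).trans ENNReal.ofReal_toReal_le
  have hcont : ContinuousOn v (Set.Icc a b) := by
    intro s hs
    set X := n2 a b V * n4 a b u with hX
    have hXtop : X < ⊤ := ENNReal.mul_lt_top (n2_lt_top hV) hu4
    have h2 : ∀ t ∈ Set.Icc a b, ‖v t - v s‖ₑ ≤ strC |t - s| * X := by
      intro t ht
      rcases le_total s t with h | h
      · rw [abs_of_nonneg (by linarith)]
        refine (hbound s t hs.1 h ht.2).trans ?_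
        rw [mul_assoc]
        exact mul_le_mul_right (mul_le_mul' (n2_mono hs.1 ht.2 V) (n4_mono hs.1 ht.2 u)) _
      · rw [abs_sub_comm, abs_of_nonneg (by linarith), ← enorm_neg, neg_sub]
        refine (hbound t s ht.1 h hs.2).trans ?_
        rw [mul_assoc]
        exact mul_le_mul_right (mul_le_mul' (n2_mono ht.1 hs.2 V) (n4_mono ht.1 hs.2 u)) _
    have h3 : Tendsto (fun t => strC |t - s| * X) (𝓝[Set.Icc a b] s) (𝓝 0) := by
      have h4 : Tendsto (fun t : ℝ => |t - s|) (𝓝[Set.Icc a b] s) (𝓝 0) := by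
        have : Continuous fun t : ℝ => |t - s| := by fun_prop
        have := this.tendsto s
        rw [sub_self, abs_zero] at this
        exact this.mono_left nhdsWithin_le_nhds
      have := ENNReal.Tendsto.mul_const (b := X) (tendsto_strC.comp h4) (Or.inr hXtop.ne)
      rwa [zero_mul] at this
    have h5 : Tendsto (fun t => ‖v t - v s‖ₑ) (𝓝[Set.Icc a b] s) (𝓝 0) :=
      tendsto_of_tendsto_of_tendsto_of_le_of_le' tendsto_const_nhds h3
        (Eventually.of_forall fun _ => zero_le)
        (eventually_nhdsWithin_of_forall h2)
    rw [ContinuousWithinAt, tendsto_iff_norm_sub_tendsto_zero]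
    have h6 := (ENNReal.tendsto_toReal ENNReal.zero_ne_top).comp h5
    simpa [Function.comp_def] using h6
  refine ⟨v, fun t ht => hv t ht, hcont, hbound, fun s t hs hst ht => ?_⟩
  set D := strC (t - s) * n2 s t V with hD
  have hDtop : D < ⊤ := ENNReal.mul_lt_top (strC_lt_top _)
    ((n2_mono hs ht V).trans_lt (n2_lt_top hV))
  -- On a subinterval the increment of v is at most D times the L⁴ norm of u there, so its fourth
  -- power is dominated by the measure with density D⁴·`quart (u r)`, as `n4_profile_le` requires.
  set μ : Measure ℝ := D ^ 4 • (volume.withDensity fun r => quart (u r)) with hμ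
  have hμI : ∀ s' t', μ (Set.Ioc s' t') = (D * n4 s' t' u) ^ 4 := by
    intro s' t'
    rw [hμ, Measure.smul_apply, withDensity_apply _ measurableSet_Ioc, mul_pow D, n4_pow, smul_eq_mul]
  have h7 := n4_profile_le (a := s) (b := t) (v := v) (μ := μ) hst (by linarith)
    (hcont.mono (Set.Icc_subset_Icc hs ht)) (fun s' t' hs' hst' ht' => by
      rw [hμI]
      refine pow_le_pow_left' ((hbound s' t' (hs.trans hs') hst' (ht'.trans ht)).trans ?_) 4
      gcongr
      rw [hD]
      gcongr
      · exact strC_mono (by linarith) (by linarith)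
      · exact n2_mono hs' ht' V)
  refine h7.trans (le_of_eq ?_)
  rw [hμI, pow_rpow_quarter, hD]
  ring

/-! ### Linear Schrödinger equations with a potential, on short time intervals -/

/-- `e^{itΔ} v(t)` solves `i ∂ₜ u = -Δu + V u` on `[a,b]`, in the sense of Duhamel's formula. -/
structure IsProfile (a b : ℝ) (V v : ℝ → L2) : Prop where
  cont : ContinuousOn v (Set.Icc a b)
  fin : n4 a b (fun t => free t (v t)) < ⊤
  eq : ∀ t ∈ Set.Icc a b, ∀ n, inner ℂ (e n) (v t) =
    inner ℂ (e n) (v a) - Complex.I * duh V (fun r => free r (v r)) n a t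

theorem continuousOn_free {v : ℝ → L2} {s : Set ℝ} (hv : ContinuousOn v s) :
    ContinuousOn (fun t => free t (v t)) s := by
  have h : ContinuousOn (fun t : ℝ => (t, v t)) s := continuousOn_id.prodMk hv
  have h2 : ContinuousOn ((fun p : ℝ × L2 => free p.1 p.2) ∘ fun t => (t, v t)) s :=
    continuous_free.comp_continuousOn h
  simpa only [Function.comp_def] using h2

theorem aesm_free {a b : ℝ} {v : ℝ → L2} (hv : ContinuousOn v (Set.Icc a b)) :
    AEStronglyMeasurable (fun t => free t (v t)) (volume.restrict (Set.Ioc a b)) :=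
  ((continuousOn_free hv).mono Set.Ioc_subset_Icc_self).aestronglyMeasurable measurableSet_Ioc

theorem memLp_sub_interval {a b s t : ℝ} {V : ℝ → L2}
    (hV : MemLp V 2 (volume.restrict (Set.Ioc a b))) (hs : a ≤ s) (ht : t ≤ b) :
    MemLp V 2 (volume.restrict (Set.Ioc s t)) :=
  hV.mono_measure (Measure.restrict_mono (Set.Ioc_subset_Ioc hs ht) le_rfl)

theorem duh_congr {V u w : ℝ → L2} {n : ℤ} {s t : ℝ} (hst : s ≤ t)
    (h : ∀ r ∈ Set.Icc s t, u r = w r) : duh V u n s t = duh V w n s t := by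
  unfold duh
  refine intervalIntegral.integral_congr fun r hr => ?_
  rw [Set.uIcc_of_le hst] at hr
  simp only [h r hr]

theorem IsProfile.congr {a b : ℝ} {V v w : ℝ → L2} (hv : IsProfile a b V v) (hab : a ≤ b)
    (h : ∀ t ∈ Set.Icc a b, w t = v t) : IsProfile a b V w where
  cont := hv.cont.congr h
  fin := by
    rw [n4_congr (w := fun t => free t (v t))
      (fun t ht => by rw [h t (Set.Ioc_subset_Icc_self ht)])]
    exact hv.fin
  eq t ht n := by
    rw [h t ht, h a ⟨le_rfl, hab⟩, hv.eq t ht n, duh_congr (u := fun r => free r (w r)) ht.1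
      (fun r hr => by rw [h r ⟨hr.1, hr.2.trans ht.2⟩])]

theorem IsProfile.congr_potential {a b : ℝ} {V W v : ℝ → L2} (hv : IsProfile a b V v)
    (h : ∀ᵐ t ∂(volume.restrict (Set.Ioc a b)), V t = W t) : IsProfile a b W v where
  cont := hv.cont
  fin := hv.fin
  eq t ht n := by
    rw [hv.eq t ht n]
    congr 2
    unfold duh
    rw [intervalIntegral.integral_of_le ht.1, intervalIntegral.integral_of_le ht.1]
    refine integral_congr_ae ?_
    filter_upwards [ae_restrict_of_ae_restrict_of_subset (Set.Ioc_subset_Ioc_right ht.2) h]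
      with r hr
    rw [hr]

theorem IsProfile.mono {a b s t : ℝ} {V v : ℝ → L2} (hv : IsProfile a b V v)
    (hV : MemLp V 2 (volume.restrict (Set.Ioc a b))) (hs : a ≤ s) (ht : t ≤ b) :
    IsProfile s t V v where
  cont := hv.cont.mono (Set.Icc_subset_Icc hs ht)
  fin := (n4_mono hs ht _).trans_lt hv.fin
  eq r hr n := by
    have h1 := hv.eq r ⟨hs.trans hr.1, hr.2.trans ht⟩ n
    have h2 := hv.eq s ⟨hs, (hr.1.trans hr.2).trans ht⟩ n
    rw [h1, h2, ← duh_add hV (continuousOn_free hv.cont) n le_rfl hs hr.1 (hr.2.trans ht)]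
    ring

theorem IsProfile.union {a c b : ℝ} {V v : ℝ → L2} (hv : IsProfile a c V v)
    (hw : IsProfile c b V v) (hV : MemLp V 2 (volume.restrict (Set.Ioc a b))) (hac : a ≤ c)
    (hcb : c ≤ b) : IsProfile a b V v := by
  have hc : ContinuousOn v (Set.Icc a b) := by
    rw [← Set.Icc_union_Icc_eq_Icc hac hcb]
    exact hv.cont.union_of_isClosed hw.cont isClosed_Icc isClosed_Icc
  refine ⟨hc, ?_, fun t ht n => ?_⟩
  · have h1 := hv.fin
    have h2 := hw.fin
    have h3 : n4 a b (fun t => free t (v t)) ^ 4 < ⊤ := by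
      rw [n4_pow, lintegral_Ioc_add hac hcb, ← n4_pow, ← n4_pow]
      exact ENNReal.add_lt_top.mpr ⟨ENNReal.pow_lt_top h1, ENNReal.pow_lt_top h2⟩
    simpa using h3
  · rcases le_total t c with h | h
    · exact hv.eq t ⟨ht.1, h⟩ n
    · rw [hw.eq t ⟨h, ht.2⟩ n, hv.eq c ⟨hac, le_rfl⟩ n,
        ← duh_add hV (continuousOn_free hc) n le_rfl hac h ht.2]
      ring

theorem isProfile_zero (a b : ℝ) (V : ℝ → L2) : IsProfile a b V (fun _ => 0) where
  cont := continuousOn_const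
  fin := by simp [n4_zero]
  eq t _ n := by simp [duh]

/-- Absorption of a small multiple of the left side, legitimate only for finite N; for solutions
this finiteness is recorded in `IsProfile`. -/
theorem le_two_mul_of_le_add {N A K : ℝ≥0∞} (hN : N < ⊤) (hK : K ≤ 1 / 2) (h : N ≤ A + K * N) :
    N ≤ 2 * A := by
  have h1 : N ≤ A + N / 2 := by
    refine h.trans ?_
    rw [ENNReal.div_eq_inv_mul]
    gcongr
    simpa using hK
  have h2 : N / 2 + N / 2 ≤ A + N / 2 := by rwa [ENNReal.add_halves]
  have h3 : N / 2 ≤ A := (ENNReal.add_le_add_iff_right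
    (ENNReal.div_lt_top hN.ne (by norm_num)).ne).mp h2
  calc N = 2 * (N / 2) := (ENNReal.mul_div_cancel (by norm_num) (by norm_num)).symm
    _ ≤ 2 * A := by gcongr

/-- The constant in the retarded Strichartz estimate. -/
noncomputable def retC (h : ℝ) : ℝ≥0∞ := 12 * strC h ^ 2

theorem tendsto_retC : Tendsto retC (𝓝 0) (𝓝 0) := by
  have h := ENNReal.Tendsto.const_mul (a := 12)
    (((ENNReal.continuous_pow 2).tendsto 0).comp tendsto_strC) (Or.inr (by norm_num))
  unfold retC
  simpa [Function.comp_def] using h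

theorem duh_sub {a b : ℝ} {V W u w : ℝ → L2}
    (hV : MemLp V 2 (volume.restrict (Set.Ioc a b)))
    (hW : MemLp W 2 (volume.restrict (Set.Ioc a b)))
    (hu : ContinuousOn u (Set.Icc a b)) (hw : ContinuousOn w (Set.Icc a b)) (n : ℤ) {t : ℝ}
    (ht : t ∈ Set.Icc a b) :
    duh V u n a t - duh W w n a t =
      duh V (fun r => u r - w r) n a t + duh (fun r => V r - W r) w n a t := by
  unfold duh
  have huw : ContinuousOn (fun r => u r - w r) (Set.Icc a b) := hu.sub hw
  have i1 := intervalIntegrable_duh hV huw n le_rfl ht.1 ht.2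
  have i2 := intervalIntegrable_duh (V := fun r => V r - W r) (hV.sub hW) hw n le_rfl ht.1 ht.2
  rw [← intervalIntegral.integral_sub (intervalIntegrable_duh hV hu n le_rfl ht.1 ht.2)
    (intervalIntegrable_duh hW hw n le_rfl ht.1 ht.2),
    ← intervalIntegral.integral_add i1 i2]
  refine intervalIntegral.integral_congr fun r _ => ?_
  simp only [map_sub, sub_apply]
  ring

theorem n4_free_smul (a b : ℝ) (c : ℂ) (v : ℝ → L2) :
    n4 a b (fun t => free t (c • v t)) = ‖c‖ₑ * n4 a b (fun t => free t (v t)) := by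
  simp only [map_smul]
  exact n4_smul a b c _

theorem n4_free_add_le {a b : ℝ} {v w : ℝ → L2} (hv : ContinuousOn v (Set.Icc a b))
    (hw : ContinuousOn w (Set.Icc a b)) :
    n4 a b (fun t => free t (v t + w t)) ≤
      n4 a b (fun t => free t (v t)) + n4 a b (fun t => free t (w t)) := by
  simp only [map_add]
  exact n4_add_le (aesm_free hv) (aesm_free hw)

theorem IsProfile.n4_sub_lt_top {a b : ℝ} {V W v w : ℝ → L2} (hv : IsProfile a b V v)
    (hw : IsProfile a b W w) : n4 a b (fun t => free t (v t - w t)) < ⊤ := by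
  have hwc : ContinuousOn (fun t => (-1 : ℂ) • w t) (Set.Icc a b) := by
    have := hw.cont
    fun_prop
  have h2 : n4 a b (fun t => free t (v t - w t)) =
      n4 a b (fun t => free t (v t + (-1 : ℂ) • w t)) :=
    n4_congr fun t _ => by rw [neg_one_smul, sub_eq_add_neg]
  rw [h2]
  refine (n4_free_add_le hv.cont hwc).trans_lt ?_
  rw [n4_free_smul]
  exact ENNReal.add_lt_top.mpr ⟨hv.fin, ENNReal.mul_lt_top (by simp) hw.fin⟩

theorem enorm_neg_I : ‖-Complex.I‖ₑ = 1 := by rw [← ofReal_norm]; simp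

/-- The difference of two solutions as a sum of a free wave and two Duhamel integrals. -/
theorem IsProfile.exists_sub_eq {a b : ℝ} {V W v w : ℝ → L2} (hab : a ≤ b) (h1 : b - a ≤ 1)
    (hV : MemLp V 2 (volume.restrict (Set.Ioc a b)))
    (hW : MemLp W 2 (volume.restrict (Set.Ioc a b)))
    (hv : IsProfile a b V v) (hw : IsProfile a b W w) :
    ∃ x y : ℝ → L2, ContinuousOn x (Set.Icc a b) ∧ ContinuousOn y (Set.Icc a b) ∧
      (∀ t ∈ Set.Icc a b, v t - w t = (v a - w a) + ((-Complex.I) • x t + (-Complex.I) • y t)) ∧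
      n4 a b (fun t => free t (x t)) ≤
        retC (b - a) * n2 a b V * n4 a b (fun t => free t (v t - w t)) ∧
      n4 a b (fun t => free t (y t)) ≤
        retC (b - a) * n2 a b (fun t => V t - W t) * n4 a b (fun t => free t (w t)) ∧
      (∀ t ∈ Set.Icc a b, ‖x t‖ₑ ≤
        strC (b - a) * n2 a b V * n4 a b (fun t => free t (v t - w t))) ∧
      ∀ t ∈ Set.Icc a b, ‖y t‖ₑ ≤
        strC (b - a) * n2 a b (fun t => V t - W t) * n4 a b (fun t => free t (w t)) := by
  have hdc : ContinuousOn (fun t => v t - w t) (Set.Icc a b) := hv.cont.sub hw.cont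
  obtain ⟨x, hx, hxc, hxb, hx4⟩ := exists_duhamel h1 hV (continuousOn_free hdc)
    (hv.n4_sub_lt_top hw)
  obtain ⟨y, hy, hyc, hyb, hy4⟩ := exists_duhamel (V := fun r => V r - W r) h1 (hV.sub hW)
    (continuousOn_free hw.cont) hw.fin
  have haa : a ∈ Set.Icc a b := ⟨le_rfl, hab⟩
  have hxa : x a = 0 := ext_coef fun n => by rw [hx a haa n]; simp [duh]
  have hya : y a = 0 := ext_coef fun n => by rw [hy a haa n]; simp [duh]
  refine ⟨x, y, hxc, hyc, fun t ht => ?_, ?_, ?_, fun t ht => ?_, fun t ht => ?_⟩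
  · apply ext_coef
    intro n
    have h3 := duh_sub hV hW (continuousOn_free hv.cont) (continuousOn_free hw.cont) n ht
    simp only [← map_sub] at h3
    rw [inner_add_right, inner_add_right, inner_smul_right, inner_smul_right, hx t ht n, hy t ht n,
      inner_sub_right, hv.eq t ht n, hw.eq t ht n, inner_sub_right]
    linear_combination (-Complex.I) * h3
  · have := hx4 a b le_rfl hab le_rfl
    simp only [hxa, sub_zero] at this
    exact this
  · have := hy4 a b le_rfl hab le_rfl
    simp only [hya, sub_zero] at this
    exact this
  · have := hxb a t le_rfl ht.1 ht.2
    rw [hxa, sub_zero] at this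
    refine this.trans (mul_le_mul' (mul_le_mul' ?_ (n2_mono le_rfl ht.2 V))
      (n4_mono le_rfl ht.2 _))
    exact strC_mono (by linarith [ht.1]) (by linarith [ht.2])
  · have := hyb a t le_rfl ht.1 ht.2
    rw [hya, sub_zero] at this
    refine this.trans (mul_le_mul' (mul_le_mul' ?_ (n2_mono le_rfl ht.2 _))
      (n4_mono le_rfl ht.2 _))
    exact strC_mono (by linarith [ht.1]) (by linarith [ht.2])

/-- Difference of two solutions with different potentials and different initial values. -/
theorem IsProfile.sub_le {a b : ℝ} {V W v w : ℝ → L2} (hab : a ≤ b) (h1 : b - a ≤ 1)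
    (hV : MemLp V 2 (volume.restrict (Set.Ioc a b)))
    (hW : MemLp W 2 (volume.restrict (Set.Ioc a b)))
    (hv : IsProfile a b V v) (hw : IsProfile a b W w) (hK : retC (b - a) * n2 a b V ≤ 1 / 2) :
    n4 a b (fun t => free t (v t - w t)) ≤ 2 * (strC (b - a) * ‖v a - w a‖ₑ +
      retC (b - a) * n2 a b (fun t => V t - W t) * n4 a b (fun t => free t (w t))) ∧
    ∀ t ∈ Set.Icc a b, ‖v t - w t‖ₑ ≤ ‖v a - w a‖ₑ +
      strC (b - a) * n2 a b V * n4 a b (fun t => free t (v t - w t)) +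
      strC (b - a) * n2 a b (fun t => V t - W t) * n4 a b (fun t => free t (w t)) := by
  obtain ⟨x, y, hxc, hyc, hd, hx4, hy4, hxb, hyb⟩ := hv.exists_sub_eq hab h1 hV hW hw
  constructor
  · apply le_two_mul_of_le_add (hv.n4_sub_lt_top hw) hK
    have m1 : ContinuousOn (fun t => (-Complex.I) • x t) (Set.Icc a b) := by fun_prop
    have m2 : ContinuousOn (fun t => (-Complex.I) • y t) (Set.Icc a b) := by fun_prop
    have e1 := n4_free_add_le (continuousOn_const (c := v a - w a)) (m1.add m2)
    have e2 := n4_free_add_le m1 m2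
    rw [n4_free_smul, n4_free_smul, enorm_neg_I, one_mul, one_mul] at e2
    rw [n4_congr (u := fun t => free t (v t - w t)) (w := fun t => free t ((v a - w a) +
        ((-Complex.I) • x t + (-Complex.I) • y t)))
      fun t ht => by rw [hd t (Set.Ioc_subset_Icc_self ht)]]
    refine e1.trans ((add_le_add (n4_free_le _ a b h1) (e2.trans (add_le_add hx4 hy4))).trans ?_)
    rw [add_comm (retC (b - a) * n2 a b V * _), ← add_assoc]
    rw [n4_congr (u := fun t => free t (v t - w t)) (w := fun t => free t ((v a - w a) +
        ((-Complex.I) • x t + (-Complex.I) • y t)))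
      fun t ht => by rw [hd t (Set.Ioc_subset_Icc_self ht)]]
  · intro t ht
    rw [hd t ht]
    refine (enorm_add_le _ _).trans ?_
    rw [add_assoc]
    refine add_le_add le_rfl ((enorm_add_le _ _).trans ?_)
    rw [enorm_smul, enorm_smul, enorm_neg_I, one_mul, one_mul]
    exact add_le_add (hxb t ht) (hyb t ht)

/-- Comparison with the zero solution of the same equation. -/
theorem IsProfile.n4_le {a b : ℝ} {V v : ℝ → L2} (hab : a ≤ b) (h1 : b - a ≤ 1)
    (hV : MemLp V 2 (volume.restrict (Set.Ioc a b)))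
    (hv : IsProfile a b V v) (hK : retC (b - a) * n2 a b V ≤ 1 / 2) :
    n4 a b (fun t => free t (v t)) ≤ 2 * strC (b - a) * ‖v a‖ₑ := by
  have h := (hv.sub_le hab h1 hV hV (isProfile_zero a b V) hK).1
  simpa [n4_zero, mul_assoc] using h

theorem IsProfile.eqOn {a b : ℝ} {V v w : ℝ → L2} (hab : a ≤ b) (h1 : b - a ≤ 1)
    (hV : MemLp V 2 (volume.restrict (Set.Ioc a b)))
    (hv : IsProfile a b V v) (hw : IsProfile a b V w) (hK : retC (b - a) * n2 a b V ≤ 1 / 2)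
    (ha : v a = w a) : ∀ t ∈ Set.Icc a b, v t = w t := by
  obtain ⟨h2, h3⟩ := hv.sub_le hab h1 hV hV hw hK
  have h4 : n2 a b (fun t => V t - V t) = 0 := by simp [n2]
  rw [h4, ha, sub_self, enorm_zero] at h2 h3
  have h5 : n4 a b (fun t => free t (v t - w t)) = 0 := by
    simpa using h2
  intro t ht
  have := h3 t ht
  rw [h5] at this
  simpa [sub_eq_zero] using this

/-- Existence on a short time interval, by Picard iteration. -/
theorem exists_isProfile_short {a b : ℝ} {V : ℝ → L2} (hab : a ≤ b) (h1 : b - a ≤ 1)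
    (hV : MemLp V 2 (volume.restrict (Set.Ioc a b))) (hK : retC (b - a) * n2 a b V ≤ 1 / 2)
    (ψ : L2) : ∃ v, IsProfile a b V v ∧ v a = ψ := by
  have haa : a ∈ Set.Icc a b := ⟨le_rfl, hab⟩
  have hI : ‖-Complex.I‖ₑ = 1 := by rw [← ofReal_norm]; simp
  -- Below, `step` is −i times Duhamel's map and `d j` are its iterates on the constant profile ψ:
  -- the terms of the Picard series, not its partial sums. Their L⁴ norms at least halve each time,
  -- and each sup norm is bounded by the preceding L⁴ norm, so both series converge.
  let S := {v : ℝ → L2 // ContinuousOn v (Set.Icc a b) ∧ n4 a b (fun t => free t (v t)) < ⊤}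
  have hstep : ∀ s : S, ∃ s' : S,
      (∀ t ∈ Set.Icc a b, ∀ n, inner ℂ (e n) (s'.1 t) =
        -Complex.I * duh V (fun r => free r (s.1 r)) n a t) ∧
      (∀ t ∈ Set.Icc a b, ‖s'.1 t‖ₑ ≤
        strC (b - a) * n2 a b V * n4 a b (fun t => free t (s.1 t))) ∧
      n4 a b (fun t => free t (s'.1 t)) ≤ 1 / 2 * n4 a b (fun t => free t (s.1 t)) := by
    rintro ⟨v, hvc, hv4⟩
    obtain ⟨x, hx, hxc, hxb, hx4⟩ := exists_duhamel h1 hV (continuousOn_free hvc) hv4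
    have hxa : x a = 0 := ext_coef fun n => by rw [hx a haa n]; simp [duh]
    have h4 : n4 a b (fun t => free t ((-Complex.I) • x t)) ≤
        1 / 2 * n4 a b (fun t => free t (v t)) := by
      rw [n4_free_smul, hI, one_mul]
      have := hx4 a b le_rfl hab le_rfl
      simp only [hxa, sub_zero] at this
      refine this.trans ?_
      gcongr
      exact hK
    have hxc' : ContinuousOn (fun t => (-Complex.I) • x t) (Set.Icc a b) := by fun_prop
    refine ⟨⟨fun t => (-Complex.I) • x t, hxc',
      h4.trans_lt (ENNReal.mul_lt_top (by norm_num) hv4)⟩, fun t ht n => ?_, fun t ht => ?_, h4⟩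
    · rw [inner_smul_right, hx t ht n]
    · have := hxb a t le_rfl ht.1 ht.2
      rw [hxa, sub_zero] at this
      rw [enorm_smul, hI, one_mul]
      refine this.trans ?_
      gcongr
      · exact strC_mono (by linarith [ht.1]) (by linarith [ht.2])
      · exact n2_mono le_rfl ht.2 V
      · exact n4_mono le_rfl ht.2 _
  choose step hs1 hs2 hs3 using hstep
  have hψ4 : n4 a b (fun t => free t ψ) < ⊤ := (n4_free_le ψ a b h1).trans_lt
    (ENNReal.mul_lt_top (strC_lt_top _) (by simp))
  let d : ℕ → S := fun j => step^[j] ⟨fun _ => ψ, continuousOn_const, hψ4⟩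
  have hd0 : ∀ t, (d 0).1 t = ψ := fun _ => rfl
  have hdS : ∀ j, d (j + 1) = step (d j) := fun j => Function.iterate_succ_apply' _ _ _
  set M := n4 a b (fun t => free t ψ) with hM
  have h4 : ∀ j, n4 a b (fun t => free t ((d j).1 t)) ≤ (1 / 2) ^ j * M := by
    intro j
    induction j with
    | zero => simp [hd0, hM]
    | succ j ih =>
      rw [hdS]
      refine (hs3 _).trans ?_
      rw [pow_succ', mul_assoc]
      gcongr
  set C : ℝ := (strC (b - a) * n2 a b V * M).toReal with hC
  have hCtop : strC (b - a) * n2 a b V * M < ⊤ :=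
    ENNReal.mul_lt_top (ENNReal.mul_lt_top (strC_lt_top _) (n2_lt_top hV)) hψ4
  set bd : ℕ → ℝ := fun j => (‖ψ‖ + 2 * C) * (1 / 2) ^ j with hbd
  have hC0 : 0 ≤ C := ENNReal.toReal_nonneg
  have hbound : ∀ j, ∀ t ∈ Set.Icc a b, ‖(d j).1 t‖ ≤ bd j := by
    intro j t ht
    cases j with
    | zero => rw [hd0]; simp only [hbd, pow_zero, mul_one]; linarith
    | succ j =>
      have h5 : ‖(d (j + 1)).1 t‖ₑ ≤ ENNReal.ofReal (C * (1 / 2) ^ j) := by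
        rw [hdS]
        refine (hs2 _ t ht).trans ?_
        rw [hC, ENNReal.ofReal_mul ENNReal.toReal_nonneg, ENNReal.ofReal_toReal hCtop.ne,
          ENNReal.ofReal_pow (by norm_num)]
        have : ENNReal.ofReal (1 / 2) = 1 / 2 := by
          rw [ENNReal.ofReal_div_of_pos (by norm_num)]; simp
        rw [this, mul_assoc, mul_assoc, mul_assoc]
        gcongr
        rw [mul_comm M]
        exact h4 j
      rw [← ofReal_norm, ENNReal.ofReal_le_ofReal_iff (by positivity)] at h5
      refine h5.trans ?_
      simp only [hbd, pow_succ]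
      have : (0 : ℝ) < (1 / 2) ^ j := by positivity
      nlinarith [norm_nonneg ψ]
  have hbs : Summable bd := (summable_geometric_of_lt_one (by norm_num) (by norm_num)).mul_left _
  have hsum : ∀ t ∈ Set.Icc a b, HasSum (fun j => (d j).1 t) (∑' j, (d j).1 t) := fun t ht =>
    (Summable.of_norm_bounded hbs fun j => hbound j t ht).hasSum
  have hvc : ContinuousOn (fun t => ∑' j, (d j).1 t) (Set.Icc a b) :=
    continuousOn_tsum (fun j => (d j).2.1) hbs hbound
  have hfsum : ∀ t ∈ Set.Icc a b,
      HasSum (fun j => free t ((d j).1 t)) (free t (∑' j, (d j).1 t)) := fun t ht =>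
    (hsum t ht).mapL (free t).toContinuousLinearMap
  refine ⟨fun t => ∑' j, (d j).1 t, ⟨hvc, ?_, fun t ht n => ?_⟩, ?_⟩
  · refine (n4_tsum_le (fun j => aesm_free (d j).2.1)
      (fun t ht => hfsum t (Set.Ioc_subset_Icc_self ht))).trans_lt ?_
    refine (ENNReal.tsum_le_tsum h4).trans_lt ?_
    rw [ENNReal.tsum_mul_right, ENNReal.tsum_geometric]
    refine ENNReal.mul_lt_top ?_ hψ4
    simp
  · have e1 : HasSum (fun j => duh V (fun r => free r ((d j).1 r)) n a t)
        (duh V (fun r => free r (∑' j, (d j).1 r)) n a t) := by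
      have hsub : Set.uIoc a t ⊆ Set.Icc a b := by
        rw [Set.uIoc_of_le ht.1]
        exact (Set.Ioc_subset_Ioc_right ht.2).trans Set.Ioc_subset_Icc_self
      refine intervalIntegral.hasSum_integral_of_dominated_convergence
        (fun j r => ‖prodCoef n‖ * ‖V r‖ * bd j) (fun j => ?_) (fun j => ?_) ?_ ?_ ?_
      · have := (intervalIntegrable_duh hV (continuousOn_free (d j).2.1) n le_rfl ht.1 ht.2)
        exact this.def'.aestronglyMeasurable
      · refine Eventually.of_forall fun r hr => ?_
        rw [norm_mul, norm_phase, one_mul]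
        refine ((prodCoef n).le_opNorm₂ _ _).trans ?_
        rw [LinearIsometry.norm_map]
        gcongr
        exact hbound j r (hsub hr)
      · exact Eventually.of_forall fun r _ => hbs.mul_left _
      · simp only [tsum_mul_left]
        refine IntervalIntegrable.mul_const (IntervalIntegrable.const_mul ?_ _) _
        rw [intervalIntegrable_iff_integrableOn_Ioc_of_le ht.1]
        exact ((memLp_sub_interval hV le_rfl ht.2).integrable (by norm_num)).norm
      · exact Eventually.of_forall fun r hr =>
          ((hfsum r (hsub hr)).mapL (prodCoef n (V r))).mul_left _
    have e2 : HasSum (fun j => inner ℂ (e n) ((d j).1 t)) (inner ℂ (e n) (∑' j, (d j).1 t)) :=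
      (hsum t ht).mapL (innerSL ℂ (e n))
    have e3 : HasSum (fun j => inner ℂ (e n) ((d (j + 1)).1 t))
        (-Complex.I * duh V (fun r => free r (∑' j, (d j).1 r)) n a t) := by
      refine (e1.mul_left (-Complex.I)).congr_fun ?_
      intro j
      rw [hdS]
      exact hs1 _ t ht n
    -- The series without its first term is the termwise image of the series under Duhamel's map,
    -- which is the integral equation.
    have e4 := e2.unique (e3.zero_add (f := fun j => inner ℂ (e n) ((d j).1 t)))
    rw [e4, hd0]
    have hva : ∑' j, (d j).1 a = ψ := by
      rw [tsum_eq_single 0, hd0]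
      intro j hj
      obtain ⟨i, rfl⟩ := Nat.exists_eq_succ_of_ne_zero hj
      apply ext_coef
      intro m
      rw [Nat.succ_eq_add_one, hdS, hs1 _ a haa m]
      simp [duh]
    rw [hva]
    ring
  · change ∑' j, (d j).1 a = ψ
    rw [tsum_eq_single 0, hd0]
    intro j hj
    obtain ⟨i, rfl⟩ := Nat.exists_eq_succ_of_ne_zero hj
    apply ext_coef
    intro m
    rw [Nat.succ_eq_add_one, hdS, hs1 _ a haa m]
    simp [duh]

/-! ### Linear Schrödinger equations on long time intervals -/

/-- The step is applied between the consecutive points min(kh, t), which are at most h apart and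
reach t. -/
theorem step_induction {P : ℝ → Prop} {T h : ℝ} (hh : 0 < h) (h0 : P 0)
    (hstep : ∀ s t, 0 ≤ s → s ≤ t → t ≤ T → t - s ≤ h → P s → P t) :
    ∀ t ∈ Set.Icc 0 T, P t := by
  intro t ht
  have key : ∀ k : ℕ, P (min (k * h) t) := by
    intro k
    induction k with
    | zero => simpa [ht.1] using h0
    | succ k ih =>
      refine hstep _ _ (le_min (by positivity) ht.1) ?_ ((min_le_right _ _).trans ht.2) ?_ ih
      · exact min_le_min_right _ (by push_cast; nlinarith)
      · push_cast
        rcases le_total (k * h) t with h1 | h1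
        · rw [min_eq_left h1]
          have := min_le_left ((k + 1) * h) t
          linarith
        · rw [min_eq_right h1]
          have := min_le_right ((k + 1) * h) t
          linarith
  obtain ⟨k, hk⟩ := exists_nat_ge (t / h)
  have h1 : t ≤ k * h := by rwa [div_le_iff₀ hh] at hk
  have := key k
  rwa [min_eq_right h1] at this

theorem exists_small_step {f : ℝ → ℝ≥0∞} (hf : Tendsto f (𝓝 0) (𝓝 0)) {ε X : ℝ≥0∞} (hε : 0 < ε)
    (hX : X < ⊤) : ∃ h : ℝ, 0 < h ∧ h ≤ 1 ∧ ∀ h', 0 ≤ h' → h' ≤ h → f h' * X ≤ ε := by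
  have h1 := ENNReal.Tendsto.mul_const (b := X) hf (Or.inr hX.ne)
  rw [zero_mul] at h1
  obtain ⟨δ, hδ, hb⟩ := Metric.eventually_nhds_iff.mp (h1.eventually (gt_mem_nhds hε))
  refine ⟨min (δ / 2) 1, by positivity, min_le_right _ _, fun h' h0 hh' => ?_⟩
  refine (hb ?_).le
  rw [Real.dist_eq, sub_zero, abs_of_nonneg h0]
  have := hh'.trans (min_le_left _ _)
  linarith

/-- The norm of V on a subinterval is at most its norm on (0, T], so one step length serves
everywhere. -/
theorem exists_step {T : ℝ} {V : ℝ → L2} (hV : MemLp V 2 (volume.restrict (Set.Ioc 0 T))) :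
    ∃ h : ℝ, 0 < h ∧ h ≤ 1 ∧ ∀ s t, 0 ≤ s → s ≤ t → t ≤ T → t - s ≤ h →
      retC (t - s) * n2 s t V ≤ 1 / 2 := by
  obtain ⟨h, h0, h1, hb⟩ := exists_small_step tendsto_retC (ε := 1 / 2) (by norm_num) (n2_lt_top hV)
  refine ⟨h, h0, h1, fun s t hs hst ht hh => le_trans ?_ (hb (t - s) (by linarith) hh)⟩
  gcongr
  exact n2_mono hs ht V

theorem exists_isProfile {T : ℝ} {V : ℝ → L2} (hT : 0 ≤ T)
    (hV : MemLp V 2 (volume.restrict (Set.Ioc 0 T))) (ψ : L2) :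
    ∃ v, IsProfile 0 T V v ∧ v 0 = ψ := by
  obtain ⟨h, h0, h1, hb⟩ := exists_step hV
  refine step_induction (P := fun t => ∃ v, IsProfile 0 t V v ∧ v 0 = ψ) h0 ?_ ?_ T ⟨hT, le_rfl⟩
  · exact exists_isProfile_short le_rfl (by norm_num) (memLp_sub_interval hV le_rfl hT)
      (by simp [n2]) ψ
  · rintro s t hs hst ht hh ⟨v, hv, hv0⟩
    obtain ⟨w, hw, hws⟩ := exists_isProfile_short hst (hh.trans h1) (memLp_sub_interval hV hs ht)
      (hb s t hs hst ht hh) (v s)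
    refine ⟨fun r => if r ≤ s then v r else w r, ?_, by simp [hs, hv0]⟩
    refine (hv.congr hs fun r hr => if_pos hr.2).union (hw.congr hst fun r hr => ?_)
      (memLp_sub_interval hV le_rfl ht) hs hst
    by_cases h2 : r ≤ s
    · have : r = s := le_antisymm h2 hr.1
      subst this
      simp [hws]
    · exact if_neg h2

theorem IsProfile.unique {T : ℝ} {V v w : ℝ → L2}
    (hV : MemLp V 2 (volume.restrict (Set.Ioc 0 T))) (hv : IsProfile 0 T V v)
    (hw : IsProfile 0 T V w) (h0 : v 0 = w 0) : ∀ t ∈ Set.Icc 0 T, v t = w t := by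
  obtain ⟨h, hh0, h1, hb⟩ := exists_step hV
  refine step_induction (P := fun t => v t = w t) hh0 h0 ?_
  intro s t hs hst ht hh h2
  exact (hv.mono hV hs ht).eqOn hst (hh.trans h1) (memLp_sub_interval hV hs ht) (hw.mono hV hs ht)
    (hb s t hs hst ht hh) h2 t ⟨hst, le_rfl⟩

theorem IsProfile.smul_add {a b : ℝ} {V v w : ℝ → L2}
    (hV : MemLp V 2 (volume.restrict (Set.Ioc a b))) (c : ℂ) (hv : IsProfile a b V v)
    (hw : IsProfile a b V w) : IsProfile a b V (fun t => c • v t + w t) := by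
  have hvc := hv.cont
  have hwc := hw.cont
  have hcv : ContinuousOn (fun t => c • v t) (Set.Icc a b) := by fun_prop
  refine ⟨hcv.add hwc, ?_, fun t ht n => ?_⟩
  · refine (n4_free_add_le hcv hwc).trans_lt ?_
    rw [n4_free_smul]
    exact ENNReal.add_lt_top.mpr ⟨ENNReal.mul_lt_top (by simp) hv.fin, hw.fin⟩
  · have h1 : duh V (fun r => free r (c • v r + w r)) n a t =
        c * duh V (fun r => free r (v r)) n a t + duh V (fun r => free r (w r)) n a t := by
      unfold duh
      rw [← intervalIntegral.integral_const_mul, ← intervalIntegral.integral_add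
        ((intervalIntegrable_duh hV (continuousOn_free hvc) n le_rfl ht.1 ht.2).const_mul c)
        (intervalIntegrable_duh hV (continuousOn_free hwc) n le_rfl ht.1 ht.2)]
      refine intervalIntegral.integral_congr fun r _ => ?_
      simp only [map_add, map_smul, smul_eq_mul]
      ring
    rw [inner_add_right, inner_smul_right, inner_add_right, inner_smul_right, hv.eq t ht n,
      hw.eq t ht n, h1]
    ring

/-! ### Conservation of the `L²` norm for real potentials -/

/-- `f` is real valued. -/
def IsRealValued (f : L2) : Prop := ∀ᵐ x : Circ, (starRingEnd ℂ) (f x) = f x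

/-- For g = u the integral is ∫ V|u|², which is real, so −i times it has no real part. Only g − u
contributes. -/
theorem abs_re_integral_le {V u g : L2} (hV : IsRealValued V) (hu : quart u < ⊤) :
    ‖(-Complex.I * ∫ x : Circ, (starRingEnd ℂ) (g x) * (V x * u x)).re‖ₑ ≤
      quart (g - u) ^ (1 / 4 : ℝ) * ‖V‖ₑ * quart u ^ (1 / 4 : ℝ) := by
  -- If g − u is not in L⁴ the right side is infinite, unless V or u vanishes and 0·∞ = 0; then the
  -- left side is seen to vanish directly.
  by_cases hgu : quart (g - u) = ⊤
  · rcases eq_or_ne ‖V‖ₑ 0 with hV0 | hV0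
    · have hV' : V = 0 := by simpa using hV0
      have h1 : ∫ x : Circ, (starRingEnd ℂ) (g x) * (V x * u x) = 0 := by
        rw [integral_congr_ae (g := fun _ => 0), integral_zero]
        filter_upwards [Lp.coeFn_zero ℂ 2 (volume : Measure Circ)] with x hx
        rw [hV', hx]; simp
      rw [h1]; simp
    rcases eq_or_ne (quart u) 0 with hu0 | hu0
    · have h1 : ∫ x : Circ, (starRingEnd ℂ) (g x) * (V x * u x) = 0 := by
        have h2 : ∀ᵐ x : Circ, ‖u x‖ₑ ^ 4 = 0 :=
          (lintegral_eq_zero_iff' ((Lp.aestronglyMeasurable u).enorm.pow_const 4)).mp hu0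
        rw [integral_congr_ae (g := fun _ => 0), integral_zero]
        filter_upwards [h2] with x hx
        have : u x = 0 := by simpa using hx
        rw [this]; simp
      rw [h1]; simp
    · rw [hgu, ENNReal.top_rpow_of_pos (by norm_num), ENNReal.top_mul hV0, ENNReal.top_mul]
      · exact le_top
      · simp [hu0]
  have hfin : ∀ f : L2, quart f < ⊤ →
      Integrable fun x : Circ => (starRingEnd ℂ) (f x) * (V x * u x) := by
    intro f hf
    refine ⟨(Complex.continuous_conj.comp_aestronglyMeasurable (Lp.aestronglyMeasurable f)).mul
      ((Lp.aestronglyMeasurable V).mul (Lp.aestronglyMeasurable u)), ?_⟩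
    rw [HasFiniteIntegral]
    refine lt_of_le_of_lt (le_of_eq ?_) ((lintegral_mul_mul_le f V u).trans_lt ?_)
    · refine lintegral_congr fun x => ?_
      rw [enorm_mul, enorm_mul, ← mul_assoc, ← ofReal_norm ((starRingEnd ℂ) _), RCLike.norm_conj,
        ofReal_norm]
    · exact ENNReal.mul_lt_top (ENNReal.mul_lt_top (ENNReal.rpow_lt_top_of_nonneg (by norm_num)
        hf.ne) (by simp)) (ENNReal.rpow_lt_top_of_nonneg (by norm_num) hu.ne)
  have h1 : ∫ x : Circ, (starRingEnd ℂ) (g x) * (V x * u x) =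
      (∫ x : Circ, (starRingEnd ℂ) ((g - u : L2) x) * (V x * u x)) +
        ∫ x : Circ, (starRingEnd ℂ) (u x) * (V x * u x) := by
    rw [← integral_add (hfin _ (lt_top_iff_ne_top.mpr hgu)) (hfin _ hu)]
    refine integral_congr_ae ?_
    filter_upwards [Lp.coeFn_sub g u] with x hx
    rw [hx, Pi.sub_apply, map_sub]; ring
  have h2 : (-Complex.I * ∫ x : Circ, (starRingEnd ℂ) (u x) * (V x * u x)).re = 0 := by
    have h3 : (starRingEnd ℂ) (∫ x : Circ, (starRingEnd ℂ) (u x) * (V x * u x)) =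
        ∫ x : Circ, (starRingEnd ℂ) (u x) * (V x * u x) := by
      rw [← integral_conj]
      refine integral_congr_ae ?_
      filter_upwards [hV] with x hx
      rw [map_mul, map_mul, hx, Complex.conj_conj]; ring
    have h4 := Complex.conj_eq_iff_im.mp h3
    simp [h4]
  rw [h1, mul_add, Complex.add_re, h2, add_zero]
  calc ‖(-Complex.I * ∫ x : Circ, (starRingEnd ℂ) ((g - u : L2) x) * (V x * u x)).re‖ₑ
      ≤ ‖∫ x : Circ, (starRingEnd ℂ) ((g - u : L2) x) * (V x * u x)‖ₑ := by
        rw [← ofReal_norm, ← ofReal_norm]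
        apply ENNReal.ofReal_le_ofReal
        refine (Complex.abs_re_le_norm _).trans ?_
        rw [norm_mul]; simp
    _ ≤ ∫⁻ x : Circ, ‖(g - u : L2) x‖ₑ * ‖V x‖ₑ * ‖u x‖ₑ := by
        refine (enorm_integral_le_lintegral_enorm _).trans (le_of_eq ?_)
        refine lintegral_congr fun x => ?_
        rw [enorm_mul, enorm_mul, ← mul_assoc, ← ofReal_norm ((starRingEnd ℂ) _),
          RCLike.norm_conj, ofReal_norm]
    _ ≤ _ := lintegral_mul_mul_le _ _ _

/-- Cut the interval into 2^j equal pieces: by additivity of μ the increments sum to at most ε((b −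
a)/2^j)·μ, which tends to 0. -/
theorem eq_of_enorm_sub_le {f : ℝ → ℝ} {ε : ℝ → ℝ≥0∞} {μ : Measure ℝ} {a b : ℝ}
    (hε : Tendsto ε (𝓝 0) (𝓝 0)) (hμ : μ (Set.Ioc a b) < ⊤)
    (hf : ∀ s t, a ≤ s → s ≤ t → t ≤ b → ‖f t - f s‖ₑ ≤ ε (t - s) * μ (Set.Ioc s t)) (hab : a ≤ b) :
    f b = f a := by
  have key : ∀ j : ℕ, ∀ s t, a ≤ s → s ≤ t → t ≤ b →
      ‖f t - f s‖ₑ ≤ ε ((t - s) / 2 ^ j) * μ (Set.Ioc s t) := by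
    intro j
    induction j with
    | zero => simpa using hf
    | succ j ih =>
      intro s t hs hst ht
      set c := (s + t) / 2 with hc
      have h1 := ih s c hs (by linarith) (by linarith)
      have h2 := ih c t (by linarith) (by linarith) ht
      have e1 : (c - s) / 2 ^ j = (t - s) / 2 ^ (j + 1) := by rw [hc, pow_succ]; field_simp; ring
      have e2 : (t - c) / 2 ^ j = (t - s) / 2 ^ (j + 1) := by rw [hc, pow_succ]; field_simp; ring
      rw [e1] at h1
      rw [e2] at h2
      have h3 : μ (Set.Ioc s c) + μ (Set.Ioc c t) = μ (Set.Ioc s t) := by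
        rw [← Set.Ioc_union_Ioc_eq_Ioc (show s ≤ c by linarith) (show c ≤ t by linarith),
          measure_union (Set.Ioc_disjoint_Ioc_of_le le_rfl) measurableSet_Ioc]
      calc ‖f t - f s‖ₑ = ‖(f c - f s) + (f t - f c)‖ₑ := by congr 1; ring
        _ ≤ ‖f c - f s‖ₑ + ‖f t - f c‖ₑ := enorm_add_le _ _
        _ ≤ _ := add_le_add h1 h2
        _ = _ := by rw [← mul_add, h3]
  have h1 : Tendsto (fun j : ℕ => ε ((b - a) / 2 ^ j) * μ (Set.Ioc a b)) atTop (𝓝 0) := by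
    have h2 : Tendsto (fun j : ℕ => (b - a) / 2 ^ j) atTop (𝓝 0) := by
      have := (tendsto_pow_atTop_nhds_zero_of_lt_one (r := (1 / 2 : ℝ)) (by norm_num)
        (by norm_num)).const_mul (b - a)
      simpa [div_eq_mul_inv] using this
    have := ENNReal.Tendsto.mul_const (b := μ (Set.Ioc a b)) (hε.comp h2) (Or.inr hμ.ne)
    rwa [zero_mul] at this
  have h2 : ‖f b - f a‖ₑ ≤ 0 := ge_of_tendsto h1
    (Eventually.of_forall fun j => key j a b le_rfl hab le_rfl)
  have h3 : f b - f a = 0 := by simpa using h2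
  linarith

/-- The equation is known coefficient by coefficient, so `v s` is tested through its Fourier
truncations ψ. Since V is real, ψ may be replaced by ψ − v(r), which splits into the truncation
error ψ − v(s), a free wave, and the small increment v(r) − v(s). -/
theorem IsProfile.enorm_re_inner_le {a b : ℝ} {V v : ℝ → L2} (h1 : b - a ≤ 1)
    (hV : MemLp V 2 (volume.restrict (Set.Ioc a b)))
    (hreal : ∀ᵐ t ∂(volume.restrict (Set.Ioc a b)), IsRealValued (V t))
    (hv : IsProfile a b V v) {s t : ℝ} (hs : a ≤ s) (hst : s ≤ t) (ht : t ≤ b) (F : Finset ℤ) :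
    ‖(inner ℂ (∑ n ∈ F, inner ℂ (e n) (v s) • e n) (v t - v s)).re‖ₑ ≤
      (strC (t - s) * ‖(∑ n ∈ F, inner ℂ (e n) (v s) • e n) - v s‖ₑ +
        n4 s t (fun r => free r (v r - v s))) * n2 s t V * n4 s t (fun r => free r (v r)) := by
  set c : ℤ → ℂ := fun n => inner ℂ (e n) (v s) with hc
  set ψ : L2 := ∑ n ∈ F, c n • e n with hψ
  have hsub : Set.Ioc s t ⊆ Set.Ioc a b := Set.Ioc_subset_Ioc hs ht
  have hvs : IsProfile s t V v := hv.mono hV hs ht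
  have hVs := memLp_sub_interval hV hs ht
  have e1 : inner ℂ ψ (v t - v s) = ∫ r in Set.Ioc s t,
      -Complex.I * ∑ n ∈ F, (starRingEnd ℂ) (c n) *
        (phase (-r) n * prodCoef n (V r) (free r (v r))) := by
    rw [hψ, sum_inner, integral_const_mul, integral_finsetSum _ fun n _ =>
      (integrableOn_duh hVs (continuousOn_free hvs.cont) n).const_mul _, Finset.mul_sum]
    refine Finset.sum_congr rfl fun n _ => ?_
    rw [inner_smul_left, inner_sub_right, hvs.eq t ⟨hst, le_rfl⟩ n, integral_const_mul,
      duh, intervalIntegral.integral_of_le hst]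
    ring
  have hint : Integrable (fun r => -Complex.I * ∑ n ∈ F, (starRingEnd ℂ) (c n) *
        (phase (-r) n * prodCoef n (V r) (free r (v r)))) (volume.restrict (Set.Ioc s t)) :=
    (integrable_finsetSum _ fun n _ =>
      (integrableOn_duh hVs (continuousOn_free hvs.cont) n).const_mul _).const_mul _
  have e2 : (inner ℂ ψ (v t - v s)).re = ∫ r in Set.Ioc s t,
      (-Complex.I * ∑ n ∈ F, (starRingEnd ℂ) (c n) *
        (phase (-r) n * prodCoef n (V r) (free r (v r)))).re := by
    rw [e1]
    exact (integral_re hint).symm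
  have hae : ∀ᵐ r ∂(volume.restrict (Set.Ioc s t)), quart (free r (v r)) < ⊤ := by
    refine ae_lt_top' (aemeasurable_quart (aesm_free hvs.cont)) ?_
    rw [← n4_pow]
    exact (ENNReal.pow_lt_top hvs.fin).ne
  have hψc : ContinuousOn (fun r => ψ - v r) (Set.Icc s t) := continuousOn_const.sub hvs.cont
  rw [e2]
  refine (enorm_integral_le_lintegral_enorm _).trans ?_
  calc ∫⁻ r in Set.Ioc s t, ‖(-Complex.I * ∑ n ∈ F, (starRingEnd ℂ) (c n) *
        (phase (-r) n * prodCoef n (V r) (free r (v r)))).re‖ₑ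
      ≤ ∫⁻ r in Set.Ioc s t, quart (free r (ψ - v r)) ^ (1 / 4 : ℝ) * ‖V r‖ₑ *
          quart (free r (v r)) ^ (1 / 4 : ℝ) := by
        refine lintegral_mono_ae ?_
        filter_upwards [hae, ae_restrict_of_ae_restrict_of_subset hsub hreal] with r hr1 hr2
        rw [sum_prodCoef, map_sub]
        exact abs_re_integral_le hr2 hr1
    _ ≤ n4 s t (fun r => free r (ψ - v r)) * n2 s t V * n4 s t (fun r => free r (v r)) :=
        lintegral_quart_mul_le (aesm_free hψc) hVs.1 (aesm_free hvs.cont)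
    _ ≤ _ := by
        gcongr
        have hsc : ContinuousOn (fun r => (-1 : ℂ) • (v r - v s)) (Set.Icc s t) := by
          have := hvs.cont
          fun_prop
        have e3 := n4_free_add_le (continuousOn_const (c := ψ - v s)) hsc
        rw [n4_free_smul, enorm_neg, enorm_one, one_mul] at e3
        have e4 : n4 s t (fun r => free r (ψ - v r)) =
            n4 s t (fun r => free r ((ψ - v s) + (-1 : ℂ) • (v r - v s))) :=
          n4_congr fun r _ => by congr 1; rw [neg_one_smul]; abel
        rw [e4]
        refine e3.trans (add_le_add (n4_free_le _ s t (by linarith)) le_rfl)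

/-- Expand ‖v t‖² about `v s`. The term ‖v t − v s‖² is quadratic in X, and because V is real so is
the cross term 2 Re⟨v s, v t − v s⟩; the constant is 3 = 2 + 1. A bound of second order is what
conservation needs. -/
theorem IsProfile.enorm_normSq_sub_le {a b : ℝ} {V v : ℝ → L2} (h1 : b - a ≤ 1)
    (hV : MemLp V 2 (volume.restrict (Set.Ioc a b)))
    (hreal : ∀ᵐ t ∂(volume.restrict (Set.Ioc a b)), IsRealValued (V t))
    (hv : IsProfile a b V v) {s t : ℝ} (hs : a ≤ s) (hst : s ≤ t) (ht : t ≤ b) :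
    ‖‖v t‖ ^ 2 - ‖v s‖ ^ 2‖ₑ ≤
      3 * retC (t - s) * (n2 s t V * n4 s t (fun r => free r (v r))) ^ 2 := by
  obtain ⟨z, hz, hzc, hzb, hz4⟩ := exists_duhamel h1 hV (continuousOn_free hv.cont) hv.fin
  have hvz : ∀ r ∈ Set.Icc a b, v r = v a + (-Complex.I) • z r := by
    intro r hr
    apply ext_coef
    intro n
    rw [inner_add_right, inner_smul_right, hz r hr n, hv.eq r hr n]; ring
  have hss : s ∈ Set.Icc a b := ⟨hs, hst.trans ht⟩
  have htt : t ∈ Set.Icc a b := ⟨hs.trans hst, ht⟩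
  have hdiff : ∀ r ∈ Set.Icc a b, v r - v s = (-Complex.I) • (z r - z s) := by
    intro r hr
    rw [hvz r hr, hvz s hss, smul_sub]; abel
  set X := n2 s t V * n4 s t (fun r => free r (v r)) with hX
  have hδ : ‖v t - v s‖ₑ ≤ strC (t - s) * X := by
    rw [hdiff t htt, enorm_smul, enorm_neg_I, one_mul, hX, ← mul_assoc]
    exact hzb s t hs hst ht
  have hδ4 : n4 s t (fun r => free r (v r - v s)) ≤ retC (t - s) * X := by
    rw [n4_congr (w := fun r => free r ((-Complex.I) • (z r - z s)))
      (fun r hr => by rw [hdiff r ⟨hs.trans hr.1.le, hr.2.trans ht⟩]), n4_free_smul, enorm_neg_I,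
      one_mul, hX, ← mul_assoc]
    exact hz4 s t hs hst ht
  have hre : ‖(inner ℂ (v s) (v t - v s)).re‖ₑ ≤ retC (t - s) * X ^ 2 := by
    have hψ : Tendsto (fun F : Finset ℤ => ∑ n ∈ F, inner ℂ (e n) (v s) • e n) atTop (𝓝 (v s)) :=
      hasSum_coef_smul (v s)
    have l1 : Tendsto (fun F : Finset ℤ =>
        ‖(inner ℂ (∑ n ∈ F, inner ℂ (e n) (v s) • e n) (v t - v s)).re‖ₑ) atTop
        (𝓝 ‖(inner ℂ (v s) (v t - v s)).re‖ₑ) := by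
      have : Continuous fun f : L2 => ‖(inner ℂ f (v t - v s)).re‖ₑ := by
        have : Continuous fun f : L2 => inner ℂ f (v t - v s) := by fun_prop
        exact (Complex.continuous_re.comp this).enorm
      exact (this.tendsto _).comp hψ
    have l2 : Tendsto (fun F : Finset ℤ =>
        (strC (t - s) * ‖(∑ n ∈ F, inner ℂ (e n) (v s) • e n) - v s‖ₑ + retC (t - s) * X) * X)
        atTop (𝓝 ((strC (t - s) * 0 + retC (t - s) * X) * X)) := by
      have hXtop : X < ⊤ := ENNReal.mul_lt_top ((n2_mono hs ht V).trans_lt (n2_lt_top hV))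
        ((n4_mono hs ht _).trans_lt hv.fin)
      have l3 : Tendsto (fun F : Finset ℤ => ‖(∑ n ∈ F, inner ℂ (e n) (v s) • e n) - v s‖ₑ)
          atTop (𝓝 0) := by
        have := (hψ.sub_const (v s)).enorm
        rwa [sub_self, enorm_zero] at this
      exact ENNReal.Tendsto.mul_const ((ENNReal.Tendsto.const_mul l3
        (Or.inr (strC_lt_top _).ne)).add tendsto_const_nhds) (Or.inr hXtop.ne)
    have := le_of_tendsto_of_tendsto l1 l2 (Eventually.of_forall fun F => by
      refine (hv.enorm_re_inner_le h1 hV hreal hs hst ht F).trans ?_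
      refine (mul_assoc _ _ _).le.trans ?_
      exact mul_le_mul' (add_le_add le_rfl hδ4) le_rfl)
    refine this.trans (le_of_eq ?_)
    ring
  have hsq : ‖v t‖ ^ 2 - ‖v s‖ ^ 2 = 2 * (inner ℂ (v s) (v t - v s)).re + ‖v t - v s‖ ^ 2 := by
    have h3 := norm_add_sq (𝕜 := ℂ) (v s) (v t - v s)
    rw [add_sub_cancel] at h3
    have h4 : RCLike.re (inner ℂ (v s) (v t - v s)) = (inner ℂ (v s) (v t - v s)).re := rfl
    rw [h4] at h3
    linarith
  rw [hsq]
  calc _ ≤ ‖2 * (inner ℂ (v s) (v t - v s)).re‖ₑ + ‖‖v t - v s‖ ^ 2‖ₑ := enorm_add_le _ _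
    _ = 2 * ‖(inner ℂ (v s) (v t - v s)).re‖ₑ + ‖v t - v s‖ₑ ^ 2 := by
        rw [enorm_mul, enorm_pow, enorm_norm]
        congr 2
        rw [← ofReal_norm]; norm_num
    _ ≤ 2 * (retC (t - s) * X ^ 2) + retC (t - s) * X ^ 2 := by
        gcongr
        refine (pow_le_pow_left' hδ 2).trans ?_
        rw [mul_pow]
        gcongr
        unfold retC
        exact le_mul_of_one_le_left (by positivity) (by norm_num)
    _ = _ := by ring

theorem IsProfile.norm_eq {T : ℝ} {V v : ℝ → L2}
    (hV : MemLp V 2 (volume.restrict (Set.Ioc 0 T)))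
    (hreal : ∀ᵐ t ∂(volume.restrict (Set.Ioc 0 T)), IsRealValued (V t))
    (hv : IsProfile 0 T V v) : ∀ t ∈ Set.Icc 0 T, ‖v t‖ = ‖v 0‖ := by
  refine step_induction (P := fun t => ‖v t‖ = ‖v 0‖) one_pos rfl ?_
  intro a b ha hab hb h1 ih
  rw [← ih]
  have hVs := memLp_sub_interval hV ha hb
  have hvs := hv.mono hV ha hb
  set N := n4 a b (fun r => free r (v r)) with hN
  have hNtop : N < ⊤ := hvs.fin
  have hn2top := n2_lt_top hVs
  have h2 : ‖v b‖ ^ 2 = ‖v a‖ ^ 2 := by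
    -- The L⁴ factor is bounded by its value on all of [a, b]; the squared norm of V provides the
    -- additive measure, and `retC` the factor that tends to 0.
    refine eq_of_enorm_sub_le (f := fun t => ‖v t‖ ^ 2) (ε := fun h => 3 * retC h * N ^ 2)
      (μ := volume.withDensity fun r => ‖V r‖ₑ ^ 2) ?_ ?_ ?_ hab
    · have := ENNReal.Tendsto.mul_const (b := N ^ 2) (ENNReal.Tendsto.const_mul (a := 3)
        tendsto_retC (Or.inr (by norm_num))) (Or.inr (ENNReal.pow_lt_top hNtop).ne)
      simpa using this
    · rw [withDensity_apply _ measurableSet_Ioc, ← n2_sq]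
      exact ENNReal.pow_lt_top hn2top
    · intro s t hs hst ht
      refine (hvs.enorm_normSq_sub_le h1 hVs
        (ae_restrict_of_ae_restrict_of_subset (Set.Ioc_subset_Ioc ha hb) hreal) hs hst ht).trans ?_
      rw [withDensity_apply _ measurableSet_Ioc, ← n2_sq, mul_pow, mul_comm (n2 s t V ^ 2),
        ← mul_assoc]
      gcongr
      exact n4_mono hs ht _
  exact (sq_eq_sq₀ (norm_nonneg _) (norm_nonneg _)).mp h2

/-! ### Propagators -/

theorem timeMeasure_eq (T : ℝ) : timeMeasure T = volume.restrict (Set.Ioc 0 T) :=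
  Measure.restrict_congr_set Ioc_ae_eq_Icc.symm

theorem lintegral_Icc_eq_Ioc (T : ℝ) (f : ℝ → ℝ≥0∞) :
    ∫⁻ t in Set.Icc 0 T, f t = ∫⁻ t in Set.Ioc 0 T, f t := by
  rw [Measure.restrict_congr_set Ioc_ae_eq_Icc]

theorem n4_lt_top_iff {a b : ℝ} {u : ℝ → L2} :
    n4 a b u < ⊤ ↔ ∫⁻ t in Set.Ioc a b, quart (u t) < ⊤ := by
  unfold n4
  rw [ENNReal.rpow_lt_top_iff_of_pos (by norm_num)]

theorem duhamel_integral_eq (V u : ℝ → L2) (n : ℤ) (t : ℝ) :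
    (∫ s in (0 : ℝ)..t, Complex.exp (-Complex.I * (t - s) * n ^ 2) *
      ∫ x : Circ, (starRingEnd ℂ) (e n x) * (V s x * u s x)) = phase t n * duh V u n 0 t := by
  unfold duh
  rw [← intervalIntegral.integral_const_mul]
  refine intervalIntegral.integral_congr fun s _ => ?_
  have : Complex.exp (-Complex.I * (t - s) * n ^ 2) = phase t n * phase (-s) n := by
    rw [← phase_add, phase]
    congr 1; push_cast; ring
  simp only [this, prodCoef_apply]
  ring

theorem IsLinearSolution.initial {T : ℝ} {V : ℝ → L2} {φ : L2} {u : ℝ → L2} (hT : 0 ≤ T)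
    (h : IsLinearSolution T V φ u) : u 0 = φ := by
  apply ext_coef
  intro n
  rw [h.duhamel 0 ⟨le_rfl, hT⟩ n]
  simp

theorem IsLinearSolution.isProfile {T : ℝ} {V : ℝ → L2} {φ : L2} {u : ℝ → L2} (hT : 0 ≤ T)
    (h : IsLinearSolution T V φ u) : IsProfile 0 T V (fun t => free (-t) (u t)) where
  cont := by
    have h1 : ContinuousOn (fun t : ℝ => (-t, u t)) (Set.Icc 0 T) :=
      continuous_neg.continuousOn.prodMk h.continuousOn
    have h2 : ContinuousOn ((fun p : ℝ × L2 => free p.1 p.2) ∘ fun t => (-t, u t)) (Set.Icc 0 T) :=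
      continuous_free.comp_continuousOn h1
    simpa only [Function.comp_def] using h2
  fin := by
    simp only [free_free_neg]
    rw [n4_lt_top_iff, ← lintegral_Icc_eq_Ioc]
    exact h.strichartz
  eq t ht n := by
    simp only [free_free_neg]
    rw [coef_free, coef_free, neg_zero, phase_zero, one_mul, h.initial hT, h.duhamel t ht n,
      duhamel_integral_eq]
    have h1 := phase_neg_mul t n
    change phase (-t) n * (phase t n * inner ℂ (e n) φ -
      Complex.I * (phase t n * duh V (fun r => u r) n 0 t)) = _
    linear_combination (inner ℂ (e n) φ - Complex.I * duh V (fun r => u r) n 0 t) * h1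

theorem IsProfile.isLinearSolution {T : ℝ} {V v : ℝ → L2} (h : IsProfile 0 T V v) :
    IsLinearSolution T V (v 0) (fun t => free t (v t)) where
  continuousOn := continuousOn_free h.cont
  strichartz := by
    rw [lintegral_Icc_eq_Ioc]
    exact n4_lt_top_iff.mp h.fin
  duhamel t ht n := by
    rw [duhamel_integral_eq, coef_free, h.eq t ht n]
    change _ = phase t n * inner ℂ (e n) (v 0) - _
    ring

theorem IsLinearSolution.mono {T T' : ℝ} {V : ℝ → L2} {φ : L2} {u : ℝ → L2} (hT : T' ≤ T)
    (h : IsLinearSolution T V φ u) : IsLinearSolution T' V φ u where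
  continuousOn := h.continuousOn.mono (Set.Icc_subset_Icc_right hT)
  strichartz := (lintegral_mono_set (Set.Icc_subset_Icc_right hT)).trans_lt h.strichartz
  duhamel t ht n := h.duhamel t ⟨ht.1, ht.2.trans hT⟩ n

theorem IsPropagator.mono {T T' : ℝ} {V : ℝ → L2} {U : ℝ → Op} (hT : T' ≤ T)
    (h : IsPropagator T V U) : IsPropagator T' V U := fun φ => (h φ).mono hT

theorem IsPropagator.zero {T : ℝ} {V : ℝ → L2} {U : ℝ → Op} (hT : 0 ≤ T)
    (h : IsPropagator T V U) : U 0 = 1 := by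
  ext1 φ
  rw [(h φ).initial hT, one_apply_eq_self]

theorem IsPropagator.congr_potential {T : ℝ} {V W : ℝ → L2} {U : ℝ → Op} (hT : 0 ≤ T)
    (h : IsPropagator T V U) (hVW : ∀ᵐ t ∂(volume.restrict (Set.Ioc 0 T)), V t = W t) :
    IsPropagator T W U := by
  intro φ
  have h1 := (((h φ).isProfile hT).congr_potential hVW).isLinearSolution
  simp only [free_free_neg, neg_zero, free_zero] at h1
  rwa [(h φ).initial hT] at h1

theorem IsPropagator.congr {T : ℝ} {V : ℝ → L2} {U U' : ℝ → Op} (hT : 0 ≤ T)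
    (h : IsPropagator T V U) (hU : ∀ t ∈ Set.Icc 0 T, U' t = U t) : IsPropagator T V U' := by
  intro φ
  have h1 := (((h φ).isProfile hT).congr (w := fun t => free (-t) (U' t φ)) hT
    (fun t ht => by rw [hU t ht])).isLinearSolution
  simp only [free_free_neg, neg_zero, free_zero] at h1
  rwa [hU 0 ⟨le_rfl, hT⟩, (h φ).initial hT] at h1

theorem IsPropagator.unique {T : ℝ} {V : ℝ → L2} {U U' : ℝ → Op} (hT : 0 ≤ T)
    (hV : MemLp V 2 (volume.restrict (Set.Ioc 0 T))) (h : IsPropagator T V U)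
    (h' : IsPropagator T V U') : ∀ t ∈ Set.Icc 0 T, U t = U' t := by
  intro t ht
  ext1 φ
  have h1 := ((h φ).isProfile hT).unique hV ((h' φ).isProfile hT)
    (by simp only [neg_zero, free_zero]; rw [(h φ).initial hT, (h' φ).initial hT]) t ht
  exact (free (-t)).injective h1

theorem IsPropagator.norm_eq {T : ℝ} {V : ℝ → L2} {U : ℝ → Op}
    (hV : MemLp V 2 (volume.restrict (Set.Ioc 0 T)))
    (hreal : ∀ᵐ t ∂(volume.restrict (Set.Ioc 0 T)), IsRealValued (V t))
    (h : IsPropagator T V U) {t : ℝ} (ht : t ∈ Set.Icc 0 T) (φ : L2) : ‖U t φ‖ = ‖φ‖ := by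
  have hT := ht.1.trans ht.2
  have h1 := ((h φ).isProfile hT).norm_eq hV hreal t ht
  simpa [(h φ).initial hT] using h1

/-- Uniqueness makes the solution linear in its initial value; conservation of the norm, where
reality of V enters, makes it bounded. -/
theorem exists_isPropagator {T : ℝ} {V : ℝ → L2} (hT : 0 ≤ T)
    (hV : MemLp V 2 (volume.restrict (Set.Ioc 0 T)))
    (hreal : ∀ᵐ t ∂(volume.restrict (Set.Ioc 0 T)), IsRealValued (V t)) :
    ∃ U : ℝ → Op, IsPropagator T V U := by
  choose v hv hv0 using exists_isProfile hT hV
  have h0 : (0 : ℝ) ∈ Set.Icc 0 T := ⟨le_rfl, hT⟩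
  have hlin : ∀ t ∈ Set.Icc 0 T, ∀ (c : ℂ) (φ ψ : L2), v (c • φ + ψ) t = c • v φ t + v ψ t :=
    fun t ht c φ ψ => (hv (c • φ + ψ)).unique hV ((hv φ).smul_add hV c (hv ψ))
      (by rw [hv0, hv0, hv0]) t ht
  have hzero : ∀ t ∈ Set.Icc 0 T, v 0 t = 0 := fun t ht =>
    (hv 0).unique hV (isProfile_zero 0 T V) (hv0 0) t ht
  have hU : ∀ t : ℝ, ∃ A : Op, t ∈ Set.Icc 0 T → ∀ φ, A φ = free t (v φ t) := by
    intro t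
    by_cases ht : t ∈ Set.Icc 0 T
    · refine ⟨LinearMap.mkContinuous (IsLinearMap.mk' (fun φ => free t (v φ t))
        ⟨fun φ ψ => ?_, fun c φ => ?_⟩) 1 fun φ => ?_, fun _ φ => rfl⟩
      · have := hlin t ht 1 φ ψ
        rw [one_smul, one_smul] at this
        rw [this, map_add]
      · have := hlin t ht c φ 0
        rw [add_zero, hzero t ht, add_zero] at this
        rw [this, map_smul]
      · change ‖free t (v φ t)‖ ≤ 1 * ‖φ‖
        rw [LinearIsometry.norm_map, one_mul, (hv φ).norm_eq hV hreal t ht, hv0]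
    · exact ⟨0, fun h => absurd h ht⟩
  choose U hU using hU
  refine ⟨U, fun φ => ?_⟩
  have h1 := ((hv φ).congr (w := fun t => free (-t) (U t φ)) hT
    (fun t ht => by rw [hU t ht, free_neg_free])).isLinearSolution
  simp only [free_free_neg, neg_zero, free_zero] at h1
  rwa [hU 0 h0 φ, free_zero, hv0] at h1

theorem IsPropagator.n4_le {T : ℝ} {V : ℝ → L2} {U : ℝ → Op}
    (hV : MemLp V 2 (volume.restrict (Set.Ioc 0 T)))
    (hreal : ∀ᵐ t ∂(volume.restrict (Set.Ioc 0 T)), IsRealValued (V t))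
    (h : IsPropagator T V U) {a b : ℝ} (ha : 0 ≤ a) (hab : a ≤ b) (hb : b ≤ T) (h1 : b - a ≤ 1)
    (hK : retC (b - a) * n2 a b V ≤ 1 / 2) (φ : L2) :
    n4 a b (fun t => U t φ) ≤ 2 * strC (b - a) * ‖φ‖ₑ := by
  have hT := (ha.trans hab).trans hb
  have h2 := (((h φ).isProfile hT).mono hV ha hb).n4_le hab h1 (memLp_sub_interval hV ha hb) hK
  simp only [free_free_neg] at h2
  refine h2.trans (le_of_eq ?_)
  rw [← ofReal_norm, LinearIsometry.norm_map, h.norm_eq hV hreal ⟨ha, hab.trans hb⟩, ofReal_norm]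

theorem strC_le_two {h : ℝ} (h0 : 0 ≤ h) (h1 : h ≤ 1) : strC h ≤ 2 := by
  refine (strC_mono h0 h1).trans ?_
  simp [strC]

/-- Dependence of the propagator on the potential. -/
theorem IsPropagator.sub_le {T : ℝ} {V V' : ℝ → L2} {U U' : ℝ → Op}
    (hV : MemLp V 2 (volume.restrict (Set.Ioc 0 T)))
    (hV' : MemLp V' 2 (volume.restrict (Set.Ioc 0 T)))
    (hreal' : ∀ᵐ t ∂(volume.restrict (Set.Ioc 0 T)), IsRealValued (V' t))
    (h : IsPropagator T V U) (h' : IsPropagator T V' U')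
    {a b : ℝ} (ha : 0 ≤ a) (hab : a ≤ b) (hb : b ≤ T) (h1 : b - a ≤ 1)
    (hK : retC (b - a) * n2 a b V ≤ 1 / 2) (hK' : retC (b - a) * n2 a b V' ≤ 1 / 2)
    (hUa : U a = U' a) (φ : L2) :
    n4 a b (fun t => U t φ - U' t φ) ≤
      4 * retC (b - a) * strC (b - a) * n2 a b (fun t => V t - V' t) * ‖φ‖ₑ ∧
    ∀ t ∈ Set.Icc a b, ‖U t φ - U' t φ‖ₑ ≤ 16 * n2 a b (fun t => V t - V' t) * ‖φ‖ₑ := by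
  have hT := (ha.trans hab).trans hb
  obtain ⟨h2, h3⟩ := (((h φ).isProfile hT).mono hV ha hb).sub_le hab h1
    (memLp_sub_interval hV ha hb) (memLp_sub_interval hV' ha hb)
    (((h' φ).isProfile hT).mono hV' ha hb) hK
  have h4 := h'.n4_le hV' hreal' ha hab hb h1 hK' φ
  simp only [← map_sub, free_free_neg, hUa, sub_self, enorm_zero, mul_zero, zero_add]
    at h2 h3
  set D := n2 a b (fun t => V t - V' t) with hD
  set S := strC (b - a) with hS
  set K := retC (b - a) with hKd
  have h5 : n4 a b (fun t => U t φ - U' t φ) ≤ 4 * K * S * D * ‖φ‖ₑ := by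
    refine h2.trans ?_
    calc 2 * (K * D * n4 a b (fun t => U' t φ)) ≤ 2 * (K * D * (2 * S * ‖φ‖ₑ)) := by gcongr
      _ = _ := by ring
  refine ⟨h5, fun t ht => ?_⟩
  have h6 := h3 t ht
  rw [← ofReal_norm, LinearIsometry.norm_map, ofReal_norm] at h6
  have hS2 : S ≤ 2 := strC_le_two (by linarith) h1
  refine h6.trans ?_
  -- With K·`n2 a b V` ≤ 1/2 and S ≤ 2 each of the two terms is at most 8·D·‖φ‖.
  calc S * n2 a b V * n4 a b (fun t => U t φ - U' t φ) + S * D * n4 a b (fun t => U' t φ)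
      ≤ S * n2 a b V * (4 * K * S * D * ‖φ‖ₑ) + S * D * (2 * S * ‖φ‖ₑ) := by gcongr
    _ = (K * n2 a b V) * (4 * (S * S) * D * ‖φ‖ₑ) + 2 * (S * S) * D * ‖φ‖ₑ := by ring
    _ ≤ (1 / 2) * (4 * (2 * 2) * D * ‖φ‖ₑ) + 2 * (2 * 2) * D * ‖φ‖ₑ := by gcongr
    _ = ((1 / 2) * 16 + 8) * D * ‖φ‖ₑ := by ring
    _ = 16 * D * ‖φ‖ₑ := by
        congr 2
        have : (1 / 2 : ℝ≥0∞) * 16 = 8 := by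
          rw [one_div, show (16 : ℝ≥0∞) = 2 * 8 by norm_num, ← mul_assoc,
            ENNReal.inv_mul_cancel (by norm_num) (by norm_num), one_mul]
        rw [this]; norm_num

/-! ### The trace norm -/

section
variable {H : Type*} [NormedAddCommGroup H] [InnerProductSpace ℂ H] [CompleteSpace H]

theorem absPow_one (A : H →L[ℂ] H) : absPow A 1 = CFC.abs A := CFC.rpow_one _ (CFC.abs_nonneg A)

theorem absPow_one_nonneg (A : H →L[ℂ] H) : 0 ≤ absPow A 1 := absPow_one A ▸ CFC.abs_nonneg A

theorem absPow_one_mul_self (A : H →L[ℂ] H) : absPow A 1 * absPow A 1 = star A * A := by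
  rw [absPow_one, CFC.abs_mul_abs]

theorem exists_mul_self_eq_absPow_one (A : H →L[ℂ] H) :
    ∃ B : H →L[ℂ] H, IsSelfAdjoint B ∧ B * B = absPow A 1 :=
  ⟨CFC.sqrt (absPow A 1), (CFC.sqrt_nonneg _).isSelfAdjoint,
    CFC.sqrt_mul_sqrt_self _ (absPow_one_nonneg A)⟩

/-- Smooth approximation of the polar decomposition of a self-adjoint operator. -/
theorem exists_approx_abs (A : H →L[ℂ] H) (hA : IsSelfAdjoint A) (ε : ℝ) (hε : 0 < ε) :
    ∃ S : H →L[ℂ] H, IsSelfAdjoint S ∧ ‖S‖ ≤ 1 ∧ ‖absPow A 1 - S * A‖ ≤ ε := by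
  have hc : Continuous fun x : ℝ => x / (|x| + ε) :=
    continuous_id.div (by fun_prop) (fun x => by positivity)
  refine ⟨cfc (fun x : ℝ => x / (|x| + ε)) A, IsSelfAdjoint.cfc, ?_, ?_⟩
  · refine norm_cfc_le zero_le_one fun x _ => ?_
    rw [norm_div, Real.norm_eq_abs, Real.norm_of_nonneg (by positivity),
      div_le_one (by positivity)]
    linarith
  · have h1 : cfc (fun x : ℝ => x / (|x| + ε)) A * A =
        cfc (fun x : ℝ => x / (|x| + ε) * x) A := by
      rw [cfc_mul (fun x : ℝ => x / (|x| + ε)) (fun x => x) A hc.continuousOn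
        continuous_id.continuousOn, cfc_id' ℝ A]
    rw [h1, absPow_one, CFC.abs_eq_cfc_norm A hA, ← cfc_sub (fun x : ℝ => ‖x‖)
      (fun x : ℝ => x / (|x| + ε) * x) A continuous_norm.continuousOn
      (hc.mul continuous_id').continuousOn]
    refine norm_cfc_le hε.le fun x _ => ?_
    have h2 : ‖x‖ - x / (|x| + ε) * x = |x| * ε / (|x| + ε) := by
      rw [Real.norm_eq_abs]
      have : |x| + ε ≠ 0 := by positivity
      field_simp
      nlinarith [abs_mul_abs_self x]
    rw [h2, Real.norm_of_nonneg (by positivity), div_le_iff₀ (by positivity)]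
    nlinarith [abs_nonneg x]

/-- The functional calculus of a projection sees only the points 0 and 1, where (cx)^p = c^p x; at 0
this requires p > 0. -/
theorem absPow_smul_projection {P : H →L[ℂ] H} (hP : IsSelfAdjoint P) (hPP : P * P = P) {c p : ℝ}
    (hc : 0 ≤ c) (hp : 0 < p) : absPow ((c : ℂ) • P) p = ((c ^ p : ℝ) : ℂ) • P := by
  have hs : IsStarProjection P := ⟨hPP, hP⟩
  have h0 : 0 ≤ P := hs.nonneg
  have h1 : CFC.abs ((c : ℂ) • P) = c • P := by
    have h2 : (c : ℂ) • P = c • P := by ext; simp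
    rw [h2, CFC.abs_of_nonneg (c • P) (smul_nonneg hc h0)]
  have hsp : ∀ x ∈ spectrum ℝ P, x = 0 ∨ x = 1 := fun x hx =>
    IsIdempotentElem.spectrum_subset ℝ hPP hx
  have hfin : (spectrum ℝ P).Finite := IsIdempotentElem.finite_spectrum ℝ hPP
  have h3 : c • P = cfc (fun x : ℝ => c * x) P := by
    rw [cfc_const_mul c (fun x : ℝ => x) P, cfc_id' ℝ P]
  have h4 : ((c ^ p : ℝ) : ℂ) • P = cfc (fun x : ℝ => c ^ p * x) P := by
    rw [cfc_const_mul (c ^ p) (fun x : ℝ => x) P, cfc_id' ℝ P]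
    ext; simp
  unfold absPow
  rw [h1, CFC.rpow_eq_cfc_real (smul_nonneg hc h0), h4, h3,
    ← cfc_comp' (fun x : ℝ => x ^ p) (fun x : ℝ => c * x) P
      ((hfin.image _).continuousOn _) (by fun_prop)]
  refine cfc_congr fun x hx => ?_
  rcases hsp x hx with rfl | rfl
  · simp [hp.ne']
  · simp
end
theorem schattenNorm_one (A : Op) : schattenNorm 1 A = posTrace (absPow A 1) := by
  simp [schattenNorm]

theorem tsum_enorm_coef_sq (f : L2) : ∑' n : ℤ, ‖inner ℂ (e n) f‖ₑ ^ 2 = ‖f‖ₑ ^ 2 := by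
  have := hasSum_norm_coef_sq f
  have h4 := ENNReal.ofReal_tsum_of_nonneg (fun n => by positivity) this.summable
  rw [this.tsum_eq] at h4
  simpa only [ENNReal.ofReal_pow (norm_nonneg _), ofReal_norm] using h4.symm

theorem tsum_enorm_coef_mul_le (f g : L2) :
    ∑' n : ℤ, ‖inner ℂ (e n) f‖ₑ * ‖inner ℂ (e n) g‖ₑ ≤ ‖f‖ₑ * ‖g‖ₑ := by
  rw [ENNReal.tsum_eq_iSup_sum]
  refine iSup_le fun F => ?_
  have h := ENNReal.inner_le_Lp_mul_Lq F (fun n : ℤ => ‖inner ℂ (e n) f‖ₑ)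
    (fun n : ℤ => ‖inner ℂ (e n) g‖ₑ) (p := 2) (q := 2) (by norm_num [Real.holderConjugate_iff])
  simp only [ENNReal.rpow_ofNat] at h
  refine h.trans ?_
  have key : ∀ f : L2, (∑ n ∈ F, ‖inner ℂ (e n) f‖ₑ ^ 2) ^ (1 / 2 : ℝ) ≤ ‖f‖ₑ := by
    intro f
    calc _ ≤ (‖f‖ₑ ^ 2) ^ (1 / 2 : ℝ) := by
          gcongr
          exact (ENNReal.sum_le_tsum F).trans (tsum_enorm_coef_sq f).le
      _ = ‖f‖ₑ := by
          rw [← ENNReal.rpow_natCast, ← ENNReal.rpow_mul]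
          norm_num
  exact mul_le_mul' (key f) (key g)

/-- Up to ε in operator norm, |A| is H A with a self-adjoint contraction H. The diagonal entries of
H A expand along the rank-one sum, and Cauchy–Schwarz over n bounds the k-th part by ‖H fₖ‖‖gₖ‖.
Finitely many n are treated at a time, so the total error is a multiple of ε and disappears in the
limit. -/
theorem posTrace_abs_le {ι : Type*} {A : Op} (hA : IsSelfAdjoint A) {f g : ι → L2}
    (h : ∀ x y, HasSum (fun k => inner ℂ x (f k) * inner ℂ (g k) y) (inner ℂ x (A y))) :
    posTrace (absPow A 1) ≤ ∑' k, ‖f k‖ₑ * ‖g k‖ₑ := by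
  set M := ∑' k, ‖f k‖ₑ * ‖g k‖ₑ with hM
  unfold posTrace
  rw [ENNReal.tsum_eq_iSup_sum]
  refine iSup_le fun F => ?_
  have key : ∀ ε : ℝ, 0 < ε → ∑ n ∈ F, ENNReal.ofReal (RCLike.re (inner ℂ (e n) (absPow A 1 (e n))))
      ≤ M + F.card * ENNReal.ofReal ε := by
    intro ε hε
    obtain ⟨H, hH, hH1, hHA⟩ := exists_approx_abs A hA ε hε
    have h1 : ∀ n, ENNReal.ofReal (RCLike.re (inner ℂ (e n) (absPow A 1 (e n)))) ≤
        (∑' k, ‖inner ℂ (e n) (H (f k))‖ₑ * ‖inner ℂ (e n) (g k)‖ₑ) + ENNReal.ofReal ε := by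
      intro n
      have e1 : absPow A 1 (e n) = H (A (e n)) + (absPow A 1 - H * A) (e n) := by
        simp
      have e2 : ‖inner ℂ (e n) ((absPow A 1 - H * A) (e n))‖ ≤ ε := by
        refine (norm_inner_le_norm _ _).trans ?_
        have h2 := (absPow A 1 - H * A).le_opNorm (e n)
        have h3 := orthonormal_e.1 n
        rw [h3, one_mul]
        rw [h3, mul_one] at h2
        exact h2.trans hHA
      have e3 : ‖inner ℂ (e n) (H (A (e n)))‖ₑ ≤
          ∑' k, ‖inner ℂ (e n) (H (f k))‖ₑ * ‖inner ℂ (e n) (g k)‖ₑ := by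
        have hs : ∀ x y : L2, inner ℂ x (H y) = inner ℂ (H x) y := fun x y =>
          (hH.isSymmetric x y).symm
        rw [hs]
        have h2 := h (H (e n)) (e n)
        rw [← h2.tsum_eq]
        by_cases hfin : ∑' k, ‖inner ℂ (e n) (H (f k))‖ₑ * ‖inner ℂ (e n) (g k)‖ₑ = ⊤
        · rw [hfin]; exact le_top
        · refine enorm_tsum_le_tsum_enorm.trans (le_of_eq ?_)
          refine tsum_congr fun k => ?_
          rw [enorm_mul, hs, ← ofReal_norm (inner ℂ (g k) (e n)), norm_inner_symm, ofReal_norm]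
      calc ENNReal.ofReal (RCLike.re (inner ℂ (e n) (absPow A 1 (e n))))
          ≤ ‖inner ℂ (e n) (absPow A 1 (e n))‖ₑ := by
            rw [← ofReal_norm]; exact ENNReal.ofReal_le_ofReal (RCLike.re_le_norm _)
        _ ≤ ‖inner ℂ (e n) (H (A (e n)))‖ₑ + ‖inner ℂ (e n) ((absPow A 1 - H * A) (e n))‖ₑ := by
            rw [e1, inner_add_right]; exact enorm_add_le _ _
        _ ≤ _ := by
            refine add_le_add e3 ?_
            rw [← ofReal_norm]; exact ENNReal.ofReal_le_ofReal e2
    calc _ ≤ ∑ n ∈ F, ((∑' k, ‖inner ℂ (e n) (H (f k))‖ₑ * ‖inner ℂ (e n) (g k)‖ₑ) +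
            ENNReal.ofReal ε) := Finset.sum_le_sum fun n _ => h1 n
      _ = (∑' k, ∑ n ∈ F, ‖inner ℂ (e n) (H (f k))‖ₑ * ‖inner ℂ (e n) (g k)‖ₑ) +
            F.card * ENNReal.ofReal ε := by
          rw [Finset.sum_add_distrib, Finset.sum_const, nsmul_eq_mul,
            Summable.tsum_finsetSum fun _ _ => ENNReal.summable]
      _ ≤ _ := by
          refine add_le_add (ENNReal.tsum_le_tsum fun k => ?_) le_rfl
          refine (ENNReal.sum_le_tsum F).trans ((tsum_enorm_coef_mul_le _ _).trans ?_)
          gcongr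
          rw [← ofReal_norm, ← ofReal_norm]
          apply ENNReal.ofReal_le_ofReal
          calc ‖H (f k)‖ ≤ ‖H‖ * ‖f k‖ := H.le_opNorm _
            _ ≤ 1 * ‖f k‖ := by gcongr
            _ = _ := one_mul _
  have hlim : Tendsto (fun ε : ℝ => M + F.card * ENNReal.ofReal ε) (𝓝[>] 0) (𝓝 (M + F.card * 0)) := by
    refine tendsto_const_nhds.add (ENNReal.Tendsto.const_mul ?_ (Or.inr (by simp)))
    have := (ENNReal.continuous_ofReal.tendsto (0 : ℝ))
    rw [ENNReal.ofReal_zero] at this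
    exact this.mono_left nhdsWithin_le_nhds
  rw [mul_zero, add_zero] at hlim
  exact ge_of_tendsto hlim (eventually_nhdsWithin_of_forall fun ε hε => key ε hε)

/-! ### Spectral decomposition of self-adjoint trace-class operators -/

theorem isCompactOperator_ketBra (φ ψ : L2) : IsCompactOperator (ketBra φ ψ) := by
  have h : IsCompactOperator (innerSL ℂ ψ : L2 →L[ℂ] ℂ) :=
    ⟨Metric.closedBall 0 1, isCompact_closedBall _ _,
      (innerSL ℂ ψ).continuous.continuousAt.preimage_mem_nhds (by
        rw [map_zero]; exact Metric.closedBall_mem_nhds _ one_pos)⟩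
  exact h.clm_comp (ContinuousLinearMap.toSpanSingleton ℂ φ)

theorem norm_apply_eq_norm_abs_apply (A : Op) (x : L2) : ‖A x‖ = ‖absPow A 1 x‖ := by
  have hs : IsSelfAdjoint (absPow A 1) := (absPow_one_nonneg A).isSelfAdjoint
  have h1 : inner ℂ (A x) (A x) = inner ℂ (absPow A 1 x) (absPow A 1 x) := by
    have h2 : inner ℂ x (absPow A 1 (absPow A 1 x)) = inner ℂ x (star A (A x)) :=
      congrArg (fun B : Op => inner ℂ x (B x)) (absPow_one_mul_self A)
    rw [ContinuousLinearMap.star_eq_adjoint, ContinuousLinearMap.adjoint_inner_right] at h2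
    rw [← h2]
    symm
    exact hs.isSymmetric x (absPow A 1 x)
  rw [inner_self_eq_norm_sq_to_K, inner_self_eq_norm_sq_to_K] at h1
  have h3 : ‖A x‖ ^ 2 = ‖absPow A 1 x‖ ^ 2 := by exact_mod_cast h1
  exact (sq_eq_sq₀ (norm_nonneg _) (norm_nonneg _)).mp h3

/-- With B the square root of |A|, the trace is ∑ ‖B e_n‖², so B is Hilbert–Schmidt. Since ‖A y‖ =
‖B B y‖ ≤ ‖B‖‖B y‖, cutting A off to finitely many basis vectors converges in norm, and the cutoffs
have finite rank. -/
theorem isCompactOperator_of_posTrace (A : Op) (h : posTrace (absPow A 1) < ⊤) :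
    IsCompactOperator A := by
  obtain ⟨B, hBs, hBB⟩ := exists_mul_self_eq_absPow_one A
  have hBn : ∀ x, (RCLike.re (inner ℂ x (absPow A 1 x))) = ‖B x‖ ^ 2 := by
    intro x
    rw [← hBB, show inner ℂ x ((B * B) x) = inner ℂ (B x) (B x) from
      (hBs.isSymmetric x (B x)).symm]
    exact inner_self_eq_norm_sq (𝕜 := ℂ) (B x)
  have hsum : Summable fun n : ℤ => ‖B (e n)‖ ^ 2 := by
    unfold posTrace at h
    simp only [hBn] at h
    have := ENNReal.summable_toReal h.ne
    refine this.congr fun n => ?_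
    rw [ENNReal.toReal_ofReal (by positivity)]
  have hlim : Tendsto (fun F : Finset ℤ => ∑ n ∈ F, ketBra (A (e n)) (e n)) atTop (𝓝 A) := by
    rw [tendsto_iff_norm_sub_tendsto_zero]
    have h1 : Tendsto (fun F : Finset ℤ => ‖B‖ * √((∑' n : ℤ, ‖B (e n)‖ ^ 2) -
        ∑ n ∈ F, ‖B (e n)‖ ^ 2)) atTop (𝓝 0) := by
      have h2 := (tendsto_const_nhds (x := ∑' n : ℤ, ‖B (e n)‖ ^ 2)).sub hsum.hasSum
      rw [sub_self] at h2
      simpa using h2.sqrt.const_mul ‖B‖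
    refine squeeze_zero (fun _ => norm_nonneg _) (fun F => ?_) h1
    refine ContinuousLinearMap.opNorm_le_bound _ (by positivity) fun x => ?_
    set y : L2 := x - ∑ n ∈ F, inner ℂ (e n) x • e n with hy
    have e1 : ((∑ n ∈ F, ketBra (A (e n)) (e n)) - A) x = - A y := by
      rw [hy, map_sub, sub_apply, sum_apply, map_sum]
      simp [ketBra]
    have hyc : HasSum (fun n => (if n ∈ F then 0 else inner ℂ (e n) x) • e n) y := by
      have h2 := hasSum_coef_smul x
      have h3 : HasSum (fun n => (if n ∈ F then inner ℂ (e n) x else 0) • e n)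
          (∑ n ∈ F, inner ℂ (e n) x • e n) := by
        have h4 : HasSum (fun n => (if n ∈ F then inner ℂ (e n) x else 0) • e n)
            (∑ n ∈ F, (if n ∈ F then inner ℂ (e n) x else 0) • e n) :=
          hasSum_sum_of_ne_finset_zero (fun n hn => by simp [hn])
        rwa [Finset.sum_congr rfl (fun n hn => by rw [if_pos hn])] at h4
      refine (h2.sub h3).congr_fun fun n => ?_
      split_ifs <;> simp
    have e2 : ‖B y‖ ≤ √((∑' n : ℤ, ‖B (e n)‖ ^ 2) - ∑ n ∈ F, ‖B (e n)‖ ^ 2) * ‖x‖ := by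
      have h5 : HasSum (fun n => (if n ∈ F then 0 else inner ℂ (e n) x) • B (e n)) (B y) := by
        have := hyc.mapL B
        simpa only [map_smul] using this
      refine le_of_tendsto h5.norm (Eventually.of_forall fun G => ?_)
      calc ‖∑ n ∈ G, (if n ∈ F then 0 else inner ℂ (e n) x) • B (e n)‖
          ≤ ∑ n ∈ G, ‖(if n ∈ F then 0 else inner ℂ (e n) x) • B (e n)‖ := norm_sum_le _ _
        _ ≤ ∑ n ∈ G, (if n ∈ F then 0 else ‖B (e n)‖) * ‖inner ℂ (e n) x‖ := by
            refine Finset.sum_le_sum fun n _ => ?_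
            rw [norm_smul]
            split_ifs
            · simp
            · rw [mul_comm]
        _ ≤ √(∑ n ∈ G, (if n ∈ F then 0 else ‖B (e n)‖) ^ 2) * √(∑ n ∈ G, ‖inner ℂ (e n) x‖ ^ 2) :=
            Real.sum_mul_le_sqrt_mul_sqrt _ _ _
        _ ≤ _ := by
            gcongr
            · have h6 := Summable.sum_le_tsum (F ∪ G) (fun _ _ => by positivity) hsum
              have h7 : ∑ n ∈ G, (if n ∈ F then 0 else ‖B (e n)‖) ^ 2 + ∑ n ∈ F, ‖B (e n)‖ ^ 2 ≤
                  ∑ n ∈ F ∪ G, ‖B (e n)‖ ^ 2 := by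
                rw [Finset.union_comm, ← Finset.sdiff_union_self_eq_union,
                  Finset.sum_union Finset.sdiff_disjoint]
                gcongr
                rw [← Finset.sum_filter_add_sum_filter_not G (fun n => n ∈ F),
                  Finset.sum_eq_zero (s := G.filter fun n => n ∈ F), zero_add,
                  Finset.sdiff_eq_filter]
                · exact Finset.sum_le_sum fun n hn => by
                    rw [if_neg (Finset.mem_filter.mp hn).2]
                · intro n hn
                  rw [if_pos (Finset.mem_filter.mp hn).2]; simp
              linarith
            · rw [Real.sqrt_le_left (norm_nonneg _)]
              exact sum_le_hasSum G (fun _ _ => by positivity) (hasSum_norm_coef_sq x)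
    rw [e1, norm_neg, norm_apply_eq_norm_abs_apply, ← hBB, mul_assoc]
    exact (B.le_opNorm _).trans (mul_le_mul_of_nonneg_left e2 (norm_nonneg _))
  refine isCompactOperator_of_tendsto hlim (Eventually.of_forall fun F => ?_)
  induction F using Finset.induction_on with
  | empty => simpa using isCompactOperator_zero
  | insert n F hn ih =>
    rw [Finset.sum_insert hn]
    exact (isCompactOperator_ketBra _ _).add ih

theorem infinite_of_hilbertBasis {ι : Type*} (b : HilbertBasis ι ℂ L2) : Infinite ι := by
  by_contra h
  rw [not_infinite_iff_finite] at h
  have := Fintype.ofFinite ι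
  have : FiniteDimensional ℂ L2 := b.toOrthonormalBasis.toBasis.finiteDimensional_of_finite
  have := orthonormal_e.linearIndependent.finite_of_isNoetherian
  exact not_finite ℤ

/-- Every basis vector has a nonzero coefficient on some `e n`, and for fixed n Parseval's sum has
countable support. This allows eigenbases to be indexed by ℕ. -/
theorem countable_of_hilbertBasis {ι : Type*} (b : HilbertBasis ι ℂ L2) : Countable ι := by
  rw [← Set.countable_univ_iff]
  have h : (Set.univ : Set ι) ⊆ ⋃ n : ℤ, {i | inner ℂ (e n) (b i) * inner ℂ (b i) (e n) ≠ 0} := by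
    intro i _
    by_contra hi
    simp only [Set.mem_iUnion, Set.mem_ofPred_eq, not_exists, not_not] at hi
    have h0 : b i = 0 := ext_coef fun n => by
      rw [inner_zero_right]
      rcases mul_eq_zero.mp (hi n) with h | h
      · exact h
      · exact inner_eq_zero_symm.mp h
    have := b.orthonormal.1 i
    rw [h0, norm_zero] at this
    exact zero_ne_one this
  exact (Set.countable_iUnion fun n =>
    (b.hasSum_inner_mul_inner (e n) (e n)).summable.countable_support).mono h

/-- A compact self-adjoint operator has an orthonormal basis of eigenvectors. -/
theorem exists_eigenbasis_of_isCompactOperator {H : Type*} [NormedAddCommGroup H]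
    [InnerProductSpace ℂ H] [CompleteSpace H] {A : H →L[ℂ] H} (hA : IsSelfAdjoint A)
    (hc : IsCompactOperator A) :
    ∃ (w : ℂ → Set H) (b : HilbertBasis (Σ μ, w μ) ℂ H) (l : (Σ μ, w μ) → ℝ),
      ∀ k, A (b k) = (l k : ℂ) • b k := by
  have hs : A.IsSymmetric := hA.isSymmetric
  let E : ℂ → Submodule ℂ H := fun μ => Module.End.eigenspace (A : Module.End ℂ H) μ
  have hcl : ∀ μ, IsClosed (E μ : Set H) := by
    intro μ
    have : (E μ : Set H) = {x | A x = μ • x} := by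
      ext x
      exact Module.End.mem_eigenspace_iff
    rw [this]
    exact isClosed_eq A.continuous (by fun_prop)
  have hcomp : ∀ μ, CompleteSpace (E μ) := fun μ => (hcl μ).completeSpace_coe
  choose w' b hb using fun μ => exists_hilbertBasis ℂ (E μ)
  let w : ℂ → Set H := fun μ => (Subtype.val : E μ → H) '' w' μ
  let q : ∀ μ, w μ ≃ w' μ := fun μ => (Equiv.Set.image _ (w' μ) Subtype.val_injective).symm
  let v : (Σ μ, w μ) → H := fun i => ((b i.1 (q i.1 i.2) : E i.1) : H)
  have hv : Orthonormal ℂ v :=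
    (LinearMap.IsSymmetric.orthogonalFamily_eigenspaces hs).orthonormal_sigma_orthonormal
      (fun μ => (b μ).orthonormal.comp _ (q μ).injective)
  -- For a compact self-adjoint operator only 0 is orthogonal to all eigenspaces, so it suffices to
  -- pass from the chosen basis of each eigenspace to the whole eigenspace.
  have hbot : (Submodule.span ℂ (Set.range v))ᗮ = ⊥ := by
    rw [eq_bot_iff, ← ContinuousLinearMap.orthogonalComplement_iSup_eigenspaces_eq_bot hc hs]
    intro x hx
    rw [Submodule.mem_orthogonal] at hx ⊢
    intro y hy
    have key : ∀ μ, E μ ≤ (Submodule.span ℂ {x})ᗮ := by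
      intro μ z hz
      rw [Submodule.mem_orthogonal_singleton_iff_inner_left]
      have h1 := (b μ).hasSum_repr ⟨z, hz⟩
      have h2 := (h1.mapL (E μ).subtypeL).mapL (innerSL ℂ x)
      have h3 : ∀ i, innerSL ℂ x ((E μ).subtypeL ((b μ).repr ⟨z, hz⟩ i • b μ i)) = 0 := by
        intro i
        have h4 : inner ℂ ((b μ i : E μ) : H) x = 0 :=
          hx _ (Submodule.subset_span ⟨⟨μ, (q μ).symm i⟩, by simp only [v, Equiv.apply_symm_apply]⟩)
        simp [inner_eq_zero_symm.mp h4]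
      simp only [h3] at h2
      exact inner_eq_zero_symm.mp (h2.unique hasSum_zero)
    have h5 := iSup_le key hy
    rw [Submodule.mem_orthogonal_singleton_iff_inner_left] at h5
    exact h5
  have hev : ∀ i : Σ μ, w μ, A (v i) = i.1 • v i := fun i =>
    Module.End.mem_eigenspace_iff.mp (b i.1 (q i.1 i.2) : E i.1).2
  have hre : ∀ i : Σ μ, w μ, ((RCLike.re i.1 : ℝ) : ℂ) = i.1 := by
    intro i
    refine RCLike.conj_eq_iff_re.mp (hs.conj_eigenvalue_eq_self
      (Module.End.hasEigenvalue_of_hasEigenvector (x := v i)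
        ⟨(b i.1 (q i.1 i.2) : E i.1).2, ?_⟩))
    exact hv.ne_zero i
  refine ⟨w, HilbertBasis.mkOfOrthogonalEqBot hv hbot, fun k => RCLike.re k.1, fun k => ?_⟩
  rw [HilbertBasis.coe_mkOfOrthogonalEqBot, hre]
  exact hev _

theorem exists_eigenbasis {A : Op} (hA : IsSelfAdjoint A) (hc : IsCompactOperator A) :
    ∃ (b : HilbertBasis ℕ ℂ L2) (l : ℕ → ℝ), ∀ k, A (b k) = (l k : ℂ) • b k := by
  obtain ⟨w, B, l, hB⟩ := exists_eigenbasis_of_isCompactOperator hA hc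
  have := infinite_of_hilbertBasis B
  have := countable_of_hilbertBasis B
  obtain ⟨_⟩ := nonempty_denumerable (Σ μ, w μ)
  let q : ℕ ≃ (Σ μ, w μ) := (Denumerable.eqv _).symm
  have hsp : ⊤ ≤ (Submodule.span ℂ (Set.range (B ∘ q))).topologicalClosure := by
    rw [q.surjective.range_comp, B.dense_span]
  refine ⟨HilbertBasis.mk (B.orthonormal.comp _ q.injective) hsp, l ∘ q, fun k => ?_⟩
  rw [HilbertBasis.coe_mk]
  exact hB (q k)

/-- From |A|²x = l²x the vector y = |A|x − |l|x satisfies |A|y = −|l|y, and positivity of |A| gives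
|l|‖y‖² ≤ 0. For l = 0 this says nothing, and ‖A x‖ = ‖|A|x‖ is used instead. -/
theorem absPow_one_eigenvector {A : Op} {x : L2} {l : ℝ} (hA : IsSelfAdjoint A)
    (hx : A x = (l : ℂ) • x) : absPow A 1 x = ((|l| : ℝ) : ℂ) • x := by
  have hs := (absPow_one_nonneg A).isSelfAdjoint
  set y := absPow A 1 x - ((|l| : ℝ) : ℂ) • x with hy
  have h1 : absPow A 1 (absPow A 1 x) = ((|l| : ℝ) : ℂ) • ((|l| : ℝ) : ℂ) • x := by
    have h2 : absPow A 1 (absPow A 1 x) = star A (A x) :=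
      congrArg (fun B : Op => B x) (absPow_one_mul_self A)
    rw [h2, hA.star_eq, hx, map_smul, hx, smul_smul, smul_smul, ← Complex.ofReal_mul,
      ← Complex.ofReal_mul, abs_mul_abs_self]
  have h2 : absPow A 1 y = -((|l| : ℝ) : ℂ) • y := by
    rw [hy, map_sub, map_smul, h1, smul_sub, neg_smul, neg_smul]
    abel
  have h3 : 0 ≤ RCLike.re (inner ℂ y (absPow A 1 y)) := by
    obtain ⟨B, hBs, hBB⟩ := exists_mul_self_eq_absPow_one A
    rw [← hBB, show inner ℂ y ((B * B) y) = inner ℂ (B y) (B y) from (hBs.isSymmetric y (B y)).symm]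
    exact inner_self_nonneg
  have h4 : inner ℂ y (absPow A 1 y) = ((-(|l| * ‖y‖ ^ 2) : ℝ) : ℂ) := by
    rw [h2, inner_smul_right, inner_self_eq_norm_sq_to_K]
    push_cast
    simp
  rw [h4] at h3
  have h5 : |l| * ‖y‖ ^ 2 ≤ 0 := by
    have : RCLike.re ((-(|l| * ‖y‖ ^ 2) : ℝ) : ℂ) = -(|l| * ‖y‖ ^ 2) := RCLike.ofReal_re _
    linarith
  rcases eq_or_ne l 0 with rfl | hl
  · have h6 := norm_apply_eq_norm_abs_apply A x
    rw [hx] at h6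
    simp only [Complex.ofReal_zero, zero_smul, norm_zero, abs_zero] at h6 ⊢
    exact norm_eq_zero.mp h6.symm
  · have h6 : ‖y‖ ^ 2 = 0 := by
      have : 0 < |l| := abs_pos.mpr hl
      nlinarith [sq_nonneg ‖y‖]
    exact sub_eq_zero.mp (norm_eq_zero.mp (pow_eq_zero_iff two_ne_zero |>.mp h6))

/-- Expand each `e n` in the eigenbasis, exchange the two sums of nonnegative terms, and use
Parseval for each eigenvector. -/
theorem schattenNorm_one_eq_tsum {A : Op} (hA : IsSelfAdjoint A) {b : HilbertBasis ℕ ℂ L2}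
    {l : ℕ → ℝ} (h : ∀ k, A (b k) = (l k : ℂ) • b k) :
    schattenNorm 1 A = ∑' k, ‖l k‖ₑ := by
  rw [schattenNorm_one]
  have hs := (absPow_one_nonneg A).isSelfAdjoint
  have h1 : ∀ n : ℤ, ENNReal.ofReal (RCLike.re (inner ℂ (e n) (absPow A 1 (e n)))) =
      ∑' k, ‖l k‖ₑ * ‖inner ℂ (e n) (b k)‖ₑ ^ 2 := by
    intro n
    have h2 := b.hasSum_inner_mul_inner (e n) (absPow A 1 (e n))
    have h3 : ∀ k, inner ℂ (e n) (b k) * inner ℂ (b k) (absPow A 1 (e n)) =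
        ((|l k| * ‖inner ℂ (e n) (b k)‖ ^ 2 : ℝ) : ℂ) := by
      intro k
      have h5 : inner ℂ (b k) (absPow A 1 (e n)) = inner ℂ (absPow A 1 (b k)) (e n) :=
        (hs.isSymmetric (b k) (e n)).symm
      rw [h5, absPow_one_eigenvector hA (h k), inner_smul_left, Complex.conj_ofReal,
        ← inner_conj_symm (b k) (e n)]
      have := RCLike.mul_conj (inner ℂ (e n) (b k))
      rw [mul_left_comm, this]
      push_cast
      rfl
    simp only [h3] at h2
    have h4 := Complex.hasSum_re h2
    simp only [Complex.ofReal_re] at h4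
    rw [show RCLike.re (inner ℂ (e n) (absPow A 1 (e n))) =
      (inner ℂ (e n) (absPow A 1 (e n))).re from rfl, ← h4.tsum_eq,
      ENNReal.ofReal_tsum_of_nonneg (fun k => by positivity) h4.summable]
    refine tsum_congr fun k => ?_
    rw [ENNReal.ofReal_mul (abs_nonneg _), ENNReal.ofReal_pow (norm_nonneg _), ofReal_norm,
      ← Real.norm_eq_abs, ofReal_norm]
  unfold posTrace
  simp only [h1]
  rw [ENNReal.tsum_comm]
  refine tsum_congr fun k => ?_
  rw [ENNReal.tsum_mul_left, tsum_enorm_coef_sq, ← ofReal_norm (b k), b.orthonormal.1 k]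
  simp

theorem norm_ketBra (φ ψ : L2) : ‖ketBra φ ψ‖ = ‖φ‖ * ‖ψ‖ := by
  simp [ketBra]

theorem ketBra_apply (φ ψ f : L2) : ketBra φ ψ f = inner ℂ ψ f • φ := by
  simp [ketBra]

/-- The spectral decomposition of a self-adjoint trace-class operator. -/
theorem exists_spectral {A : Op} (hA : IsSelfAdjoint A) (h : schattenNorm 1 A < ⊤) :
    ∃ (φ : ℕ → L2) (l : ℕ → ℝ), Orthonormal ℂ φ ∧ Summable (fun k => |l k|) ∧
      schattenNorm 1 A = ∑' k, ‖l k‖ₑ ∧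
      HasSum (fun k => (l k : ℂ) • ketBra (φ k) (φ k)) A := by
  have hc : IsCompactOperator A := isCompactOperator_of_posTrace A (schattenNorm_one A ▸ h)
  obtain ⟨b, l, hb⟩ := exists_eigenbasis hA hc
  have h1 := schattenNorm_one_eq_tsum hA hb
  have hsum : Summable (fun k => |l k|) := by
    rw [h1] at h
    refine (ENNReal.summable_toReal h.ne).congr fun k => ?_
    rw [toReal_enorm, Real.norm_eq_abs]
  refine ⟨b, l, b.orthonormal, hsum, h1, ?_⟩
  have h2 : Summable fun k => (l k : ℂ) • ketBra (b k) (b k) := by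
    refine Summable.of_norm_bounded hsum fun k => ?_
    rw [norm_smul, norm_ketBra, b.orthonormal.1 k]
    simp
  have h3 : ∑' k, (l k : ℂ) • ketBra (b k) (b k) = A := by
    ext1 x
    have h4 := h2.hasSum.mapL (ContinuousLinearMap.apply ℂ L2 x)
    have h5 := (b.hasSum_repr x).mapL A
    refine h4.unique (h5.congr_fun fun k => ?_)
    rw [b.repr_apply_apply, A.map_smul, hb]
    simp only [ContinuousLinearMap.apply_apply, smul_apply, ketBra_apply]
    rw [smul_comm]
  rw [← h3]
  exact h2.hasSum

/-! ### Series of rank-one operators -/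

/-- `A = ∑ₖ |fₖ⟩⟨gₖ|` in the weak operator topology. -/
def RankOneSum {ι : Type*} (A : Op) (f g : ι → L2) : Prop :=
  ∀ x y, HasSum (fun k => inner ℂ x (f k) * inner ℂ (g k) y) (inner ℂ x (A y))

theorem rankOneSum_of_hasSum {ι : Type*} {A : Op} {a : ι → ℝ} {φ ψ : ι → L2}
    (h : HasSum (fun k => (a k : ℂ) • ketBra (φ k) (ψ k)) A) :
    RankOneSum A (fun k => (a k : ℂ) • φ k) ψ := by
  intro x y
  have h1 := (h.mapL (ContinuousLinearMap.apply ℂ L2 y)).mapL (innerSL ℂ x)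
  simp only [ContinuousLinearMap.apply_apply, smul_apply, ketBra_apply, innerSL_apply_apply] at h1
  refine h1.congr_fun fun k => ?_
  simp only [inner_smul_right]
  ring

theorem RankOneSum.conj {ι : Type*} {A : Op} {f g : ι → L2} (h : RankOneSum A f g) (B C : Op) :
    RankOneSum (B * A * star C) (fun k => B (f k)) (fun k => C (g k)) := by
  intro x y
  have h1 := h (star B x) (star C y)
  simp only [ContinuousLinearMap.star_eq_adjoint, ContinuousLinearMap.adjoint_inner_left,
    ContinuousLinearMap.adjoint_inner_right] at h1
  exact h1

theorem RankOneSum.add {ι κ : Type*} {A B : Op} {f g : ι → L2} {f' g' : κ → L2}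
    (h : RankOneSum A f g) (h' : RankOneSum B f' g') :
    RankOneSum (A + B) (Sum.elim f f') (Sum.elim g g') := by
  intro x y
  rw [add_apply, inner_add_right]
  exact (h x y).sum (h' x y)

theorem RankOneSum.schattenNorm_le {ι : Type*} {A : Op} {f g : ι → L2} (h : RankOneSum A f g)
    (hA : IsSelfAdjoint A) : schattenNorm 1 A ≤ ∑' k, ‖f k‖ₑ * ‖g k‖ₑ := by
  rw [schattenNorm_one]
  exact posTrace_abs_le hA h

/-- The shifted coefficients of f belong to a function of the same norm, so the unshifted
Cauchy–Schwarz inequality applies. -/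
theorem tsum_enorm_coef_shift_mul_le (n : ℤ) (f g : L2) :
    ∑' m : ℤ, ‖inner ℂ (e (m + n)) f * inner ℂ g (e m)‖ₑ ≤ ‖f‖ₑ * ‖g‖ₑ := by
  have h : ∃ f' : L2, ‖f'‖ₑ = ‖f‖ₑ ∧ ∀ m, inner ℂ (e m) f' = inner ℂ (e (m + n)) f := by
    have h1 := (Equiv.addRight n).hasSum_iff.mpr (hasSum_norm_coef_sq f)
    obtain ⟨f', hf'⟩ := exists_of_coef (fun m => inner ℂ (e (m + n)) f) ‖f‖ (norm_nonneg f)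
      (fun F => sum_le_hasSum F (fun _ _ => by positivity) h1)
    refine ⟨f', ?_, hf'.1⟩
    have h2 := hasSum_norm_coef_sq f'
    simp only [hf'.1] at h2
    have h3 := h2.unique h1
    rw [← ofReal_norm, (sq_eq_sq₀ (norm_nonneg _) (norm_nonneg _)).mp h3, ofReal_norm]
  obtain ⟨f', h1, h2⟩ := h
  rw [← h1]
  refine le_trans (le_of_eq (tsum_congr fun m => ?_)) (tsum_enorm_coef_mul_le f' g)
  rw [enorm_mul, h2, ← ofReal_norm (inner ℂ g (e m)), norm_inner_symm, ofReal_norm]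

/-! ### Products of two functions -/

theorem star_e (n : ℤ) : (star (e n) : L2) = e (-n) := by
  refine Lp.ext ?_
  filter_upwards [Lp.coeFn_star (e n), e_ae n, e_ae (-n)] with x h1 h2 h3
  rw [h1, Pi.star_apply, h2, h3, fourier_neg]
  simp

theorem inner_star_star (f g : L2) : inner ℂ (star f) (star g) = (starRingEnd ℂ) (inner ℂ f g) := by
  rw [L2.inner_def, L2.inner_def, ← integral_conj]
  refine integral_congr_ae ?_
  filter_upwards [Lp.coeFn_star f, Lp.coeFn_star g] with x h1 h2
  rw [h1, h2]
  simp

theorem prodCoef_e (n m : ℤ) (g : L2) :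
    prodCoef n (e m) (star g) = (1 / √(2 * Real.pi) : ℝ) * inner ℂ g (e (m - n)) := by
  rw [prodCoef_apply, L2.inner_def, ← integral_const_mul]
  refine integral_congr_ae ?_
  filter_upwards [Lp.coeFn_star g, e_ae n, e_ae m, e_ae (m - n)] with x h1 h2 h3 h4
  rw [h1, h2, h3, h4, sub_eq_add_neg, fourier_add, fourier_neg, Pi.star_apply, map_mul,
    Complex.conj_ofReal]
  simp only [RCLike.inner_apply, RCLike.star_def]
  ring

/-- Insert the Fourier series of f into the bilinear form. This links the n-th diagonal of |f⟩⟨g| to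
the n-th coefficient of its density f·conj g. -/
theorem hasSum_prodCoef (n : ℤ) (f g : L2) :
    HasSum (fun m : ℤ => inner ℂ (e (m + n)) f * inner ℂ g (e m))
      ((√(2 * Real.pi) : ℝ) * prodCoef n f (star g)) := by
  have h1 := (((hasSum_coef_smul f).mapL (prodCoef n)).mapL
    (ContinuousLinearMap.apply ℂ ℂ (star g : L2)))
  have h2 := ((Equiv.addRight n).hasSum_iff.mpr h1).mul_left ((√(2 * Real.pi) : ℝ) : ℂ)
  refine h2.congr_fun fun m => ?_
  simp only [Function.comp_apply, Equiv.coe_addRight, map_smul, ContinuousLinearMap.apply_apply,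
    smul_eq_mul, prodCoef_e, add_sub_cancel_right]
  have h3 : ((√(2 * Real.pi) : ℝ) : ℂ) * ((1 / √(2 * Real.pi) : ℝ) : ℂ) = 1 := by
    rw [← Complex.ofReal_mul, mul_one_div_cancel (by positivity), Complex.ofReal_one]
  linear_combination (-inner ℂ (e (m + n)) f * inner ℂ g (e m)) * h3

/-- The Cauchy–Schwarz inequality for square roots of integrals. -/
theorem lintegral_mul_le_sqrt {α : Type*} [MeasurableSpace α] {μ : Measure α} {F G : α → ℝ≥0∞}
    (hF : AEMeasurable F μ) (hG : AEMeasurable G μ) :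
    ∫⁻ x, F x * G x ∂μ ≤
      (∫⁻ x, F x ^ 2 ∂μ) ^ (1 / 2 : ℝ) * (∫⁻ x, G x ^ 2 ∂μ) ^ (1 / 2 : ℝ) := by
  have := ENNReal.lintegral_mul_le_Lp_mul_Lq μ (p := 2) (q := 2)
    (by norm_num [Real.holderConjugate_iff]) hF hG
  simpa only [ENNReal.rpow_ofNat, Pi.mul_apply] using this

/-- Minkowski's inequality for series. -/
theorem lintegral_tsum_sq_le {α ι : Type*} [Countable ι] [MeasurableSpace α] {μ : Measure α}
    {F : ι → α → ℝ≥0∞} (hF : ∀ k, AEMeasurable (F k) μ) :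
    ∫⁻ x, (∑' k, F k x) ^ 2 ∂μ ≤ (∑' k, (∫⁻ x, F k x ^ 2 ∂μ) ^ (1 / 2 : ℝ)) ^ 2 := by
  simp only [sq (tsum _)]
  simp only [← ENNReal.tsum_mul_left, ← ENNReal.tsum_mul_right]
  have hm : ∀ j k, AEMeasurable (fun x => F k x * F j x) μ := fun j k => (hF k).mul (hF j)
  rw [lintegral_tsum fun j => AEMeasurable.tsum (hm j)]
  refine ENNReal.tsum_le_tsum fun j => ?_
  rw [lintegral_tsum (hm j)]
  exact ENNReal.tsum_le_tsum fun k => lintegral_mul_le_sqrt (hF k) (hF j)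

theorem enorm_mul_conj_sq_le (f g : L2) :
    (∫⁻ x : Circ, (‖f x‖ₑ * ‖g x‖ₑ) ^ 2) ^ (1 / 2 : ℝ) ≤
      quart f ^ (1 / 4 : ℝ) * quart g ^ (1 / 4 : ℝ) := by
  have h := lintegral_mul_le_sqrt (μ := (volume : Measure Circ))
    ((Lp.aestronglyMeasurable f).enorm.pow_const 2) ((Lp.aestronglyMeasurable g).enorm.pow_const 2)
  simp only [← pow_mul] at h
  calc _ ≤ (quart f ^ (1 / 2 : ℝ) * quart g ^ (1 / 2 : ℝ)) ^ (1 / 2 : ℝ) := by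
        refine ENNReal.rpow_le_rpow ?_ (by norm_num)
        simpa only [mul_pow, quart] using h
    _ = _ := by
        rw [ENNReal.mul_rpow_of_nonneg _ _ (by norm_num), ← ENNReal.rpow_mul, ← ENNReal.rpow_mul]
        norm_num

/-- Pointwise sums of products. -/
theorem exists_density {ι : Type*} [Countable ι] {f g : ι → L2}
    (h4 : ∑' k, quart (f k) ^ (1 / 4 : ℝ) * quart (g k) ^ (1 / 4 : ℝ) < ⊤) :
    ∃ ρ : L2, (∀ᵐ x : Circ, HasSum (fun k => f k x * (starRingEnd ℂ) (g k x)) (ρ x)) ∧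
      ‖ρ‖ₑ ≤ ∑' k, quart (f k) ^ (1 / 4 : ℝ) * quart (g k) ^ (1 / 4 : ℝ) := by
  have hm : ∀ k, AEMeasurable (fun x : Circ => ‖f k x‖ₑ * ‖g k x‖ₑ) := fun k =>
    (Lp.aestronglyMeasurable (f k)).enorm.mul (Lp.aestronglyMeasurable (g k)).enorm
  set M := ∑' k, quart (f k) ^ (1 / 4 : ℝ) * quart (g k) ^ (1 / 4 : ℝ) with hM
  have hsq : ∫⁻ x : Circ, (∑' k, ‖f k x‖ₑ * ‖g k x‖ₑ) ^ 2 ≤ M ^ 2 := by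
    refine (lintegral_tsum_sq_le hm).trans ?_
    exact pow_le_pow_left' (ENNReal.tsum_le_tsum fun k => enorm_mul_conj_sq_le _ _) 2
  have hae : ∀ᵐ x : Circ, ∑' k, ‖f k x‖ₑ * ‖g k x‖ₑ < ⊤ := by
    have := ae_lt_top' ((AEMeasurable.tsum hm).pow_const 2)
      (hsq.trans_lt (ENNReal.pow_lt_top h4)).ne
    filter_upwards [this] with x hx
    by_contra h
    rw [not_lt, top_le_iff] at h
    rw [h] at hx
    simp at hx
  have hsum : ∀ᵐ x : Circ, HasSum (fun k => f k x * (starRingEnd ℂ) (g k x))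
      (∑' k, f k x * (starRingEnd ℂ) (g k x)) := by
    filter_upwards [hae] with x hx
    refine Summable.hasSum (Summable.of_norm ?_)
    refine (ENNReal.summable_toReal hx.ne).congr fun k => ?_
    rw [ENNReal.toReal_mul, toReal_enorm, toReal_enorm, norm_mul, RCLike.norm_conj]
  have hmeas : AEStronglyMeasurable (fun x : Circ => ∑' k, f k x * (starRingEnd ℂ) (g k x)) := by
    refine aestronglyMeasurable_of_tendsto_ae (atTop : Filter (Finset ι))
      (f := fun F x => ∑ k ∈ F, f k x * (starRingEnd ℂ) (g k x)) (fun F => ?_) hsum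
    refine Finset.aestronglyMeasurable_fun_sum F fun k _ => ?_
    exact (Lp.aestronglyMeasurable _).mul
      (Complex.continuous_conj.comp_aestronglyMeasurable (Lp.aestronglyMeasurable _))
  have hnorm : eLpNorm (fun x : Circ => ∑' k, f k x * (starRingEnd ℂ) (g k x)) 2 volume ≤ M := by
    rw [eLpNorm_eq_lintegral_rpow_enorm_toReal (by norm_num) (by norm_num)]
    simp only [ENNReal.toReal_ofNat, ENNReal.rpow_ofNat]
    calc _ ≤ (M ^ 2) ^ (1 / 2 : ℝ) := by
          refine ENNReal.rpow_le_rpow (le_trans (lintegral_mono fun x => ?_) hsq) (by norm_num)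
          gcongr
          refine enorm_tsum_le_tsum_enorm.trans (le_of_eq (tsum_congr fun k => ?_))
          rw [enorm_mul, ← ofReal_norm ((starRingEnd ℂ) _), RCLike.norm_conj, ofReal_norm]
      _ = M := by rw [← ENNReal.rpow_natCast, ← ENNReal.rpow_mul]; norm_num
  have hL : MemLp (fun x : Circ => ∑' k, f k x * (starRingEnd ℂ) (g k x)) 2 volume :=
    ⟨hmeas, hnorm.trans_lt h4⟩
  refine ⟨hL.toLp, ?_, ?_⟩
  · filter_upwards [hsum, hL.coeFn_toLp] with x h2 h3
    rwa [h3]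
  · rw [Lp.enorm_toLp]
    exact hnorm

/-! ### Densities through Fourier coefficients -/

/-- The Fourier coefficients of `ρ` are the traces of `A` along the diagonals. -/
def DensC (A : Op) (ρ : L2) : Prop :=
  ∀ n : ℤ, HasSum (fun m : ℤ => inner ℂ (e (m + n)) (A (e m)))
    (((√(2 * Real.pi) : ℝ) : ℂ) * inner ℂ (e n) ρ)

/-- `IsDensity` depends on a singular value decomposition, and neither its linearity nor its
uniqueness is apparent. `DensC` has both, and differences of densities are estimated through it. -/
theorem DensC.sub {A B : Op} {ρ τ : L2} (h : DensC A ρ) (h' : DensC B τ) : DensC (A - B) (ρ - τ) := by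
  intro n
  have := (h n).sub (h' n)
  simpa only [sub_apply, inner_sub_right, mul_sub] using this

theorem DensC.unique {A : Op} {ρ τ : L2} (h : DensC A ρ) (h' : DensC A τ) : ρ = τ := by
  apply ext_coef
  intro n
  have h0 : ((√(2 * Real.pi) : ℝ) : ℂ) ≠ 0 := by
    rw [Complex.ofReal_ne_zero]; positivity
  exact mul_left_cancel₀ h0 ((h n).unique (h' n))

/-- The double series over (k, m) converges absolutely by `tsum_enorm_coef_shift_mul_le` and is
summed in both orders. -/
theorem RankOneSum.hasSum_diag {ι : Type*} {A : Op} {f g : ι → L2} (h : RankOneSum A f g)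
    (h1 : ∑' k, ‖f k‖ₑ * ‖g k‖ₑ < ⊤) (n : ℤ) :
    HasSum (fun m : ℤ => inner ℂ (e (m + n)) (A (e m)))
      (((√(2 * Real.pi) : ℝ) : ℂ) * ∑' k, prodCoef n (f k) (star (g k))) := by
  let F : ι × ℤ → ℂ := fun p => inner ℂ (e (p.2 + n)) (f p.1) * inner ℂ (g p.1) (e p.2)
  have hF : Summable F := by
    have h2 : ∑' p, ‖F p‖ₑ ≠ ⊤ := by
      rw [ENNReal.tsum_prod']
      exact ((ENNReal.tsum_le_tsum fun k =>
        tsum_enorm_coef_shift_mul_le n (f k) (g k)).trans_lt h1).ne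
    refine Summable.of_norm ((ENNReal.summable_toReal h2).congr fun p => ?_)
    rw [toReal_enorm]
  have h2 := hF.hasSum.prod_fiberwise fun k => hasSum_prodCoef n (f k) (g k)
  have h3 := ((Equiv.prodComm ℤ ι).hasSum_iff.mpr hF.hasSum).prod_fiberwise
    fun m => h (e (m + n)) (e m)
  rw [← tsum_mul_left, h2.tsum_eq]
  exact h3

theorem RankOneSum.densC {ι : Type*} [Countable ι] {A : Op} {f g : ι → L2} (h : RankOneSum A f g)
    (h1 : ∑' k, ‖f k‖ₑ * ‖g k‖ₑ < ⊤) {ρ : L2}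
    (hρ : ∀ᵐ x : Circ, HasSum (fun k => f k x * (starRingEnd ℂ) (g k x)) (ρ x)) : DensC A ρ := by
  intro n
  convert! h.hasSum_diag h1 n using 2
  have hm : ∀ k, AEStronglyMeasurable (fun x : Circ =>
      (starRingEnd ℂ) (e n x) * (f k x * (starRingEnd ℂ) (g k x))) := fun k =>
    (Complex.continuous_conj.comp_aestronglyMeasurable (Lp.aestronglyMeasurable _)).mul
      ((Lp.aestronglyMeasurable _).mul
        (Complex.continuous_conj.comp_aestronglyMeasurable (Lp.aestronglyMeasurable _)))
  have hconj : ∀ z : ℂ, ‖(starRingEnd ℂ) z‖ₑ = ‖z‖ₑ := fun z => by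
    rw [← ofReal_norm, RCLike.norm_conj, ofReal_norm]
  have hfin : ∑' k, ∫⁻ x : Circ, ‖(starRingEnd ℂ) (e n x) * (f k x * (starRingEnd ℂ) (g k x))‖ₑ
      ≠ ⊤ := by
    have hb : ∀ k, ∫⁻ x : Circ, ‖(starRingEnd ℂ) (e n x) * (f k x * (starRingEnd ℂ) (g k x))‖ₑ ≤
        ENNReal.ofReal (1 / √(2 * Real.pi)) * (‖f k‖ₑ * ‖g k‖ₑ) := by
      intro k
      calc _ = ∫⁻ x : Circ, ENNReal.ofReal (1 / √(2 * Real.pi)) * (‖f k x‖ₑ * ‖g k x‖ₑ) := by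
            refine lintegral_congr_ae ?_
            filter_upwards [e_ae n] with x hx
            rw [enorm_mul, enorm_mul, hconj, hconj, hx, enorm_mul]
            have h2 : ‖(fourier n x : ℂ)‖ₑ = 1 := by
              rw [← ofReal_norm, fourier_apply, Circle.norm_coe, ENNReal.ofReal_one]
            rw [h2, mul_one, ← ofReal_norm, Complex.norm_real,
              Real.norm_of_nonneg (by positivity)]
        _ = ENNReal.ofReal (1 / √(2 * Real.pi)) * ∫⁻ x : Circ, ‖f k x‖ₑ * ‖g k x‖ₑ :=
            lintegral_const_mul' _ _ ENNReal.ofReal_ne_top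
        _ ≤ _ := by
            gcongr
            refine (lintegral_mul_le_sqrt (Lp.aestronglyMeasurable _).enorm
              (Lp.aestronglyMeasurable _).enorm).trans (le_of_eq ?_)
            rw [Lp.enorm_def, Lp.enorm_def,
              eLpNorm_eq_lintegral_rpow_enorm_toReal (by norm_num) (by norm_num),
              eLpNorm_eq_lintegral_rpow_enorm_toReal (by norm_num) (by norm_num)]
            simp
    refine ((ENNReal.tsum_le_tsum hb).trans_lt ?_).ne
    rw [ENNReal.tsum_mul_left]
    exact ENNReal.mul_lt_top ENNReal.ofReal_lt_top h1
  have h2 := integral_tsum hm hfin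
  rw [L2.inner_def]
  have h3 : ∀ k, prodCoef n (f k) (star (g k)) =
      ∫ x : Circ, (starRingEnd ℂ) (e n x) * (f k x * (starRingEnd ℂ) (g k x)) := by
    intro k
    rw [prodCoef_apply]
    refine integral_congr_ae ?_
    filter_upwards [Lp.coeFn_star (g k)] with x hx
    rw [hx]; rfl
  simp only [h3]
  rw [← h2]
  refine integral_congr_ae ?_
  filter_upwards [hρ] with x hx
  rw [tsum_mul_left, hx.tsum_eq, RCLike.inner_apply, mul_comm]

theorem IsDensity.densC {A : Op} {ρ : L2} (h : IsDensity A ρ) : DensC A ρ := by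
  obtain ⟨a, φ, ψ, ha, hs, hφ, hψ, hA, hρ⟩ := h
  refine (rankOneSum_of_hasSum hA).densC ?_ ?_
  · have h1 : ∀ k, ‖(a k : ℂ) • φ k‖ₑ * ‖ψ k‖ₑ = ENNReal.ofReal (a k) := by
      intro k
      rw [← ofReal_norm, ← ofReal_norm, norm_smul, hφ.1, hψ.1, Complex.norm_real,
        Real.norm_of_nonneg (ha k)]
      simp
    simp only [h1]
    exact hs.tsum_ofReal_lt_top
  · have h2 : ∀ᵐ x : Circ, ∀ k, ((a k : ℂ) • φ k : L2) x = (a k : ℂ) * φ k x := by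
      rw [ae_all_iff]
      intro k
      filter_upwards [Lp.coeFn_smul (a k : ℂ) (φ k)] with x hx
      rw [hx, Pi.smul_apply, smul_eq_mul]
    filter_upwards [h2, hρ] with x h3 h4
    simpa only [h3] using h4

/-- By uniqueness in `DensC`, ρ is the pointwise sum built from f and g. Hence any rank-one
expansion bounds the density, not only the one that defines it. -/
theorem RankOneSum.enorm_densC_le {ι : Type*} [Countable ι] {A : Op} {f g : ι → L2}
    (h : RankOneSum A f g) (h1 : ∑' k, ‖f k‖ₑ * ‖g k‖ₑ < ⊤) {ρ : L2} (hρ : DensC A ρ) :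
    ‖ρ‖ₑ ≤ ∑' k, quart (f k) ^ (1 / 4 : ℝ) * quart (g k) ^ (1 / 4 : ℝ) := by
  by_cases h4 : ∑' k, quart (f k) ^ (1 / 4 : ℝ) * quart (g k) ^ (1 / 4 : ℝ) < ⊤
  · obtain ⟨τ, h2, h3⟩ := exists_density h4
    rwa [hρ.unique (h.densC h1 h2)]
  · rw [not_lt, top_le_iff] at h4
    rw [h4]
    exact le_top

/-- Self-adjointness exchanges the diagonals n and −n up to conjugation, so `star ρ` and ρ have the
same coefficients. -/
theorem DensC.isRealValued {A : Op} {ρ : L2} (hA : IsSelfAdjoint A) (h : DensC A ρ) :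
    IsRealValued ρ := by
  have h1 : (star ρ : L2) = ρ := by
    apply ext_coef
    intro n
    have h2 := (Complex.hasSum_conj'.mpr (h (-n)))
    have h3 := (Equiv.addRight n).hasSum_iff.mpr h2
    have h4 : ∀ m : ℤ, ((fun m : ℤ => (starRingEnd ℂ) (inner ℂ (e (m + -n)) (A (e m)))) ∘
        (Equiv.addRight n)) m = inner ℂ (e (m + n)) (A (e m)) := by
      intro m
      simp only [Function.comp_apply, Equiv.coe_addRight, add_neg_cancel_right, inner_conj_symm]
      exact hA.isSymmetric _ _
    have h5 := (h3.congr_fun fun m => (h4 m).symm).unique (h n)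
    rw [map_mul, Complex.conj_ofReal] at h5
    have h0 : ((√(2 * Real.pi) : ℝ) : ℂ) ≠ 0 := by
      rw [Complex.ofReal_ne_zero]; positivity
    rw [← mul_left_cancel₀ h0 h5, ← inner_star_star, star_e, neg_neg]
  have h2 := Lp.coeFn_star ρ
  rw [h1] at h2
  filter_upwards [h2] with x hx
  exact hx.symm

/-! ### Densities depending on time -/

theorem aestronglyMeasurable_of_coef {μ : Measure ℝ} {ρ : ℝ → L2}
    (h : ∀ n, AEStronglyMeasurable (fun t => inner ℂ (e n) (ρ t)) μ) : AEStronglyMeasurable ρ μ := by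
  refine aestronglyMeasurable_of_tendsto_ae (atTop : Filter (Finset ℤ))
    (f := fun F t => ∑ n ∈ F, inner ℂ (e n) (ρ t) • e n) (fun F => ?_)
    (Eventually.of_forall fun t => hasSum_coef_smul (ρ t))
  exact Finset.aestronglyMeasurable_fun_sum F fun n _ => (h n).smul_const (e n)

/-- Densities get chosen separately at each time. Measurability is recovered because their
coefficients are limits of finite sums of matrix elements of `A t`. -/
theorem aestronglyMeasurable_of_densC {μ : Measure ℝ} {A : ℝ → Op} {ρ : ℝ → L2}
    (hA : ∀ x y, AEStronglyMeasurable (fun t => inner ℂ x (A t y)) μ)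
    (h : ∀ᵐ t ∂μ, DensC (A t) (ρ t)) : AEStronglyMeasurable ρ μ := by
  refine aestronglyMeasurable_of_coef fun n => ?_
  have h0 : ((√(2 * Real.pi) : ℝ) : ℂ) ≠ 0 := by
    rw [Complex.ofReal_ne_zero]; positivity
  have h1 : AEStronglyMeasurable (fun t => ((√(2 * Real.pi) : ℝ) : ℂ) * inner ℂ (e n) (ρ t)) μ := by
    refine aestronglyMeasurable_of_tendsto_ae (atTop : Filter (Finset ℤ))
      (f := fun F t => ∑ m ∈ F, inner ℂ (e (m + n)) (A t (e m))) (fun F => ?_) ?_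
    · exact Finset.aestronglyMeasurable_fun_sum F fun m _ => hA _ _
    · filter_upwards [h] with t ht
      exact ht n
  refine (h1.const_mul (((√(2 * Real.pi) : ℝ) : ℂ)⁻¹)).congr (Eventually.of_forall fun t => ?_)
  exact inv_mul_cancel_left₀ h0 _

theorem lintegral_quart_sq_le {a b : ℝ} {f g : ℝ → L2}
    (hf : AEStronglyMeasurable f (volume.restrict (Set.Ioc a b)))
    (hg : AEStronglyMeasurable g (volume.restrict (Set.Ioc a b))) :
    (∫⁻ t in Set.Ioc a b, (quart (f t) ^ (1 / 4 : ℝ) * quart (g t) ^ (1 / 4 : ℝ)) ^ 2) ^ (1 / 2 : ℝ)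
      ≤ n4 a b f * n4 a b g := by
  have h := lintegral_mul_le_sqrt (((aemeasurable_quart hf).pow_const (1 / 4 : ℝ)).pow_const 2)
    (((aemeasurable_quart hg).pow_const (1 / 4 : ℝ)).pow_const 2)
  simp only [← pow_mul, Nat.reduceMul, rpow_quarter_pow] at h
  calc _ ≤ ((∫⁻ t in Set.Ioc a b, quart (f t)) ^ (1 / 2 : ℝ) *
        (∫⁻ t in Set.Ioc a b, quart (g t)) ^ (1 / 2 : ℝ)) ^ (1 / 2 : ℝ) := by
        refine ENNReal.rpow_le_rpow ?_ (by norm_num)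
        simpa only [mul_pow] using h
    _ = _ := by
        rw [ENNReal.mul_rpow_of_nonneg _ _ (by norm_num), ← ENNReal.rpow_mul, ← ENNReal.rpow_mul,
          n4, n4]
        norm_num

theorem lintegral_tsum_quart_sq_le {ι : Type*} [Countable ι] {a b : ℝ} {f g : ι → ℝ → L2}
    (hf : ∀ k, AEStronglyMeasurable (f k) (volume.restrict (Set.Ioc a b)))
    (hg : ∀ k, AEStronglyMeasurable (g k) (volume.restrict (Set.Ioc a b))) :
    ∫⁻ t in Set.Ioc a b, (∑' k, quart (f k t) ^ (1 / 4 : ℝ) * quart (g k t) ^ (1 / 4 : ℝ)) ^ 2 ≤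
      (∑' k, n4 a b (f k) * n4 a b (g k)) ^ 2 := by
  refine (lintegral_tsum_sq_le fun k => ((aemeasurable_quart (hf k)).pow_const _).mul
    ((aemeasurable_quart (hg k)).pow_const _)).trans ?_
  exact pow_le_pow_left' (ENNReal.tsum_le_tsum fun k => lintegral_quart_sq_le (hf k) (hg k)) 2

theorem n2_le_tsum {ι : Type*} [Countable ι] {a b : ℝ} {f g : ι → ℝ → L2} {A : ℝ → Op}
    {ρ : ℝ → L2}
    (hf : ∀ k, AEStronglyMeasurable (f k) (volume.restrict (Set.Ioc a b)))
    (hg : ∀ k, AEStronglyMeasurable (g k) (volume.restrict (Set.Ioc a b)))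
    (h : ∀ t ∈ Set.Ioc a b, RankOneSum (A t) (fun k => f k t) (fun k => g k t))
    (h1 : ∀ t ∈ Set.Ioc a b, ∑' k, ‖f k t‖ₑ * ‖g k t‖ₑ < ⊤)
    (hρ : ∀ᵐ t ∂(volume.restrict (Set.Ioc a b)), DensC (A t) (ρ t)) :
    n2 a b ρ ≤ ∑' k, n4 a b (f k) * n4 a b (g k) := by
  set M := ∑' k, n4 a b (f k) * n4 a b (g k) with hM
  calc n2 a b ρ ≤ (M ^ 2) ^ (1 / 2 : ℝ) := by
        refine ENNReal.rpow_le_rpow (le_trans (lintegral_mono_ae ?_)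
          (lintegral_tsum_quart_sq_le hf hg)) (by norm_num)
        filter_upwards [hρ, ae_restrict_mem measurableSet_Ioc] with t h2 ht
        exact pow_le_pow_left' ((h t ht).enorm_densC_le (h1 t ht) h2) 2
    _ = M := by rw [← ENNReal.rpow_natCast, ← ENNReal.rpow_mul]; norm_num

/-! ### Conjugation of a self-adjoint trace-class operator -/

/-- `A = ∑ₖ lₖ |φₖ⟩⟨φₖ|` is the spectral decomposition of the trace-class operator `A`. -/
structure IsSpectral (A : Op) (φ : ℕ → L2) (l : ℕ → ℝ) : Prop where
  orthonormal : Orthonormal ℂ φ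
  summable : Summable fun k => |l k|
  norm_eq : schattenNorm 1 A = ∑' k, ‖l k‖ₑ
  hasSum : HasSum (fun k => (l k : ℂ) • ketBra (φ k) (φ k)) A

theorem exists_isSpectral {A : Op} (hA : IsSelfAdjoint A) (h : schattenNorm 1 A < ⊤) :
    ∃ φ l, IsSpectral A φ l := by
  obtain ⟨φ, l, h1, h2, h3, h4⟩ := exists_spectral hA h
  exact ⟨φ, l, h1, h2, h3, h4⟩

theorem enorm_ofReal (r : ℝ) : ‖(r : ℂ)‖ₑ = ‖r‖ₑ := by
  rw [← ofReal_norm, ← ofReal_norm, Complex.norm_real]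

theorem IsSpectral.enorm_eq_one {A : Op} {φ : ℕ → L2} {l : ℕ → ℝ} (h : IsSpectral A φ l) (k : ℕ) :
    ‖φ k‖ₑ = 1 := by
  rw [← ofReal_norm, h.orthonormal.1 k, ENNReal.ofReal_one]

theorem IsSpectral.rankOneSum {A : Op} {φ : ℕ → L2} {l : ℕ → ℝ} (h : IsSpectral A φ l)
    (B C : Op) : RankOneSum (B * A * star C) (fun k => (l k : ℂ) • B (φ k)) (fun k => C (φ k)) := by
  have := (rankOneSum_of_hasSum h.hasSum).conj B C
  simpa only [map_smul] using this

/-- From B A B* − C A C* = (B − C) A B* + C A (B − C)*: two families, each with one factor B − C. -/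
theorem IsSpectral.rankOneSum_sub {A : Op} {φ : ℕ → L2} {l : ℕ → ℝ} (h : IsSpectral A φ l)
    (B C : Op) : RankOneSum (B * A * star B - C * A * star C)
      (Sum.elim (fun k => (l k : ℂ) • (B - C) (φ k)) (fun k => (l k : ℂ) • C (φ k)))
      (Sum.elim (fun k => B (φ k)) (fun k => (B - C) (φ k))) := by
  have h1 : B * A * star B - C * A * star C =
      (B - C) * A * star B + C * A * star (B - C) := by
    rw [star_sub]; noncomm_ring
  rw [h1]
  exact (h.rankOneSum (B - C) B).add (h.rankOneSum C (B - C))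

theorem tsum_sum_elim {ι κ : Type*} (F : ι ⊕ κ → ℝ≥0∞) :
    ∑' i, F i = (∑' k, F (Sum.inl k)) + ∑' k, F (Sum.inr k) :=
  Summable.tsum_sum ENNReal.summable ENNReal.summable

theorem IsSpectral.tsum_elim_sub {A : Op} {φ : ℕ → L2} {l : ℕ → ℝ}
    (h : IsSpectral A φ l) {B C : Op} (hB : ∀ x, ‖B x‖ = ‖x‖) (hC : ∀ x, ‖C x‖ = ‖x‖) :
    ∑' i, ‖Sum.elim (fun k => (l k : ℂ) • (B - C) (φ k)) (fun k => (l k : ℂ) • C (φ k)) i‖ₑ *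
      ‖Sum.elim (fun k => B (φ k)) (fun k => (B - C) (φ k)) i‖ₑ =
      ∑' k, ‖l k‖ₑ * (2 * ‖B (φ k) - C (φ k)‖ₑ) := by
  rw [tsum_sum_elim, ← ENNReal.tsum_add]
  refine tsum_congr fun k => ?_
  have hB1 : ‖B (φ k)‖ₑ = 1 := by rw [← ofReal_norm, hB, ofReal_norm, h.enorm_eq_one]
  have hC1 : ‖C (φ k)‖ₑ = 1 := by rw [← ofReal_norm, hC, ofReal_norm, h.enorm_eq_one]
  simp only [Sum.elim_inl, Sum.elim_inr, enorm_smul, hB1, hC1, enorm_ofReal, sub_apply]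
  ring

theorem IsSpectral.schattenNorm_conj_sub_le {A : Op} {φ : ℕ → L2} {l : ℕ → ℝ}
    (h : IsSpectral A φ l) (hA : IsSelfAdjoint A) {B C : Op} (hB : ∀ x, ‖B x‖ = ‖x‖)
    (hC : ∀ x, ‖C x‖ = ‖x‖) :
    schattenNorm 1 (B * A * star B - C * A * star C) ≤
      ∑' k, ‖l k‖ₑ * (2 * ‖B (φ k) - C (φ k)‖ₑ) :=
  ((h.rankOneSum_sub B C).schattenNorm_le (.sub (hA.conjugate B) (hA.conjugate C))).trans
    (h.tsum_elim_sub hB hC).le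

theorem IsSpectral.tsum_conj {A : Op} {φ : ℕ → L2} {l : ℕ → ℝ} (h : IsSpectral A φ l) {B : Op}
    (hB : ∀ x, ‖B x‖ = ‖x‖) :
    ∑' k, ‖(l k : ℂ) • B (φ k)‖ₑ * ‖B (φ k)‖ₑ = schattenNorm 1 A := by
  rw [h.norm_eq]
  refine tsum_congr fun k => ?_
  rw [enorm_smul, ← ofReal_norm (B (φ k)), hB, ofReal_norm, h.enorm_eq_one, enorm_ofReal, mul_one,
    mul_one]

theorem schattenNorm_conj_le {A : Op} (hA : IsSelfAdjoint A) {B : Op} (hB : ∀ x, ‖B x‖ = ‖x‖) :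
    schattenNorm 1 (B * A * star B) ≤ schattenNorm 1 A := by
  by_cases h : schattenNorm 1 A < ⊤
  · obtain ⟨φ, l, hs⟩ := exists_isSpectral hA h
    rw [← hs.tsum_conj hB]
    exact (hs.rankOneSum B B).schattenNorm_le (hA.conjugate B)
  · rw [not_lt, top_le_iff] at h
    rw [h]
    exact le_top

theorem mul_ketBra_mul_star (B : Op) (φ ψ : L2) :
    B * ketBra φ ψ * star B = ketBra (B φ) (B ψ) := by
  ext1 x
  change B (ketBra φ ψ (star B x)) = _
  rw [ketBra_apply, ketBra_apply, map_smul, ContinuousLinearMap.star_eq_adjoint,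
    ContinuousLinearMap.adjoint_inner_right]

theorem IsSpectral.exists_isDensity {A : Op} {φ : ℕ → L2} {l : ℕ → ℝ} (h : IsSpectral A φ l)
    {B : Op} (hB : ∀ x, ‖B x‖ = ‖x‖)
    (h4 : ∑' k, quart ((l k : ℂ) • B (φ k)) ^ (1 / 4 : ℝ) * quart (B (φ k)) ^ (1 / 4 : ℝ) < ⊤) :
    ∃ ρ : L2, IsDensity (B * A * star B) ρ := by
  obtain ⟨ρ, hρ, -⟩ := exists_density h4
  let J : L2 →ₗᵢ[ℂ] L2 := ⟨B.toLinearMap, hB⟩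
  have hφ : Orthonormal ℂ fun k => B (φ k) := h.orthonormal.comp_linearIsometry J
  -- Singular values are nonnegative, so the sign of an eigenvalue is moved into ψₖ. At the
  -- eigenvalue 0 the sign is +1, which keeps the system orthonormal.
  let s : ℕ → ℝ := fun k => if l k < 0 then -1 else 1
  have hs : ∀ k, |l k| * s k = l k := by
    intro k
    simp only [s]
    split_ifs with hl
    · rw [abs_of_neg hl]; ring
    · rw [abs_of_nonneg (not_lt.mp hl)]; ring
  have hs1 : ∀ k, ‖(s k : ℂ)‖ = 1 := by
    intro k
    simp only [s]
    split_ifs <;> simp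
  have hψ : Orthonormal ℂ fun k => (s k : ℂ) • B (φ k) := by
    refine ⟨fun k => by rw [norm_smul, hs1, hφ.1 k, one_mul], fun i j hij => ?_⟩
    simp only [inner_smul_left, inner_smul_right]
    rw [hφ.2 hij, mul_zero, mul_zero]
  refine ⟨ρ, fun k => |l k|, fun k => B (φ k), fun k => (s k : ℂ) • B (φ k),
    fun k => abs_nonneg _, h.summable, hφ, hψ, ?_, ?_⟩
  · have h1 := (h.hasSum.mul_left B).mul_right (star B)
    refine h1.congr_fun fun k => ?_
    rw [mul_smul_comm, smul_mul_assoc, mul_ketBra_mul_star]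
    ext1 x
    simp only [smul_apply, ketBra_apply, inner_smul_left, Complex.conj_ofReal, smul_smul]
    rw [← mul_assoc, ← Complex.ofReal_mul, hs]
  · have h2 : ∀ᵐ x : Circ, ∀ k, ((l k : ℂ) • B (φ k) : L2) x = (l k : ℂ) * B (φ k) x ∧
        ((s k : ℂ) • B (φ k) : L2) x = (s k : ℂ) * B (φ k) x := by
      rw [ae_all_iff]
      intro k
      filter_upwards [Lp.coeFn_smul (l k : ℂ) (B (φ k)), Lp.coeFn_smul (s k : ℂ) (B (φ k))] with x
        h1 h2
      rw [h1, h2]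
      exact ⟨rfl, rfl⟩
    filter_upwards [h2, hρ] with x h3 h4
    refine h4.congr_fun fun k => ?_
    rw [(h3 k).1, (h3 k).2, map_mul, Complex.conj_ofReal]
    have := hs k
    have h5 : (l k : ℂ) = ((|l k| : ℝ) : ℂ) * (s k : ℂ) := by
      rw [← Complex.ofReal_mul, hs]
    linear_combination (-(B (φ k) x * (starRingEnd ℂ) (B (φ k) x))) * h5

section flow

/-! ### Unitary flows -/

/-- `U` is the propagator on `[0,T]` of a real potential in `L²([0,T]; L²(𝕋))`. -/
structure IsFlow (T : ℝ) (V : ℝ → L2) (U : ℝ → Op) : Prop where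
  nonneg : 0 ≤ T
  memLp : MemLp V 2 (volume.restrict (Set.Ioc 0 T))
  real : ∀ᵐ t ∂(volume.restrict (Set.Ioc 0 T)), IsRealValued (V t)
  prop : IsPropagator T V U

variable {T : ℝ} {V V' : ℝ → L2} {U U' : ℝ → Op} {A : Op} {φ : ℕ → L2} {l : ℕ → ℝ}

theorem ae_sub_interval {a b s t : ℝ} {p : ℝ → Prop}
    (h : ∀ᵐ r ∂(volume.restrict (Set.Ioc a b)), p r) (hs : a ≤ s) (ht : t ≤ b) :
    ∀ᵐ r ∂(volume.restrict (Set.Ioc s t)), p r :=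
  ae_restrict_of_ae_restrict_of_subset (Set.Ioc_subset_Ioc hs ht) h

theorem IsFlow.mono {T' : ℝ} (h : IsFlow T V U) (h0 : 0 ≤ T') (hT : T' ≤ T) : IsFlow T' V U :=
  ⟨h0, memLp_sub_interval h.memLp le_rfl hT, ae_sub_interval h.real le_rfl hT, h.prop.mono hT⟩

theorem IsFlow.congr_potential (h : IsFlow T V U)
    (hV : ∀ᵐ t ∂(volume.restrict (Set.Ioc 0 T)), V t = V' t) : IsFlow T V' U where
  nonneg := h.nonneg
  memLp := h.memLp.ae_eq hV
  real := by filter_upwards [h.real, hV] with t h1 h2; rwa [← h2]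
  prop := h.prop.congr_potential h.nonneg hV

theorem IsFlow.unique (h : IsFlow T V U) (h' : IsFlow T V U') {t : ℝ} (ht : t ∈ Set.Icc 0 T) :
    U t = U' t := h.prop.unique h.nonneg h.memLp h'.prop t ht

theorem IsFlow.isometry (h : IsFlow T V U) {t : ℝ} (ht : t ∈ Set.Icc 0 T) (x : L2) :
    ‖U t x‖ = ‖x‖ := h.prop.norm_eq h.memLp h.real ht x

theorem IsFlow.continuousOn (h : IsFlow T V U) (x : L2) :
    ContinuousOn (fun t => U t x) (Set.Icc 0 T) := (h.prop x).continuousOn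

theorem IsFlow.aestronglyMeasurable (h : IsFlow T V U) (x : L2) {a b : ℝ} (ha : 0 ≤ a)
    (hb : b ≤ T) : AEStronglyMeasurable (fun t => U t x) (volume.restrict (Set.Ioc a b)) :=
  ((h.continuousOn x).mono (fun _ ht => ⟨ha.trans ht.1.le, ht.2.trans hb⟩)).aestronglyMeasurable
    measurableSet_Ioc

/-- Dominated convergence in the spectral sum of `schattenNorm_conj_sub_le`: every `U s (φ k)` is
continuous in s, and isometry gives the majorant 4|lₖ|. -/
theorem IsFlow.schattenContinuous (h : IsFlow T V U) (hA : IsSelfAdjoint A)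
    (hfin : schattenNorm 1 A < ⊤) : SchattenContinuous 1 T fun t => U t * A * star (U t) := by
  obtain ⟨φ, l, hs⟩ := exists_isSpectral hA hfin
  intro t ht
  refine ⟨(schattenNorm_conj_le hA (h.isometry ht)).trans_lt hfin, ?_⟩
  have hreal : Tendsto (fun s => ∑' k, |l k| * (2 * ‖U s (φ k) - U t (φ k)‖)) (𝓝[Set.Icc 0 T] t)
      (𝓝 (∑' _ : ℕ, 0)) := by
    refine tendsto_tsum_of_dominated_convergence (bound := fun k => |l k| * 4)
      (hs.summable.mul_right 4) (fun k => ?_) ?_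
    · have h1 : Tendsto (fun s => U s (φ k) - U t (φ k)) (𝓝[Set.Icc 0 T] t) (𝓝 0) := by
        have := ((h.continuousOn (φ k)) t ht).tendsto.sub
          (tendsto_const_nhds (x := U t (φ k)))
        rwa [sub_self] at this
      have h2 := (h1.norm.const_mul 2).const_mul |l k|
      simpa using h2
    · filter_upwards [self_mem_nhdsWithin] with s hs' k
      rw [Real.norm_of_nonneg (by positivity)]
      gcongr
      have h1 := norm_sub_le (U s (φ k)) (U t (φ k))
      rw [h.isometry hs', h.isometry ht, hs.orthonormal.1 k] at h1
      linarith
  rw [tsum_zero] at hreal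
  have hE := ENNReal.tendsto_ofReal hreal
  rw [ENNReal.ofReal_zero] at hE
  refine tendsto_of_tendsto_of_tendsto_of_le_of_le' tendsto_const_nhds hE
    (Eventually.of_forall fun _ => bot_le) ?_
  filter_upwards [self_mem_nhdsWithin] with s hs'
  refine (hs.schattenNorm_conj_sub_le hA (h.isometry hs') (h.isometry ht)).trans (le_of_eq ?_)
  have hsum : Summable fun k => |l k| * (2 * ‖U s (φ k) - U t (φ k)‖) := by
    refine Summable.of_nonneg_of_le (fun k => by positivity) (fun k => ?_) (hs.summable.mul_right 4)
    gcongr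
    have h1 := norm_sub_le (U s (φ k)) (U t (φ k))
    rw [h.isometry hs', h.isometry ht, hs.orthonormal.1 k] at h1
    linarith
  rw [ENNReal.ofReal_tsum_of_nonneg (fun k => by positivity) hsum]
  refine tsum_congr fun k => ?_
  rw [ENNReal.ofReal_mul (abs_nonneg _), ENNReal.ofReal_mul zero_le_two, ofReal_norm,
    ← Real.norm_eq_abs, ofReal_norm]
  norm_num

/-! ### Estimates for unitary flows and their densities on short intervals. -/

section short

variable {a b : ℝ}

theorem IsFlow.n4_le
    (ha : 0 ≤ a) (hab : a ≤ b) (hb : b ≤ T) (h1 : b - a ≤ 1)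
    (h : IsFlow T V U) (hK : retC (b - a) * n2 a b V ≤ 1 / 2) (x : L2) :
    n4 a b (fun t => U t x) ≤ 2 * strC (b - a) * ‖x‖ₑ :=
  h.prop.n4_le h.memLp h.real ha hab hb h1 hK x

/-- The estimate behind well-posedness at α = 1: the Strichartz norm of `U t (φ k)` is bounded
uniformly in k, and the weights |lₖ| add up to the trace norm. -/
theorem IsFlow.tsum_n4_le
    (ha : 0 ≤ a) (hab : a ≤ b) (hb : b ≤ T) (h1 : b - a ≤ 1)
    (h : IsFlow T V U) (hK : retC (b - a) * n2 a b V ≤ 1 / 2)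
    (hs : IsSpectral A φ l) :
    ∑' k, n4 a b (fun t => (l k : ℂ) • U t (φ k)) * n4 a b (fun t => U t (φ k)) ≤
      4 * strC (b - a) * strC (b - a) * schattenNorm 1 A := by
  rw [hs.norm_eq, ← ENNReal.tsum_mul_left]
  refine ENNReal.tsum_le_tsum fun k => ?_
  have h2 := h.n4_le ha hab hb h1 hK (φ k)
  rw [hs.enorm_eq_one, mul_one] at h2
  rw [n4_smul, enorm_ofReal]
  calc ‖l k‖ₑ * n4 a b (fun t => U t (φ k)) * n4 a b (fun t => U t (φ k))
      ≤ ‖l k‖ₑ * (2 * strC (b - a)) * (2 * strC (b - a)) := by gcongr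
    _ = _ := by ring

/-- The space-time bound is finite, so at almost every time the series of L⁴ products converges and
a density exists. -/
theorem IsFlow.ae_exists_isDensity
    (ha : 0 ≤ a) (hab : a ≤ b) (hb : b ≤ T) (h1 : b - a ≤ 1)
    (h : IsFlow T V U) (hK : retC (b - a) * n2 a b V ≤ 1 / 2)
    (hA : IsSelfAdjoint A) (hfin : schattenNorm 1 A < ⊤) :
    ∀ᵐ t ∂(volume.restrict (Set.Ioc a b)), ∃ ρ : L2, IsDensity (U t * A * star (U t)) ρ := by
  obtain ⟨φ, l, hs⟩ := exists_isSpectral hA hfin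
  have hm : ∀ k, AEStronglyMeasurable (fun t => U t (φ k)) (volume.restrict (Set.Ioc a b)) :=
    fun k => h.aestronglyMeasurable _ ha hb
  have hm' : ∀ k, AEStronglyMeasurable (fun t => (l k : ℂ) • U t (φ k))
      (volume.restrict (Set.Ioc a b)) := fun k => (hm k).const_smul (l k : ℂ)
  have h2 := lintegral_tsum_quart_sq_le hm' hm
  have h3 : (∑' k, n4 a b (fun t => (l k : ℂ) • U t (φ k)) * n4 a b (fun t => U t (φ k))) ^ 2 < ⊤ :=
    ENNReal.pow_lt_top ((h.tsum_n4_le ha hab hb h1 hK hs).trans_lt (by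
      have := strC_lt_top (b - a)
      exact ENNReal.mul_lt_top (ENNReal.mul_lt_top (ENNReal.mul_lt_top (by norm_num) this) this)
        hfin))
  have h4 := ae_lt_top' ((AEMeasurable.tsum fun k =>
    ((aemeasurable_quart (hm' k)).pow_const (1 / 4 : ℝ)).mul
      ((aemeasurable_quart (hm k)).pow_const (1 / 4 : ℝ))).pow_const 2) (h2.trans_lt h3).ne
  filter_upwards [h4, ae_restrict_mem measurableSet_Ioc] with t ht ht'
  refine hs.exists_isDensity (h.isometry ⟨ha.trans ht'.1.le, ht'.2.trans hb⟩) ?_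
  by_contra hc
  rw [not_lt, top_le_iff] at hc
  simp only [Pi.mul_apply, hc] at ht
  simp at ht

theorem IsFlow.n2_density_le
    (ha : 0 ≤ a) (hab : a ≤ b) (hb : b ≤ T) (h1 : b - a ≤ 1)
    (h : IsFlow T V U) (hK : retC (b - a) * n2 a b V ≤ 1 / 2)
    (hA : IsSelfAdjoint A) (hfin : schattenNorm 1 A < ⊤) {ρ : ℝ → L2}
    (hρ : ∀ᵐ t ∂(volume.restrict (Set.Ioc a b)), DensC (U t * A * star (U t)) (ρ t)) :
    n2 a b ρ ≤ 4 * strC (b - a) * strC (b - a) * schattenNorm 1 A := by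
  obtain ⟨φ, l, hs⟩ := exists_isSpectral hA hfin
  refine le_trans ?_ (h.tsum_n4_le ha hab hb h1 hK hs)
  have hm : ∀ k, AEStronglyMeasurable (fun t => U t (φ k)) (volume.restrict (Set.Ioc a b)) :=
    fun k => h.aestronglyMeasurable _ ha hb
  refine n2_le_tsum (A := fun t => U t * A * star (U t)) (fun k => (hm k).const_smul (l k : ℂ)) hm
    (fun t _ => hs.rankOneSum (U t) (U t)) (fun t ht => ?_) hρ
  exact (hs.tsum_conj (h.isometry ⟨ha.trans ht.1.le, ht.2.trans hb⟩)).trans_lt hfin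

/-- With D the distance of the potentials, each of the two families of `rankOneSum_sub` contributes
(4·`retC`·`strC`·D)·(2·`strC`) per unit of weight, and 16 = 2·8. Two equal initial operators leave
the difference of the potentials as the only source. -/
theorem IsFlow.n2_density_sub_le
    (ha : 0 ≤ a) (hab : a ≤ b) (hb : b ≤ T) (h1 : b - a ≤ 1)
    (h : IsFlow T V U) (h' : IsFlow T V' U')
    (hK : retC (b - a) * n2 a b V ≤ 1 / 2) (hK' : retC (b - a) * n2 a b V' ≤ 1 / 2)
    (hUa : U a = U' a) (hA : IsSelfAdjoint A) (hfin : schattenNorm 1 A < ⊤) {ρ : ℝ → L2}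
    (hρ : ∀ᵐ t ∂(volume.restrict (Set.Ioc a b)),
      DensC (U t * A * star (U t) - U' t * A * star (U' t)) (ρ t)) :
    n2 a b ρ ≤ 16 * retC (b - a) * strC (b - a) * strC (b - a) * schattenNorm 1 A *
      n2 a b (fun t => V t - V' t) := by
  obtain ⟨φ, l, hs⟩ := exists_isSpectral hA hfin
  have hm : ∀ k, AEStronglyMeasurable (fun t => U t (φ k)) (volume.restrict (Set.Ioc a b)) :=
    fun k => h.aestronglyMeasurable _ ha hb
  have hm' : ∀ k, AEStronglyMeasurable (fun t => U' t (φ k)) (volume.restrict (Set.Ioc a b)) :=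
    fun k => h'.aestronglyMeasurable _ ha hb
  have hms : ∀ k, AEStronglyMeasurable (fun t => (U t - U' t) (φ k))
      (volume.restrict (Set.Ioc a b)) := fun k => (hm k).sub (hm' k)
  have hmem : ∀ t ∈ Set.Ioc a b, t ∈ Set.Icc 0 T := fun t ht => ⟨ha.trans ht.1.le, ht.2.trans hb⟩
  have key := n2_le_tsum (A := fun t => U t * A * star (U t) - U' t * A * star (U' t))
    (f := Sum.elim (fun k t => (l k : ℂ) • (U t - U' t) (φ k)) (fun k t => (l k : ℂ) • U' t (φ k)))
    (g := Sum.elim (fun k t => U t (φ k)) (fun k t => (U t - U' t) (φ k)))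
    (a := a) (b := b) (ρ := ρ) ?_ ?_ ?_ ?_ hρ
  · refine key.trans ?_
    rw [tsum_sum_elim, ← ENNReal.tsum_add, hs.norm_eq, mul_assoc, ← ENNReal.tsum_mul_right,
      ← ENNReal.tsum_mul_left]
    refine ENNReal.tsum_le_tsum fun k => ?_
    simp only [Sum.elim_inl, Sum.elim_inr]
    rw [n4_smul, n4_smul, enorm_ofReal]
    have e1 := h.n4_le ha hab hb h1 hK (φ k)
    have e2 := h'.n4_le ha hab hb h1 hK' (φ k)
    have e3 := (h.prop.sub_le h.memLp h'.memLp h'.real h'.prop ha hab hb h1 hK hK' hUa (φ k)).1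
    rw [hs.enorm_eq_one, mul_one] at e1 e2 e3
    set S := strC (b - a)
    set K := retC (b - a)
    set D := n2 a b (fun t => V t - V' t)
    have e4 : n4 a b (fun t => (U t - U' t) (φ k)) ≤ 4 * K * S * D := e3
    calc ‖l k‖ₑ * n4 a b (fun t => (U t - U' t) (φ k)) * n4 a b (fun t => U t (φ k)) +
          ‖l k‖ₑ * n4 a b (fun t => U' t (φ k)) * n4 a b (fun t => (U t - U' t) (φ k))
        ≤ ‖l k‖ₑ * (4 * K * S * D) * (2 * S) + ‖l k‖ₑ * (2 * S) * (4 * K * S * D) := by gcongr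
      _ = _ := by ring
  · rintro (k | k)
    · exact (hms k).const_smul (l k : ℂ)
    · exact (hm' k).const_smul (l k : ℂ)
  · rintro (k | k)
    · exact hm k
    · exact hms k
  · intro t ht
    convert! hs.rankOneSum_sub (U t) (U' t) using 1
    · ext1 k; rcases k with k | k <;> rfl
    · ext1 k; rcases k with k | k <;> rfl
  · intro t ht
    rw [tsum_sum_elim]
    simp only [Sum.elim_inl, Sum.elim_inr, enorm_smul, enorm_ofReal]
    have hU1 : ∀ k, ‖U t (φ k)‖ₑ = 1 := fun k => by
      rw [← ofReal_norm, h.isometry (hmem t ht), ofReal_norm, hs.enorm_eq_one]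
    have hU2 : ∀ k, ‖U' t (φ k)‖ₑ = 1 := fun k => by
      rw [← ofReal_norm, h'.isometry (hmem t ht), ofReal_norm, hs.enorm_eq_one]
    have hU3 : ∀ k, ‖(U t - U' t) (φ k)‖ₑ ≤ 2 := fun k => by
      have h3 : ‖U t (φ k) - U' t (φ k)‖ₑ ≤ ‖U t (φ k)‖ₑ + ‖U' t (φ k)‖ₑ := enorm_sub_le
      rw [hU1, hU2, one_add_one_eq_two] at h3
      exact h3
    have hfin' : ∑' k, ‖l k‖ₑ * 2 < ⊤ := by
      rw [ENNReal.tsum_mul_right, ← hs.norm_eq]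
      exact ENNReal.mul_lt_top hfin (by norm_num)
    refine ENNReal.add_lt_top.mpr ⟨lt_of_le_of_lt (ENNReal.tsum_le_tsum fun k => ?_) hfin',
      lt_of_le_of_lt (ENNReal.tsum_le_tsum fun k => ?_) hfin'⟩
    · rw [hU1, mul_one]; gcongr; exact hU3 k
    · rw [hU2, mul_one]; gcongr; exact hU3 k

theorem IsFlow.tsum_sub_le
    (ha : 0 ≤ a) (hab : a ≤ b) (hb : b ≤ T) (h1 : b - a ≤ 1)
    (h : IsFlow T V U) (h' : IsFlow T V' U')
    (hK : retC (b - a) * n2 a b V ≤ 1 / 2) (hK' : retC (b - a) * n2 a b V' ≤ 1 / 2)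
    (hUa : U a = U' a) (hs : IsSpectral A φ l) {t : ℝ} (ht : t ∈ Set.Icc a b) :
    ∑' k, ‖l k‖ₑ * (2 * ‖U t (φ k) - U' t (φ k)‖ₑ) ≤
      32 * schattenNorm 1 A * n2 a b (fun t => V t - V' t) := by
  rw [hs.norm_eq, mul_assoc, ← ENNReal.tsum_mul_right, ← ENNReal.tsum_mul_left]
  refine ENNReal.tsum_le_tsum fun k => ?_
  have e3 := (h.prop.sub_le h.memLp h'.memLp h'.real h'.prop ha hab hb h1 hK hK' hUa (φ k)).2 t ht
  rw [hs.enorm_eq_one, mul_one] at e3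
  calc ‖l k‖ₑ * (2 * ‖U t (φ k) - U' t (φ k)‖ₑ)
      ≤ ‖l k‖ₑ * (2 * (16 * n2 a b (fun t => V t - V' t))) := by gcongr
    _ = _ := by ring

end short

end flow

/-! ### Real parts -/

/-- The real part of a function in `L²(𝕋)`. -/
noncomputable def reL (f : L2) : L2 := (1 / 2 : ℂ) • (f + star f)

theorem reL_ae (f : L2) : (reL f : Circ → ℂ) =ᵐ[volume] fun x => ((f x).re : ℂ) := by
  filter_upwards [Lp.coeFn_smul (1 / 2 : ℂ) (f + star f), Lp.coeFn_add f (star f),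
    Lp.coeFn_star f] with x h1 h2 h3
  rw [reL, h1, Pi.smul_apply, h2, Pi.add_apply, h3, Pi.star_apply, smul_eq_mul, RCLike.star_def,
    Complex.add_conj]
  push_cast
  ring

theorem isRealValued_reL (f : L2) : IsRealValued (reL f) := by
  filter_upwards [reL_ae f] with x hx
  rw [hx, Complex.conj_ofReal]

theorem reL_eq {f : L2} (hf : IsRealValued f) : reL f = f := by
  refine Lp.ext ?_
  filter_upwards [reL_ae f, hf] with x h1 h2
  rw [h1]
  exact Complex.conj_eq_iff_re.mp h2

/-- The fixed-point space consists of complex functions, whereas isometric propagators need real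
potentials. Taking real parts is harmless, as it is 1-Lipschitz and fixes real functions. -/
theorem enorm_reL_sub_le (f g : L2) : ‖reL f - reL g‖ₑ ≤ ‖f - g‖ₑ := by
  rw [Lp.enorm_def, Lp.enorm_def]
  refine eLpNorm_mono_ae ?_
  filter_upwards [Lp.coeFn_sub (reL f) (reL g), Lp.coeFn_sub f g, reL_ae f, reL_ae g] with x
    h1 h2 h3 h4
  rw [h1, h2, Pi.sub_apply, Pi.sub_apply, h3, h4, ← Complex.ofReal_sub, Complex.norm_real,
    ← Complex.sub_re]
  exact Complex.abs_re_le_norm _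

theorem reL_zero : reL 0 = 0 := reL_eq (by
  filter_upwards [Lp.coeFn_zero ℂ 2 (volume : Measure Circ)] with x hx
  rw [hx]; simp)

theorem enorm_reL_le (f : L2) : ‖reL f‖ₑ ≤ ‖f‖ₑ := by
  simpa [reL_zero] using enorm_reL_sub_le f 0

theorem continuous_reL : Continuous reL := by
  have : LipschitzWith 1 reL := fun f g => by
    rw [edist_eq_enorm_sub, edist_eq_enorm_sub, ENNReal.coe_one, one_mul]
    exact enorm_reL_sub_le f g
  exact this.continuous

theorem IsRealValued.smul {f : L2} (hf : IsRealValued f) (r : ℝ) : IsRealValued ((r : ℂ) • f) := by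
  filter_upwards [Lp.coeFn_smul (r : ℂ) f, hf] with x h1 h2
  rw [h1, Pi.smul_apply, smul_eq_mul, map_mul, h2, Complex.conj_ofReal]

theorem memLp_ite {a b : ℝ} {f g : ℝ → L2} (hf : MemLp f 2 (volume.restrict (Set.Ioc 0 a)))
    (hg : MemLp g 2 (volume.restrict (Set.Ioc a b))) :
    MemLp (fun t => if t ≤ a then f t else g t) 2 (volume.restrict (Set.Ioc 0 b)) := by
  have h1 : MemLp f 2 ((volume.restrict (Set.Ioc 0 b)).restrict (Set.Iic a)) := by
    rw [Measure.restrict_restrict measurableSet_Iic]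
    have hs : Set.Iic a ∩ Set.Ioc 0 b ⊆ Set.Ioc 0 a := fun t ht => ⟨ht.2.1, ht.1⟩
    exact hf.mono_measure (Measure.restrict_mono hs le_rfl)
  have h2 : MemLp g 2 ((volume.restrict (Set.Ioc 0 b)).restrict (Set.Iic a)ᶜ) := by
    rw [Measure.restrict_restrict measurableSet_Iic.compl]
    have hs : (Set.Iic a)ᶜ ∩ Set.Ioc 0 b ⊆ Set.Ioc a b := fun t ht => ⟨not_le.mp ht.1, ht.2.2⟩
    exact hg.mono_measure (Measure.restrict_mono hs le_rfl)
  classical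
  convert! MemLp.piecewise measurableSet_Iic h1 h2 using 2

theorem ae_Ioc_of_ae {a b : ℝ} {p : ℝ → Prop}
    (h1 : ∀ᵐ t ∂(volume.restrict (Set.Ioc 0 a)), p t)
    (h2 : ∀ᵐ t ∂(volume.restrict (Set.Ioc a b)), p t) :
    ∀ᵐ t ∂(volume.restrict (Set.Ioc 0 b)), p t := by
  have h3 : ∀ᵐ t ∂(volume.restrict (Set.Ioc 0 a ∪ Set.Ioc a b)), p t := by
    rw [ae_restrict_union_iff]
    exact ⟨h1, h2⟩
  refine ae_restrict_of_ae_restrict_of_subset (fun t ht => ?_) h3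
  rcases le_or_gt t a with h | h
  · exact Or.inl ⟨ht.1, h⟩
  · exact Or.inr ⟨h, ht.2⟩

theorem ae_eq_of_n2_eq_zero {a b : ℝ} {V W : ℝ → L2}
    (hV : AEStronglyMeasurable V (volume.restrict (Set.Ioc a b)))
    (hW : AEStronglyMeasurable W (volume.restrict (Set.Ioc a b)))
    (h : n2 a b (fun t => V t - W t) = 0) :
    ∀ᵐ t ∂(volume.restrict (Set.Ioc a b)), V t = W t := by
  have hm : AEStronglyMeasurable (fun t => V t - W t) (volume.restrict (Set.Ioc a b)) := hV.sub hW
  rw [n2_eq_eLpNorm, eLpNorm_eq_zero_iff hm (by norm_num)] at h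
  filter_upwards [h] with t ht
  exact sub_eq_zero.mp ht

/-! ### Solutions of the density equation -/

/-- `ϱ` is the density of `U γ₀ U*`, where `U` is the propagator with potential `σ ϱ`. -/
structure IsDensityFlow (σ T : ℝ) (γ₀ : Op) (ϱ : ℝ → L2) (U : ℝ → Op) : Prop where
  memLp : MemLp ϱ 2 (volume.restrict (Set.Ioc 0 T))
  flow : IsFlow T (fun t => (σ : ℂ) • ϱ t) U
  density : ∀ᵐ t ∂(volume.restrict (Set.Ioc 0 T)), IsDensity (U t * γ₀ * star (U t)) (ϱ t)

section densityFlow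

variable {σ T : ℝ} {γ₀ : Op} {γ : ℝ → Op} {ϱ ϱ' : ℝ → L2} {U U' : ℝ → Op}

theorem IsSolution.exists_isDensityFlow (hT : 0 ≤ T) (hγ : IsSelfAdjoint γ₀)
    (h : IsSolution σ T γ₀ γ ϱ) :
    ∃ U, IsDensityFlow σ T γ₀ ϱ U ∧ ∀ t ∈ Set.Icc 0 T, γ t = U t * γ₀ * star (U t) := by
  obtain ⟨U, hU, hγU⟩ := h.evolution
  have hm := h.memLp
  have hd := h.density
  rw [timeMeasure_eq] at hm hd
  have hd' : ∀ᵐ t ∂(volume.restrict (Set.Ioc 0 T)), IsDensity (U t * γ₀ * star (U t)) (ϱ t) := by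
    filter_upwards [hd, ae_restrict_mem measurableSet_Ioc] with t h1 h2
    rwa [← hγU t ⟨h2.1.le, h2.2⟩]
  refine ⟨U, ⟨hm, ⟨hT, hm.const_smul (σ : ℂ), ?_, hU⟩, hd'⟩, hγU⟩
  filter_upwards [hd'] with t ht
  exact (ht.densC.isRealValued (hγ.conjugate (U t))).smul σ

theorem IsDensityFlow.isSolution (hγ : IsSelfAdjoint γ₀) (hfin : schattenNorm 1 γ₀ < ⊤)
    (h : IsDensityFlow σ T γ₀ ϱ U) :
    IsSolution σ T γ₀ (fun t => U t * γ₀ * star (U t)) ϱ where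
  continuous := h.flow.schattenContinuous hγ hfin
  memLp := by rw [timeMeasure_eq]; exact h.memLp
  density := by rw [timeMeasure_eq]; exact h.density
  evolution := ⟨U, h.flow.prop, fun _ _ => rfl⟩

theorem IsDensityFlow.mono {T' : ℝ} (h : IsDensityFlow σ T γ₀ ϱ U) (h0 : 0 ≤ T') (hT : T' ≤ T) :
    IsDensityFlow σ T' γ₀ ϱ U :=
  ⟨memLp_sub_interval h.memLp le_rfl hT, h.flow.mono h0 hT, ae_sub_interval h.density le_rfl hT⟩

theorem isDensityFlow_zero (σ : ℝ) (γ₀ : Op) : ∃ U, IsDensityFlow σ 0 γ₀ 0 U := by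
  have hr : ∀ᵐ t ∂(volume.restrict (Set.Ioc (0 : ℝ) 0)), IsRealValued ((fun _ => 0 : ℝ → L2) t) := by
    simp
  obtain ⟨U, hU⟩ := exists_isPropagator (V := fun _ => 0) le_rfl MemLp.zero' hr
  refine ⟨U, MemLp.zero, ⟨le_rfl, ?_, ?_, ?_⟩, by simp⟩
  · simp
  · simp
  · simpa using hU

theorem n2_smul_sign (hσ : σ = 1 ∨ σ = -1) (a b : ℝ) (V : ℝ → L2) :
    n2 a b (fun t => (σ : ℂ) • V t) = n2 a b V := by
  have : ‖(σ : ℂ)‖ₑ = 1 := by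
    rw [enorm_ofReal]
    rcases hσ with rfl | rfl <;> simp
  rw [n2_smul, this, one_mul]

theorem n2_smul_sub_sign (hσ : σ = 1 ∨ σ = -1) (a b : ℝ) (V W : ℝ → L2) :
    n2 a b (fun t => (σ : ℂ) • V t - (σ : ℂ) • W t) = n2 a b fun t => V t - W t := by
  simp only [← smul_sub]
  exact n2_smul_sign hσ a b fun t => V t - W t

theorem eq_zero_of_le_half_mul {x : ℝ≥0∞} (h : x ≤ 1 / 2 * x) (hx : x < ⊤) : x = 0 := by
  by_contra h0
  have : 1 / 2 * x < x := by
    rw [one_div, mul_comm, ← div_eq_mul_inv]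
    exact ENNReal.half_lt_self h0 hx.ne
  exact absurd h (not_le.mpr this)

/-- The propagation and contraction estimates hold on time intervals of length at most `h` for
trace norms up to `R`. -/
structure IsShort (R : ℝ≥0∞) (M : ℝ≥0∞) (h : ℝ) : Prop where
  pos : 0 < h
  le_one : h ≤ 1
  pot : ∀ h' ∈ Set.Icc 0 h, retC h' * M ≤ 1 / 2
  bound : ∀ h' ∈ Set.Icc 0 h, 4 * strC h' * strC h' * R ≤ 1
  contr : ∀ h' ∈ Set.Icc 0 h, 16 * retC h' * strC h' * strC h' * R ≤ 1 / 2

theorem exists_isShort {R M : ℝ≥0∞} (hR : R < ⊤) (hM : M < ⊤) : ∃ h, IsShort R M h := by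
  have hmul : ∀ {f g : ℝ → ℝ≥0∞}, Tendsto f (𝓝 0) (𝓝 0) → Tendsto g (𝓝 0) (𝓝 0) →
      Tendsto (fun h => f h * g h) (𝓝 0) (𝓝 0) := by
    intro f g hf hg
    have := ENNReal.Tendsto.mul hf (Or.inr ENNReal.zero_ne_top) hg (Or.inr ENNReal.zero_ne_top)
    rwa [mul_zero] at this
  have hc : ∀ {f : ℝ → ℝ≥0∞} {c : ℝ≥0∞}, c ≠ ⊤ → Tendsto f (𝓝 0) (𝓝 0) →
      Tendsto (fun h => c * f h) (𝓝 0) (𝓝 0) := by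
    intro f c hc hf
    have := ENNReal.Tendsto.const_mul hf (Or.inr hc)
    rwa [mul_zero] at this
  have h2 : Tendsto (fun h => 4 * strC h * strC h) (𝓝 0) (𝓝 0) :=
    hmul (hc (by norm_num) tendsto_strC) tendsto_strC
  have h3 : Tendsto (fun h => 16 * retC h * strC h * strC h) (𝓝 0) (𝓝 0) :=
    hmul (hmul (hc (by norm_num) tendsto_retC) tendsto_strC) tendsto_strC
  obtain ⟨a, ha, ha1, ha2⟩ := exists_small_step tendsto_retC (ε := 1 / 2) (by norm_num) hM
  obtain ⟨b, hb, hb1, hb2⟩ := exists_small_step h2 (ε := 1) (by norm_num) hR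
  obtain ⟨c, hc, hc1, hc2⟩ := exists_small_step h3 (ε := 1 / 2) (by norm_num) hR
  refine ⟨min a (min b c), by positivity, (min_le_left _ _).trans ha1, ?_, ?_, ?_⟩
  · exact fun h' hh => ha2 h' hh.1 (hh.2.trans (min_le_left _ _))
  · exact fun h' hh => hb2 h' hh.1 (hh.2.trans ((min_le_right _ _).trans (min_le_left _ _)))
  · exact fun h' hh => hc2 h' hh.1 (hh.2.trans ((min_le_right _ _).trans (min_le_right _ _)))

/-- Uniqueness of the solution. -/
theorem IsDensityFlow.unique (hσ : σ = 1 ∨ σ = -1) (hγ : IsSelfAdjoint γ₀)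
    (hfin : schattenNorm 1 γ₀ < ⊤) (h : IsDensityFlow σ T γ₀ ϱ U)
    (h' : IsDensityFlow σ T γ₀ ϱ' U') :
    (∀ t ∈ Set.Icc 0 T, U t = U' t) ∧ ∀ᵐ t ∂(volume.restrict (Set.Ioc 0 T)), ϱ t = ϱ' t := by
  have hT := h.flow.nonneg
  obtain ⟨d, hd⟩ := exists_isShort hfin
    (max_lt (n2_lt_top h.memLp) (n2_lt_top h'.memLp))
  have key := step_induction (T := T) (h := d)
    (P := fun t => (∀ s ∈ Set.Icc 0 t, U s = U' s) ∧
      ∀ᵐ s ∂(volume.restrict (Set.Ioc 0 t)), ϱ s = ϱ' s) hd.pos ?_ ?_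
  · exact key T ⟨hT, le_rfl⟩
  · refine ⟨fun s hs => ?_, by simp⟩
    obtain rfl : s = 0 := le_antisymm hs.2 hs.1
    rw [h.flow.prop.zero hT, h'.flow.prop.zero hT]
  · rintro s t hs hst ht hd' ⟨hU, hϱ⟩
    have hts : t - s ∈ Set.Icc 0 d := ⟨by linarith, hd'⟩
    have h1 : t - s ≤ 1 := hd'.trans hd.le_one
    have hK : retC (t - s) * n2 s t (fun r => (σ : ℂ) • ϱ r) ≤ 1 / 2 := by
      refine le_trans ?_ (hd.pot _ hts)
      rw [n2_smul_sign hσ]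
      gcongr
      exact (n2_mono hs ht ϱ).trans (le_max_left _ _)
    have hK' : retC (t - s) * n2 s t (fun r => (σ : ℂ) • ϱ' r) ≤ 1 / 2 := by
      refine le_trans ?_ (hd.pot _ hts)
      rw [n2_smul_sign hσ]
      gcongr
      exact (n2_mono hs ht ϱ').trans (le_max_right _ _)
    have hUs : U s = U' s := hU s ⟨hs, le_rfl⟩
    have hdens : ∀ᵐ r ∂(volume.restrict (Set.Ioc s t)),
        DensC (U r * γ₀ * star (U r) - U' r * γ₀ * star (U' r)) (ϱ r - ϱ' r) := by
      filter_upwards [ae_sub_interval h.density hs ht, ae_sub_interval h'.density hs ht] with r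
        h2 h3
      exact h2.densC.sub h3.densC
    have hm := memLp_sub_interval h.memLp hs ht
    have hm' := memLp_sub_interval h'.memLp hs ht
    have hD := h.flow.n2_density_sub_le hs hst ht h1 h'.flow hK hK' hUs hγ hfin hdens
    rw [n2_smul_sub_sign hσ] at hD
    -- The distance of the densities is finite and at most half of itself.
    have hD0 : n2 s t (fun r => ϱ r - ϱ' r) = 0 := by
      refine eq_zero_of_le_half_mul (hD.trans ?_) (n2_lt_top (hm.sub hm'))
      gcongr
      exact hd.contr _ hts
    refine ⟨fun r hr => ?_, ae_Ioc_of_ae hϱ (ae_eq_of_n2_eq_zero hm.1 hm'.1 hD0)⟩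
    rcases le_or_gt r s with hrs | hrs
    · exact hU r ⟨hr.1, hrs⟩
    · ext1 x
      have h2 := (h.flow.prop.sub_le h.flow.memLp h'.flow.memLp h'.flow.real h'.flow.prop hs hst ht
        h1 hK hK' hUs x).2 r ⟨hrs.le, hr.2⟩
      rw [n2_smul_sub_sign hσ, hD0, mul_zero, zero_mul] at h2
      exact sub_eq_zero.mp (enorm_eq_zero.mp (le_antisymm h2 bot_le))

end densityFlow

/-! ### Construction of solutions by contraction and their continuation to all times. -/

section existence

variable {σ T : ℝ} {γ₀ γ₀' : Op} {ϱ ϱ' : ℝ → L2} {U U' : ℝ → Op}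

theorem IsFlow.aestronglyMeasurable_conj {V : ℝ → L2} (h : IsFlow T V U) (hγ : IsSelfAdjoint γ₀)
    (hfin : schattenNorm 1 γ₀ < ⊤) {a b : ℝ} (ha : 0 ≤ a) (hb : b ≤ T) (x y : L2) :
    AEStronglyMeasurable (fun t => inner ℂ x ((U t * γ₀ * star (U t)) y))
      (volume.restrict (Set.Ioc a b)) := by
  obtain ⟨φ, l, hs⟩ := exists_isSpectral hγ hfin
  refine aestronglyMeasurable_of_tendsto_ae (atTop : Filter (Finset ℕ))
    (f := fun F t => ∑ k ∈ F, inner ℂ x ((l k : ℂ) • U t (φ k)) * inner ℂ (U t (φ k)) y)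
    (fun F => ?_) (Eventually.of_forall fun t => hs.rankOneSum (U t) (U t) x y)
  refine Finset.aestronglyMeasurable_fun_sum F fun k _ => ?_
  have hm := h.aestronglyMeasurable (φ k) ha hb
  exact (aestronglyMeasurable_const.inner (hm.const_smul (l k : ℂ))).mul
    (hm.inner aestronglyMeasurable_const)

theorem IsFlow.exists_density {V : ℝ → L2} (h : IsFlow T V U) (hγ : IsSelfAdjoint γ₀)
    (hfin : schattenNorm 1 γ₀ < ⊤) {a b : ℝ} (ha : 0 ≤ a) (hab : a ≤ b) (hb : b ≤ T)
    (h1 : b - a ≤ 1) (hK : retC (b - a) * n2 a b V ≤ 1 / 2) :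
    ∃ τ : ℝ → L2, MemLp τ 2 (volume.restrict (Set.Ioc a b)) ∧
      ∀ᵐ t ∂(volume.restrict (Set.Ioc a b)), IsDensity (U t * γ₀ * star (U t)) (τ t) := by
  have h2 := h.ae_exists_isDensity ha hab hb h1 hK hγ hfin
  have h3 : ∀ t, ∃ ρ : L2, (∃ ρ' : L2, IsDensity (U t * γ₀ * star (U t)) ρ') →
      IsDensity (U t * γ₀ * star (U t)) ρ := fun t => by
    by_cases h : ∃ ρ' : L2, IsDensity (U t * γ₀ * star (U t)) ρ'
    · exact ⟨h.choose, fun _ => h.choose_spec⟩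
    · exact ⟨0, fun h' => absurd h' h⟩
  choose τ hτ using h3
  have h4 : ∀ᵐ t ∂(volume.restrict (Set.Ioc a b)), IsDensity (U t * γ₀ * star (U t)) (τ t) := by
    filter_upwards [h2] with t ht
    exact hτ t ht
  have h5 : ∀ᵐ t ∂(volume.restrict (Set.Ioc a b)), DensC (U t * γ₀ * star (U t)) (τ t) := by
    filter_upwards [h4] with t ht
    exact ht.densC
  refine ⟨τ, ⟨aestronglyMeasurable_of_densC (h.aestronglyMeasurable_conj hγ hfin ha hb) h5, ?_⟩, h4⟩
  rw [← n2_eq_eLpNorm]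
  refine (h.n2_density_le ha hab hb h1 hK hγ hfin h5).trans_lt ?_
  have := strC_lt_top (b - a)
  exact ENNReal.mul_lt_top (ENNReal.mul_lt_top (ENNReal.mul_lt_top (by norm_num) this) this) hfin

theorem n2_Lp (a b : ℝ) (ρ : Lp L2 2 (volume.restrict (Set.Ioc a b))) : n2 a b ρ = ‖ρ‖ₑ := by
  rw [n2_eq_eLpNorm, Lp.enorm_def]

theorem n2_Lp_sub (a b : ℝ) (ρ τ : Lp L2 2 (volume.restrict (Set.Ioc a b))) :
    n2 a b (fun t => ρ t - τ t) = ‖ρ - τ‖ₑ := by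
  rw [← n2_Lp]
  refine n2_congr ?_
  filter_upwards [Lp.coeFn_sub ρ τ] with t ht
  rw [ht, Pi.sub_apply]

/-- Continuation of a solution by a time that depends on the trace norm only. -/
theorem IsDensityFlow.extend (hσ : σ = 1 ∨ σ = -1) (hγ : IsSelfAdjoint γ₀) {R : ℝ≥0∞} (hR : R < ⊤)
    (hγR : schattenNorm 1 γ₀ ≤ R) {h a : ℝ} (hh : IsShort R 1 h) (hU : IsDensityFlow σ a γ₀ ϱ U) :
    ∃ ϱ' U', IsDensityFlow σ (a + h) γ₀ ϱ' U' ∧ n2 a (a + h) ϱ' ≤ 1 := by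
  have hfin : schattenNorm 1 γ₀ < ⊤ := hγR.trans_lt hR
  have ha := hU.flow.nonneg
  have hh0 := hh.pos.le
  set b := a + h with hb
  have hab : a ≤ b := by linarith
  have hba : b - a = h := by linarith
  have hmem : b - a ∈ Set.Icc 0 h := ⟨by linarith, hba.le⟩
  have h1 : b - a ≤ 1 := hba.le.trans hh.le_one
  set X := Lp L2 2 (volume.restrict (Set.Ioc a b))
  -- The candidate potential agrees with the given one up to time a and is made real afterwards. Its
  -- propagator starts at time 0, so the density is still that of U γ₀ U* with the original γ₀, and
  -- no flow with a shifted origin is needed.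
  let V : X → ℝ → L2 := fun ρ t => if t ≤ a then (σ : ℂ) • ϱ t else (σ : ℂ) • reL (ρ t)
  have hVlow : ∀ ρ t, t ≤ a → V ρ t = (σ : ℂ) • ϱ t := fun ρ t ht => if_pos ht
  have hVhigh : ∀ ρ t, t ∈ Set.Ioc a b → V ρ t = (σ : ℂ) • reL (ρ t) := fun ρ t ht =>
    if_neg (not_le.mpr ht.1)
  have hVm : ∀ ρ, MemLp (V ρ) 2 (volume.restrict (Set.Ioc 0 b)) := by
    intro ρ
    refine memLp_ite (hU.memLp.const_smul (σ : ℂ)) (MemLp.const_smul ?_ (σ : ℂ))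
    refine (Lp.memLp ρ).mono (continuous_reL.comp_aestronglyMeasurable (Lp.aestronglyMeasurable ρ))
      (Eventually.of_forall fun t => ?_)
    have := enorm_reL_le (ρ t)
    rwa [enorm_le_iff_norm_le] at this
  have hVr : ∀ ρ, ∀ᵐ t ∂(volume.restrict (Set.Ioc 0 b)), IsRealValued (V ρ t) := by
    intro ρ
    refine ae_Ioc_of_ae (a := a) ?_ ?_
    · filter_upwards [hU.flow.real, ae_restrict_mem measurableSet_Ioc] with t h2 h3
      rwa [hVlow ρ t h3.2]
    · filter_upwards [ae_restrict_mem measurableSet_Ioc] with t h3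
      rw [hVhigh ρ t h3]
      exact (isRealValued_reL _).smul σ
  choose W hW using fun ρ => exists_isPropagator (ha.trans hab) (hVm ρ) (hVr ρ)
  have hF : ∀ ρ, IsFlow b (V ρ) (W ρ) := fun ρ => ⟨ha.trans hab, hVm ρ, hVr ρ, hW ρ⟩
  have hWU : ∀ ρ, ∀ t ∈ Set.Icc 0 a, W ρ t = U t := by
    intro ρ t ht
    refine (((hF ρ).mono ha hab).congr_potential ?_).unique hU.flow ht
    filter_upwards [ae_restrict_mem measurableSet_Ioc] with s hs
    exact hVlow ρ s hs.2
  have hWa : ∀ ρ τ, W ρ a = W τ a := fun ρ τ => by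
    rw [hWU ρ a ⟨ha, le_rfl⟩, hWU τ a ⟨ha, le_rfl⟩]
  have hV1 : ∀ ρ : X, n2 a b (V ρ) ≤ ‖ρ‖ₑ := by
    intro ρ
    rw [← n2_Lp]
    refine ENNReal.rpow_le_rpow (setLIntegral_mono' measurableSet_Ioc fun t ht => ?_) (by norm_num)
    rw [hVhigh ρ t ht]
    have : ‖(σ : ℂ) • reL (ρ t)‖ₑ ≤ ‖ρ t‖ₑ := by
      have h2 : ‖(σ : ℂ)‖ₑ = 1 := by
        rw [enorm_ofReal]
        rcases hσ with rfl | rfl <;> simp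
      rw [enorm_smul, h2, one_mul]
      exact enorm_reL_le _
    gcongr
  have hVD : ∀ ρ τ : X, n2 a b (fun t => V ρ t - V τ t) ≤ ‖ρ - τ‖ₑ := by
    intro ρ τ
    rw [← n2_Lp_sub, ← n2_smul_sub_sign hσ a b ρ τ]
    refine ENNReal.rpow_le_rpow (setLIntegral_mono' measurableSet_Ioc fun t ht => ?_) (by norm_num)
    change ‖V ρ t - V τ t‖ₑ ^ 2 ≤ ‖(σ : ℂ) • ρ t - (σ : ℂ) • τ t‖ₑ ^ 2
    rw [hVhigh ρ t ht, hVhigh τ t ht, ← smul_sub, ← smul_sub, enorm_smul, enorm_smul]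
    have := enorm_reL_sub_le (ρ t) (τ t)
    gcongr
  have hK : ∀ ρ : X, ‖ρ‖ₑ ≤ 1 → retC (b - a) * n2 a b (V ρ) ≤ 1 / 2 := fun ρ hρ =>
    le_trans (by gcongr; exact (hV1 ρ).trans hρ) (hh.pot _ hmem)
  -- Outside the unit ball Φ gets the dummy value 0; the fixed-point argument takes place inside the
  -- ball.
  have hΦ : ∀ ρ : X, ∃ τ : X, ‖ρ‖ₑ ≤ 1 →
      ∀ᵐ t ∂(volume.restrict (Set.Ioc a b)), IsDensity (W ρ t * γ₀ * star (W ρ t)) (τ t) := by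
    intro ρ
    by_cases hρ : ‖ρ‖ₑ ≤ 1
    · obtain ⟨τ, hτ, hd⟩ := (hF ρ).exists_density hγ hfin ha hab le_rfl h1 (hK ρ hρ)
      refine ⟨hτ.toLp, fun _ => ?_⟩
      filter_upwards [hd, hτ.coeFn_toLp] with t h2 h3
      rwa [h3]
    · exact ⟨0, fun h => absurd h hρ⟩
  choose Φ hΦ using hΦ
  have hC : ∀ ρ : X, ‖ρ‖ₑ ≤ 1 →
      ∀ᵐ t ∂(volume.restrict (Set.Ioc a b)), DensC (W ρ t * γ₀ * star (W ρ t)) (Φ ρ t) := by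
    intro ρ hρ
    filter_upwards [hΦ ρ hρ] with t ht
    exact ht.densC
  let s : Set X := {ρ | ‖ρ‖ₑ ≤ 1}
  have hs : IsComplete s := (isClosed_le continuous_enorm continuous_const).isComplete
  have hmaps : Set.MapsTo Φ s s := by
    intro ρ hρ
    change ‖Φ ρ‖ₑ ≤ 1
    rw [← n2_Lp]
    refine ((hF ρ).n2_density_le ha hab le_rfl h1 (hK ρ hρ) hγ hfin (hC ρ hρ)).trans
      (le_trans ?_ (hh.bound _ hmem))
    gcongr
  -- All candidate flows coincide at time a, so only the potentials on (a, b] are compared, and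
  -- `IsShort.contr` supplies the factor 1/2.
  have hcontr : ContractingWith (1 / 2) (hmaps.restrict Φ s s) := by
    refine ⟨by rw [← NNReal.coe_lt_coe]; norm_num, fun ρ τ => ?_⟩
    rw [Subtype.edist_eq, Subtype.edist_eq, edist_eq_enorm_sub, edist_eq_enorm_sub]
    change ‖Φ ρ.1 - Φ τ.1‖ₑ ≤ _
    rw [← n2_Lp_sub]
    refine ((hF ρ.1).n2_density_sub_le ha hab le_rfl h1 (hF τ.1) (hK ρ.1 ρ.2) (hK τ.1 τ.2)
      (hWa _ _) hγ hfin ?_).trans ?_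
    · filter_upwards [hC ρ.1 ρ.2, hC τ.1 τ.2] with t h2 h3
      exact h2.sub h3
    · have h2 : ((1 / 2 : ℝ≥0) : ℝ≥0∞) = 1 / 2 := by
        rw [one_div, ENNReal.coe_inv (by norm_num)]; norm_num
      rw [h2]
      refine mul_le_mul' (le_trans ?_ (hh.contr _ hmem)) (hVD _ _)
      gcongr
  obtain ⟨ρ, hρs, hρ, -⟩ := hcontr.exists_fixedPoint' hs hmaps (x := 0) (by simp [s])
    (by rw [edist_eq_enorm_sub]; exact enorm_ne_top)
  have hρ1 : ‖ρ‖ₑ ≤ 1 := hρs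
  have hfix : Φ ρ = ρ := hρ
  have hd := hΦ ρ hρ1
  rw [hfix] at hd
  refine ⟨fun t => if t ≤ a then ϱ t else ρ t, W ρ, ⟨memLp_ite hU.memLp (Lp.memLp ρ), ?_, ?_⟩, ?_⟩
  -- At the fixed point ρ is the density of a self-adjoint operator, hence real, and `reL` can be
  -- removed.
  · refine (hF ρ).congr_potential (ae_Ioc_of_ae (a := a) ?_ ?_)
    · filter_upwards [ae_restrict_mem measurableSet_Ioc] with t ht
      rw [hVlow ρ t ht.2, if_pos ht.2]
    · filter_upwards [hd, ae_restrict_mem measurableSet_Ioc] with t h2 ht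
      rw [hVhigh ρ t ht, if_neg (not_le.mpr ht.1),
        reL_eq (h2.densC.isRealValued (hγ.conjugate (W ρ t)))]
  · refine ae_Ioc_of_ae (a := a) ?_ ?_
    · filter_upwards [hU.density, ae_restrict_mem measurableSet_Ioc] with t h2 ht
      rwa [if_pos ht.2, hWU ρ t ⟨ht.1.le, ht.2⟩]
    · filter_upwards [hd, ae_restrict_mem measurableSet_Ioc] with t h2 ht
      rwa [if_neg (not_le.mpr ht.1)]
  · refine le_trans (le_of_eq (n2_congr (W := ρ) ?_)) ((n2_Lp a b ρ).le.trans hρ1)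
    filter_upwards [ae_restrict_mem measurableSet_Ioc] with t ht
    rw [if_neg (not_le.mpr ht.1)]

/-- Each continuation lasts a time h fixed by the trace norm of γ₀ alone, whatever the time already
reached. Finitely many equal steps therefore cover [0, T]. -/
theorem exists_isDensityFlow (hσ : σ = 1 ∨ σ = -1) (hγ : IsSelfAdjoint γ₀)
    (hfin : schattenNorm 1 γ₀ < ⊤) (hT : 0 ≤ T) : ∃ ϱ U, IsDensityFlow σ T γ₀ ϱ U := by
  obtain ⟨h, hh⟩ := exists_isShort hfin ENNReal.one_lt_top
  have key : ∀ n : ℕ, ∃ ϱ U, IsDensityFlow σ (n * h) γ₀ ϱ U := by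
    intro n
    induction n with
    | zero =>
      obtain ⟨U, hU⟩ := isDensityFlow_zero σ γ₀
      exact ⟨0, U, by simpa using hU⟩
    | succ n ih =>
      obtain ⟨ϱ, U, hU⟩ := ih
      obtain ⟨ϱ', U', hU', -⟩ := hU.extend hσ hγ hfin le_rfl hh
      refine ⟨ϱ', U', ?_⟩
      rw [show ((n + 1 : ℕ) : ℝ) * h = n * h + h by push_cast; ring]
      exact hU'
  obtain ⟨n, hn⟩ := exists_nat_ge (T / h)
  obtain ⟨ϱ, U, hU⟩ := key n
  exact ⟨ϱ, U, hU.mono hT (by rwa [div_le_iff₀ hh.pos] at hn)⟩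

/-- Global existence. -/
theorem exists_global (hσ : σ = 1 ∨ σ = -1) (hγ : IsSelfAdjoint γ₀)
    (hfin : schattenNorm 1 γ₀ < ⊤) : ∃ ϱ U, ∀ T : ℝ, 0 < T → IsDensityFlow σ T γ₀ ϱ U := by
  choose ϱ U hU using fun n : ℕ => exists_isDensityFlow (σ := σ) hσ hγ hfin (Nat.cast_nonneg n)
  -- At time t the solution on [0, ⌈t⌉] is used; by uniqueness these glue to the restriction of any
  -- solution on a longer interval.
  refine ⟨fun t => ϱ ⌈t⌉₊ t, fun t => U ⌈t⌉₊ t, fun T hT => ?_⟩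
  obtain ⟨N, hN⟩ := exists_nat_ge T
  have huniq : ∀ n ≤ N, (∀ t ∈ Set.Icc (0 : ℝ) n, U n t = U N t) ∧
      ∀ᵐ t ∂(volume.restrict (Set.Ioc (0 : ℝ) n)), ϱ n t = ϱ N t := fun n hn =>
    (hU n).unique hσ hγ hfin ((hU N).mono (Nat.cast_nonneg n) (by exact_mod_cast hn))
  have hceil : ∀ t ≤ T, ⌈t⌉₊ ≤ N := fun t ht => Nat.ceil_le.mpr (ht.trans hN)
  have hϱ : ∀ᵐ t ∂(volume.restrict (Set.Ioc (0 : ℝ) T)), ϱ N t = ϱ ⌈t⌉₊ t := by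
    have h1 : ∀ᵐ t : ℝ, ∀ n : ℕ, n ≤ N → t ∈ Set.Ioc (0 : ℝ) n → ϱ n t = ϱ N t := by
      rw [ae_all_iff]
      intro n
      by_cases hn : n ≤ N
      · have h2 := (ae_restrict_iff' measurableSet_Ioc).mp (huniq n hn).2
        filter_upwards [h2] with t ht _ ht'
        exact ht ht'
      · exact Eventually.of_forall fun t h => absurd h hn
    filter_upwards [ae_restrict_of_ae h1, ae_restrict_mem measurableSet_Ioc] with t h2 ht
    exact (h2 ⌈t⌉₊ (hceil t ht.2) ⟨ht.1, Nat.le_ceil t⟩).symm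
  have hUt : ∀ t ∈ Set.Icc 0 T, U ⌈t⌉₊ t = U N t := fun t ht =>
    (huniq ⌈t⌉₊ (hceil t ht.2)).1 t ⟨ht.1, Nat.le_ceil t⟩
  have hN' := (hU N).mono hT.le hN
  have hflow : IsFlow T (fun t => (σ : ℂ) • ϱ ⌈t⌉₊ t) (U N) := by
    refine hN'.flow.congr_potential ?_
    filter_upwards [hϱ] with t ht
    rw [ht]
  refine ⟨hN'.memLp.ae_eq hϱ, ⟨hT.le, hflow.memLp, hflow.real, hflow.prop.congr hT.le hUt⟩, ?_⟩
  filter_upwards [hN'.density, hϱ, ae_restrict_mem measurableSet_Ioc] with t h1 h2 ht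
  rw [← h2, hUt t ⟨ht.1.le, ht.2⟩]
  exact h1

end existence

/-! ### Well-posedness -/

section wellPosed

variable {σ T : ℝ} {γ₀ γ₀' : Op} {γ γ' : ℝ → Op} {ϱ ϱ' : ℝ → L2} {U U' : ℝ → Op}

theorem exists_isDensityFlow_short (hσ : σ = 1 ∨ σ = -1) (hγ : IsSelfAdjoint γ₀) {R : ℝ≥0∞}
    (hR : R < ⊤) (hγR : schattenNorm 1 γ₀ ≤ R) (hT : IsShort R 1 T) :
    ∃ ϱ U, IsDensityFlow σ T γ₀ ϱ U ∧ n2 0 T ϱ ≤ 1 := by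
  obtain ⟨U, hU⟩ := isDensityFlow_zero σ γ₀
  obtain ⟨ϱ, U', h⟩ := hU.extend hσ hγ hR hγR hT
  rw [zero_add] at h
  exact ⟨ϱ, U', h⟩

/-- By uniqueness the solution is the one found in the unit ball. This a priori bound makes the
smallness conditions of the difference estimates available for arbitrary solutions. -/
theorem IsDensityFlow.n2_le_one (hσ : σ = 1 ∨ σ = -1) (hγ : IsSelfAdjoint γ₀) {R : ℝ≥0∞}
    (hR : R < ⊤) (hγR : schattenNorm 1 γ₀ ≤ R) (hT : IsShort R 1 T)
    (h : IsDensityFlow σ T γ₀ ϱ U) : n2 0 T ϱ ≤ 1 := by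
  obtain ⟨ϱ', U', h', h1⟩ := exists_isDensityFlow_short hσ hγ hR hγR hT
  rwa [n2_congr (h.unique hσ hγ (hγR.trans_lt hR) h').2]

/-- Lipschitz dependence on the initial value. -/
theorem IsDensityFlow.lipschitz (hσ : σ = 1 ∨ σ = -1) (hγ : IsSelfAdjoint γ₀)
    (hγ' : IsSelfAdjoint γ₀') {R : ℝ≥0∞} (hR : R < ⊤) (hγR : schattenNorm 1 γ₀ ≤ R)
    (hγR' : schattenNorm 1 γ₀' ≤ R) (hT : IsShort R 1 T) (h : IsDensityFlow σ T γ₀ ϱ U)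
    (h' : IsDensityFlow σ T γ₀' ϱ' U') (hδ : schattenNorm 1 (γ₀ - γ₀') < ⊤) :
    n2 0 T (fun t => ϱ t - ϱ' t) ≤ 32 * schattenNorm 1 (γ₀ - γ₀') ∧
    ∀ t ∈ Set.Icc 0 T, schattenNorm 1 (U t * γ₀ * star (U t) - U' t * γ₀' * star (U' t)) ≤
      (1 + 1024 * R) * schattenNorm 1 (γ₀ - γ₀') := by
  have hT0 := hT.pos.le
  have hmem : T - 0 ∈ Set.Icc 0 T := by rw [sub_zero]; exact ⟨hT0, le_rfl⟩
  have hT1 : T - 0 ≤ 1 := by rw [sub_zero]; exact hT.le_one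
  have hsa : IsSelfAdjoint (γ₀ - γ₀') := hγ.sub hγ'
  have hfin' : schattenNorm 1 γ₀' < ⊤ := hγR'.trans_lt hR
  have hK : retC (T - 0) * n2 0 T (fun t => (σ : ℂ) • ϱ t) ≤ 1 / 2 := by
    rw [n2_smul_sign hσ]
    exact le_trans (by gcongr; exact h.n2_le_one hσ hγ hR hγR hT) (hT.pot _ hmem)
  have hK' : retC (T - 0) * n2 0 T (fun t => (σ : ℂ) • ϱ' t) ≤ 1 / 2 := by
    rw [n2_smul_sign hσ]
    exact le_trans (by gcongr; exact h'.n2_le_one hσ hγ' hR hγR' hT) (hT.pot _ hmem)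
  have hU0 : U 0 = U' 0 := by rw [h.flow.prop.zero hT0, h'.flow.prop.zero hT0]
  -- The change of data is carried by one flow, and the change of flow acts on one datum. The first
  -- part has a density τ bounded by the distance of the data, the second one a density bounded by
  -- half the distance of the solutions.
  have hsplit : ∀ B C : Op, B * γ₀ * star B - C * γ₀' * star C =
      B * (γ₀ - γ₀') * star B + (B * γ₀' * star B - C * γ₀' * star C) := fun B C => by
    noncomm_ring
  obtain ⟨τ, hτ, hτd⟩ := h.flow.exists_density hsa hδ le_rfl hT0 le_rfl hT1 hK
  have hτC : ∀ᵐ t ∂(volume.restrict (Set.Ioc 0 T)),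
      DensC (U t * (γ₀ - γ₀') * star (U t)) (τ t) := by
    filter_upwards [hτd] with t ht
    exact ht.densC
  have hrem : ∀ᵐ t ∂(volume.restrict (Set.Ioc 0 T)),
      DensC (U t * γ₀' * star (U t) - U' t * γ₀' * star (U' t)) ((ϱ t - ϱ' t) - τ t) := by
    filter_upwards [h.density, h'.density, hτC] with t h1 h2 h3
    have h4 := (h1.densC.sub h2.densC).sub h3
    rwa [hsplit (U t) (U' t), add_sub_cancel_left] at h4
  have e1 := h.flow.n2_density_le le_rfl hT0 le_rfl hT1 hK hsa hδ hτC
  have e2 := h.flow.n2_density_sub_le le_rfl hT0 le_rfl hT1 h'.flow hK hK' hU0 hγ' hfin' hrem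
  rw [n2_smul_sub_sign hσ] at e2
  have hm := h.memLp.sub h'.memLp
  have e3 : n2 0 T (fun t => ϱ t - ϱ' t) ≤ 2 * (16 * schattenNorm 1 (γ₀ - γ₀')) := by
    have hS : strC (T - 0) ≤ 2 := strC_le_two hmem.1 hT1
    -- The half is absorbed; the 16 is 4·`strC`² with `strC` ≤ 2.
    refine le_two_mul_of_le_add (K := 1 / 2) (n2_lt_top hm) le_rfl ?_
    calc n2 0 T (fun t => ϱ t - ϱ' t) = n2 0 T (fun t => τ t + ((ϱ t - ϱ' t) - τ t)) := by
          simp only [add_sub_cancel]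
      _ ≤ n2 0 T τ + n2 0 T (fun t => (ϱ t - ϱ' t) - τ t) := n2_add_le hτ.1 (hm.sub hτ).1
      _ ≤ 4 * 2 * 2 * schattenNorm 1 (γ₀ - γ₀') + 1 / 2 * n2 0 T (fun t => ϱ t - ϱ' t) := by
          refine add_le_add (e1.trans (by gcongr)) (e2.trans ?_)
          refine mul_le_mul' (le_trans ?_ (hT.contr _ hmem)) le_rfl
          gcongr
      _ = 16 * schattenNorm 1 (γ₀ - γ₀') + 1 / 2 * n2 0 T (fun t => ϱ t - ϱ' t) := by norm_num
  have e4 : n2 0 T (fun t => ϱ t - ϱ' t) ≤ 32 * schattenNorm 1 (γ₀ - γ₀') :=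
    e3.trans (le_of_eq (by rw [← mul_assoc]; norm_num))
  refine ⟨e4, fun t ht => ?_⟩
  obtain ⟨φ, l, hs⟩ := exists_isSpectral hsa hδ
  obtain ⟨φ', l', hs'⟩ := exists_isSpectral hγ' hfin'
  have hU1 := h.flow.isometry ht
  have hU2 := h'.flow.isometry ht
  have e5 := h.flow.tsum_sub_le le_rfl hT0 le_rfl hT1 h'.flow hK hK' hU0 hs' ht
  rw [n2_smul_sub_sign hσ] at e5
  have hr := (hs.rankOneSum (U t) (U t)).add (hs'.rankOneSum_sub (U t) (U' t))
  rw [← hsplit] at hr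
  refine (hr.schattenNorm_le (.sub (hγ.conjugate _) (hγ'.conjugate _))).trans ?_
  rw [tsum_sum_elim]
  simp only [Sum.elim_inl, Sum.elim_inr]
  rw [hs.tsum_conj hU1, hs'.tsum_elim_sub hU1 hU2]
  -- The constant 1024 is the product of 32 from `IsFlow.tsum_sub_le` and 32 from the bound on the
  -- densities.
  calc schattenNorm 1 (γ₀ - γ₀') + ∑' k, ‖l' k‖ₑ * (2 * ‖U t (φ' k) - U' t (φ' k)‖ₑ)
      ≤ schattenNorm 1 (γ₀ - γ₀') + 32 * R * (32 * schattenNorm 1 (γ₀ - γ₀')) := by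
        gcongr
        exact e5.trans (by gcongr)
    _ = (1 + 32 * 32 * R) * schattenNorm 1 (γ₀ - γ₀') := by ring
    _ = _ := by norm_num

theorem local_wellPosed (hσ : σ = 1 ∨ σ = -1) (R : ℝ) : ∃ T : ℝ, 0 < T ∧
    (∀ γ₀ ∈ schattenBall 1 R, ∃ γ ϱ, IsSolution σ T γ₀ γ ϱ) ∧
    ∃ L : ℝ≥0, ∀ γ₀ ∈ schattenBall 1 R, ∀ γ₀' ∈ schattenBall 1 R,
      ∀ γ ϱ γ' ϱ', IsSolution σ T γ₀ γ ϱ → IsSolution σ T γ₀' γ' ϱ' →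
        (∀ t ∈ Set.Icc 0 T, schattenNorm 1 (γ t - γ' t) ≤ L * schattenNorm 1 (γ₀ - γ₀')) ∧
        eLpNorm (ϱ - ϱ') 2 (timeMeasure T) ≤ L * schattenNorm 1 (γ₀ - γ₀') := by
  have hR : ENNReal.ofReal R < ⊤ := ENNReal.ofReal_lt_top
  obtain ⟨T, hT⟩ := exists_isShort hR ENNReal.one_lt_top
  refine ⟨T, hT.pos, fun γ₀ hγ => ?_, 1 + 1024 * R.toNNReal + 32,
    fun γ₀ hγ γ₀' hγ' γ ϱ γ' ϱ' h h' => ?_⟩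
  · obtain ⟨ϱ, U, h, -⟩ := exists_isDensityFlow_short hσ hγ.1 hR hγ.2 hT
    exact ⟨_, ϱ, h.isSolution hγ.1 (hγ.2.trans_lt hR)⟩
  · have hL : ((1 + 1024 * R.toNNReal + 32 : ℝ≥0) : ℝ≥0∞) = 1 + 1024 * ENNReal.ofReal R + 32 := by
      push_cast; rfl
    rw [hL]
    -- At infinite distance both bounds are trivial, since the Lipschitz constant is not 0; no
    -- triangle inequality for the trace norm is called for.
    by_cases hδ : schattenNorm 1 (γ₀ - γ₀') < ⊤
    · obtain ⟨U, hU, hγU⟩ := h.exists_isDensityFlow hT.pos.le hγ.1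
      obtain ⟨U', hU', hγU'⟩ := h'.exists_isDensityFlow hT.pos.le hγ'.1
      obtain ⟨h1, h2⟩ := hU.lipschitz hσ hγ.1 hγ'.1 hR hγ.2 hγ'.2 hT hU' hδ
      refine ⟨fun t ht => ?_, ?_⟩
      · rw [hγU t ht, hγU' t ht]
        exact (h2 t ht).trans (mul_le_mul' le_self_add le_rfl)
      · rw [timeMeasure_eq]
        rw [n2_eq_eLpNorm] at h1
        exact h1.trans (mul_le_mul' le_add_self le_rfl)
    · rw [not_lt, top_le_iff] at hδ
      rw [hδ, ENNReal.mul_top (by simp)]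
      exact ⟨fun _ _ => le_top, le_top⟩

theorem IsSolution.unique (hσ : σ = 1 ∨ σ = -1) (hγ : IsSelfAdjoint γ₀)
    (hfin : schattenNorm 1 γ₀ < ⊤) (hT : 0 ≤ T) (h : IsSolution σ T γ₀ γ ϱ)
    (h' : IsSolution σ T γ₀ γ' ϱ') :
    Set.EqOn γ γ' (Set.Icc 0 T) ∧ ϱ =ᵐ[timeMeasure T] ϱ' := by
  obtain ⟨U, hU, hγU⟩ := h.exists_isDensityFlow hT hγ
  obtain ⟨U', hU', hγU'⟩ := h'.exists_isDensityFlow hT hγ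
  obtain ⟨h1, h2⟩ := hU.unique hσ hγ hfin hU'
  rw [timeMeasure_eq]
  exact ⟨fun t ht => by rw [hγU t ht, hγU' t ht, h1 t ht], h2⟩

theorem exists_global_solution (hσ : σ = 1 ∨ σ = -1) (hγ : IsSelfAdjoint γ₀)
    (hfin : schattenNorm 1 γ₀ < ⊤) : ∃ γ ϱ, ∀ T : ℝ, 0 < T → IsSolution σ T γ₀ γ ϱ := by
  obtain ⟨ϱ, U, h⟩ := exists_global hσ hγ hfin
  exact ⟨fun t => U t * γ₀ * star (U t), ϱ, fun T hT => (h T hT).isSolution hγ hfin⟩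

/-- Global existence gives a solution on [0, r + 1] for every r, and this makes the premise of the
blowup alternative false. -/
theorem maximalTime_eq_top (hσ : σ = 1 ∨ σ = -1) (hγ : IsSelfAdjoint γ₀)
    (hfin : schattenNorm 1 γ₀ < ⊤) : maximalTime σ γ₀ = ⊤ := by
  obtain ⟨γ, ϱ, h⟩ := exists_global_solution hσ hγ hfin
  refine ENNReal.eq_top_of_forall_nnreal_le fun r => ?_
  have hr : (0 : ℝ) < r + 1 := by positivity
  refine le_trans ?_ (le_iSup₂ (f := fun (T : ℝ) (_ : 0 < T ∧ ∃ γ ϱ, IsSolution σ T γ₀ γ ϱ) =>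
    ENNReal.ofReal T) ((r : ℝ) + 1) ⟨hr, γ, ϱ, h _ hr⟩)
  rw [← ENNReal.ofReal_coe_nnreal]
  exact ENNReal.ofReal_le_ofReal (by linarith)

end wellPosed

/-! ### Stationary states -/

theorem prodCoef_e_zero_e (m n : ℤ) :
    prodCoef m (e 0) (e n) = if m = n then ((1 / √(2 * Real.pi) : ℝ) : ℂ) else 0 := by
  have h := prodCoef_e m 0 (e (-n))
  rw [star_e, neg_neg, orthonormal_iff_ite.mp orthonormal_e] at h
  rw [h]
  by_cases hmn : m = n
  · rw [if_pos hmn, if_pos (by omega), mul_one]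
  · rw [if_neg hmn, if_neg (by omega), mul_zero]

/-- Multiplication by α·`e 0` is multiplication by the number w = α/√(2π), so the plane wave only
acquires the phase e^{-iwt}. -/
theorem isProfile_e_of_const (α T : ℝ) (n : ℤ) :
    IsProfile 0 T (fun _ => (α : ℂ) • e 0)
      (fun t => Complex.exp (-Complex.I * (α * (1 / √(2 * Real.pi) : ℝ)) * t) • e n) := by
  set w : ℂ := α * (1 / √(2 * Real.pi) : ℝ) with hw
  -- An explicit antiderivative of w·e^{-iwr}, the integrand of Duhamel's formula for the
  -- coefficient of index n.
  have hderiv : ∀ r : ℝ, HasDerivAt (fun r : ℝ => Complex.I * Complex.exp (-Complex.I * w * r))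
      (w * Complex.exp (-Complex.I * w * r)) r := by
    intro r
    have h1 : HasDerivAt (fun r : ℝ => -Complex.I * w * (r : ℂ)) (-Complex.I * w) r := by
      simpa using (Complex.ofRealCLM.hasDerivAt (x := r)).const_mul (-Complex.I * w)
    refine ((h1.cexp).const_mul Complex.I).congr_deriv ?_
    linear_combination (-w * Complex.exp (-Complex.I * w * r)) * Complex.I_mul_I
  refine ⟨by fun_prop, ?_, fun t ht m => ?_⟩
  · rw [n4_lt_top_iff]
    have h1 : ∀ t : ℝ, quart (free t (Complex.exp (-Complex.I * w * t) • e n)) = quart (e n) := by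
      intro t
      rw [map_smul, free_e, smul_smul, quart_smul]
      have h2 : ‖Complex.exp (-Complex.I * w * t) * phase t n‖ = 1 := by
        rw [norm_mul, norm_phase, mul_one, hw]
        have : -Complex.I * (α * (1 / √(2 * Real.pi) : ℝ)) * t =
            ((-(α * (1 / √(2 * Real.pi)) * t) : ℝ) : ℂ) * Complex.I := by push_cast; ring
        rw [this, Complex.norm_exp_ofReal_mul_I]
      rw [← ofReal_norm, h2]
      simp
    simp only [h1]
    rw [setLIntegral_const]
    refine ENNReal.mul_lt_top ?_ (by simp)
    have h2 : quart (e n) = ∫⁻ _ : Circ, ENNReal.ofReal (1 / √(2 * Real.pi)) ^ 4 := by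
      refine lintegral_congr_ae ?_
      filter_upwards [e_ae n] with x hx
      have h3 : ‖(fourier n x : ℂ)‖ = 1 := by rw [fourier_apply]; exact Circle.norm_coe _
      rw [hx, ← ofReal_norm, norm_mul, h3, mul_one, Complex.norm_real,
        Real.norm_of_nonneg (by positivity)]
    rw [h2, lintegral_const]
    exact ENNReal.mul_lt_top (ENNReal.pow_lt_top ENNReal.ofReal_lt_top) (measure_lt_top _ _)
  · have hz0 : Complex.exp (-Complex.I * w * ((0 : ℝ) : ℂ)) = 1 := by simp
    simp only [inner_smul_right, orthonormal_iff_ite.mp orthonormal_e m n, hz0]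
    unfold duh
    by_cases hmn : m = n
    · subst hmn
      have h1 : ∀ r : ℝ, phase (-r) m * prodCoef m ((α : ℂ) • e 0)
          (free r (Complex.exp (-Complex.I * w * r) • e m)) = w * Complex.exp (-Complex.I * w * r) := by
        intro r
        rw [(free r).map_smul, free_e, map_smul, map_smul, map_smul, smul_apply, prodCoef_e_zero_e, if_pos rfl]
        simp only [smul_eq_mul]
        have := phase_neg_mul r m
        linear_combination (α * Complex.exp (-Complex.I * w * r) *
          ((1 / √(2 * Real.pi) : ℝ) : ℂ)) * this
      simp only [h1, if_true]
      rw [intervalIntegral.integral_eq_sub_of_hasDerivAt (fun r _ => hderiv r)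
        (Continuous.intervalIntegrable (by fun_prop) _ _), hz0]
      linear_combination (Complex.exp (-Complex.I * w * t) - 1) * Complex.I_mul_I
    · have h1 : ∀ r : ℝ, phase (-r) m * prodCoef m ((α : ℂ) • e 0)
          (free r (Complex.exp (-Complex.I * w * r) • e n)) = 0 := by
        intro r
        rw [(free r).map_smul, free_e, map_smul, map_smul, map_smul, smul_apply, prodCoef_e_zero_e,
          if_neg hmn]
        simp
      simp only [h1, if_neg hmn]
      simp

theorem isRealValued_e_zero : IsRealValued (e 0) := by
  filter_upwards [e_ae 0] with x hx
  rw [hx]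
  simp

theorem exists_isFlow_const (α : ℝ) {T : ℝ} (hT : 0 ≤ T) :
    ∃ U, IsFlow T (fun _ => (α : ℂ) • e 0) U := by
  have hm : MemLp (fun _ : ℝ => (α : ℂ) • e 0) 2 (volume.restrict (Set.Ioc 0 T)) := memLp_const _
  have hr : ∀ᵐ _ ∂(volume.restrict (Set.Ioc 0 T)), IsRealValued ((α : ℂ) • e 0) :=
    Eventually.of_forall fun _ => isRealValued_e_zero.smul α
  obtain ⟨U, hU⟩ := exists_isPropagator hT hm hr
  exact ⟨U, hT, hm, hr, hU⟩

theorem IsFlow.apply_e_of_const {α T : ℝ} {U : ℝ → Op} (h : IsFlow T (fun _ => (α : ℂ) • e 0) U)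
    {t : ℝ} (ht : t ∈ Set.Icc 0 T) (n : ℤ) : ∃ z : ℂ, U t (e n) = z • e n := by
  have h1 := ((h.prop (e n)).isProfile h.nonneg).unique h.memLp (isProfile_e_of_const α T n)
    (by simp [h.prop.zero h.nonneg, free_zero]) t ht
  have h2 := congrArg (free t) h1
  simp only [free_free_neg, map_smul, free_e, smul_smul] at h2
  exact ⟨_, h2⟩

/-- The projection onto the span of `e_1, …, e_N`. -/
noncomputable def projN (N : ℕ) : Op := ∑ n ∈ Finset.Icc 1 N, ketBra (e n) (e n)

theorem isSelfAdjoint_ketBra (φ : L2) : IsSelfAdjoint (ketBra φ φ) := by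
  rw [ContinuousLinearMap.isSelfAdjoint_iff_isSymmetric]
  intro x y
  change inner ℂ (ketBra φ φ x) y = inner ℂ x (ketBra φ φ y)
  rw [ketBra_apply, ketBra_apply, inner_smul_left, inner_smul_right, inner_conj_symm]
  ring

theorem isSelfAdjoint_projN (N : ℕ) : IsSelfAdjoint (projN N) :=
  isSelfAdjoint_sum _ fun n _ => isSelfAdjoint_ketBra (e n)

theorem isSelfAdjoint_smul_projN (c : ℝ) (N : ℕ) : IsSelfAdjoint ((c : ℂ) • projN N) :=
  IsSelfAdjoint.smul (Complex.conj_ofReal c) (isSelfAdjoint_projN N)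

theorem projN_apply_e (N : ℕ) (m : ℤ) :
    projN N (e m) = if m ∈ Finset.Icc (1 : ℤ) N then e m else 0 := by
  unfold projN
  rw [sum_apply]
  simp only [ketBra_apply, orthonormal_iff_ite.mp orthonormal_e, ite_smul, one_smul, zero_smul]
  split_ifs with h
  · rw [Finset.mem_Icc] at h
    lift m to ℕ using by omega
    simp only [Nat.cast_inj]
    rw [Finset.sum_ite_eq' (Finset.Icc 1 N) m fun n => e (n : ℤ), if_pos]
    rw [Finset.mem_Icc]
    omega
  · refine Finset.sum_eq_zero fun n hn => if_neg ?_
    rintro rfl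
    rw [Finset.mem_Icc] at h hn
    omega

theorem projN_mul_self (N : ℕ) : projN N * projN N = projN N := by
  have h : ∀ m, (projN N * projN N) (e m) = projN N (e m) := by
    intro m
    change projN N (projN N (e m)) = _
    rw [projN_apply_e]
    split_ifs with h
    · rw [projN_apply_e, if_pos h]
    · rw [map_zero]
  ext1 x
  have h1 := (hasSum_coef_smul x).mapL (projN N * projN N)
  have h2 := (hasSum_coef_smul x).mapL (projN N)
  simp only [map_smul, h] at h1 h2
  exact h1.unique h2

theorem posTrace_smul_projN (c : ℝ) (N : ℕ) :
    posTrace ((c : ℂ) • projN N) = N * ENNReal.ofReal c := by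
  unfold posTrace
  have h : ∀ n : ℤ, ENNReal.ofReal (RCLike.re (inner ℂ (e n) (((c : ℂ) • projN N) (e n)))) =
      if n ∈ Finset.Icc (1 : ℤ) N then ENNReal.ofReal c else 0 := by
    intro n
    rw [smul_apply, projN_apply_e, inner_smul_right]
    split_ifs
    · rw [orthonormal_iff_ite.mp orthonormal_e, if_pos rfl, mul_one]
      exact congrArg _ (Complex.ofReal_re c)
    · simp
  simp only [h]
  rw [tsum_eq_sum (s := Finset.Icc (1 : ℤ) N) fun n hn => if_neg hn,
    Finset.sum_congr rfl fun n hn => if_pos hn, Finset.sum_const, Int.card_Icc, nsmul_eq_mul]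
  simp

theorem schattenNorm_smul_projN_le {α : ℝ≥0∞} (hα : 1 ≤ α) {c : ℝ} (hc : 0 ≤ c) (N : ℕ) :
    schattenNorm α ((c : ℂ) • projN N) ≤ ENNReal.ofReal (c * (N : ℝ) ^ (α⁻¹).toReal) := by
  have hP := isSelfAdjoint_projN N
  by_cases h : α = ⊤
  · subst h
    rw [schattenNorm, if_pos rfl, ← ofReal_norm]
    refine ENNReal.ofReal_le_ofReal ?_
    have h1 : ‖projN N‖ ≤ 1 := by
      have h2 : ‖projN N‖ * ‖projN N‖ = ‖projN N‖ := by
        have := CStarRing.norm_star_mul_self (x := projN N)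
        rw [hP.star_eq, projN_mul_self] at this
        exact this.symm
      nlinarith [norm_nonneg (projN N)]
    rw [norm_smul, Complex.norm_real, Real.norm_of_nonneg hc]
    simp only [ENNReal.inv_top, ENNReal.toReal_zero, Real.rpow_zero]
    gcongr
  · have hp : 0 < α.toReal := ENNReal.toReal_pos (zero_lt_one.trans_le hα).ne' h
    rw [schattenNorm, if_neg h, absPow_smul_projection hP (projN_mul_self N) hc hp,
      posTrace_smul_projN, ENNReal.toReal_inv]
    rw [ENNReal.mul_rpow_of_nonneg _ _ (by positivity), ← ENNReal.ofReal_rpow_of_nonneg hc hp.le,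
      ← ENNReal.rpow_mul, mul_one_div_cancel hp.ne', ENNReal.rpow_one, mul_comm,
      ENNReal.ofReal_mul hc, one_div, ← ENNReal.ofReal_natCast,
      ENNReal.ofReal_rpow_of_nonneg (Nat.cast_nonneg N) (by positivity)]

/-- Each |e_n|² is the constant 1/(2π), so N of them add up to a multiple of `e 0`. The
decomposition needs infinite orthonormal systems, so it runs over all e_{k+1}, with singular value 0
from k = N on. -/
theorem isDensity_smul_projN {c : ℝ} (hc : 0 ≤ c) (N : ℕ) :
    IsDensity ((c : ℂ) • projN N) (((c * N / √(2 * Real.pi) : ℝ) : ℂ) • e 0 : L2) := by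
  have ho : Orthonormal ℂ fun k : ℕ => e ((k : ℤ) + 1) :=
    orthonormal_e.comp (fun k : ℕ => (k : ℤ) + 1) fun i j h => by simpa using h
  have hz : ∀ k ∉ Finset.range N, (if k < N then c else 0) = 0 := fun k hk =>
    if_neg (by simpa using hk)
  refine ⟨fun k => if k < N then c else 0, fun k => e ((k : ℤ) + 1), fun k => e ((k : ℤ) + 1),
    fun k => ?_, summable_of_ne_finset_zero hz, ho, ho, ?_, ?_⟩
  · dsimp only
    split_ifs <;> simp [hc]
  · have h1 : (c : ℂ) • projN N = ∑ k ∈ Finset.range N, (((if k < N then c else 0 : ℝ) : ℝ) : ℂ) •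
        ketBra (e ((k : ℤ) + 1)) (e ((k : ℤ) + 1)) := by
      rw [Finset.sum_congr rfl fun k hk => by rw [if_pos (Finset.mem_range.mp hk)],
        ← Finset.smul_sum]
      congr 1
      clear hz
      unfold projN
      induction N with
      | zero => simp
      | succ N ih =>
        rw [Finset.sum_Icc_succ_top (by omega), ih, Finset.sum_range_succ]
        push_cast
        rfl
    rw [h1]
    exact hasSum_sum_of_ne_finset_zero fun k hk => by dsimp only; rw [hz k hk]; simp
  · have h1 : ∀ᵐ x : Circ, ∀ k : ℕ, e ((k : ℤ) + 1) x =
        ((1 / √(2 * Real.pi) : ℝ) : ℂ) * fourier ((k : ℤ) + 1) x := by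
      rw [ae_all_iff]
      exact fun k => e_ae _
    filter_upwards [h1, e_ae 0, Lp.coeFn_smul ((c * N / √(2 * Real.pi) : ℝ) : ℂ) (e 0)] with x h2 h3
      h4
    rw [h4, Pi.smul_apply, h3, fourier_zero, mul_one, smul_eq_mul]
    have h5 : ∀ k : ℕ, e ((k : ℤ) + 1) x * (starRingEnd ℂ) (e ((k : ℤ) + 1) x) =
        ((1 / √(2 * Real.pi) : ℝ) : ℂ) * ((1 / √(2 * Real.pi) : ℝ) : ℂ) := by
      intro k
      have h6 : (fourier ((k : ℤ) + 1) x : ℂ) * (starRingEnd ℂ) (fourier ((k : ℤ) + 1) x) = 1 := by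
        rw [RCLike.mul_conj, fourier_apply, Circle.norm_coe]
        simp
      rw [h2 k, map_mul, Complex.conj_ofReal]
      linear_combination (((1 / √(2 * Real.pi) : ℝ) : ℂ) * ((1 / √(2 * Real.pi) : ℝ) : ℂ)) * h6
    simp only [mul_assoc, h5]
    have h7 : HasSum (fun k : ℕ => (((if k < N then c else 0 : ℝ) : ℝ) : ℂ) *
        (((1 / √(2 * Real.pi) : ℝ) : ℂ) * ((1 / √(2 * Real.pi) : ℝ) : ℂ)))
        (∑ k ∈ Finset.range N, (((if k < N then c else 0 : ℝ) : ℝ) : ℂ) *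
        (((1 / √(2 * Real.pi) : ℝ) : ℂ) * ((1 / √(2 * Real.pi) : ℝ) : ℂ))) :=
      hasSum_sum_of_ne_finset_zero fun k hk => by rw [hz k hk]; simp
    convert! h7 using 1
    rw [Finset.sum_congr rfl fun k hk => by rw [if_pos (Finset.mem_range.mp hk)],
      Finset.sum_const, Finset.card_range, nsmul_eq_mul]
    push_cast
    ring

/-- The density is constant, so the propagator multiplies each `e n` by a unimodular z, and z
cancels against its conjugate in |e_n⟩⟨e_n|. -/
theorem isSolution_smul_projN (σ : ℝ) {c T : ℝ} (hc : 0 ≤ c) (hT : 0 ≤ T) (N : ℕ) :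
    IsSolution σ T ((c : ℂ) • projN N) (fun _ => (c : ℂ) • projN N)
      (fun _ => ((c * N / √(2 * Real.pi) : ℝ) : ℂ) • e 0) := by
  have hd := isDensity_smul_projN hc N
  set r : ℝ := c * N / √(2 * Real.pi) with hr
  obtain ⟨U, hU⟩ := exists_isFlow_const (σ * r) hT
  refine ⟨fun t _ => ⟨?_, ?_⟩, memLp_const _, Eventually.of_forall fun _ => hd, U, ?_,
    fun t ht => ?_⟩
  · exact (schattenNorm_smul_projN_le le_rfl hc N).trans_lt ENNReal.ofReal_lt_top
  · have h0 : schattenNorm 1 (0 : Op) = 0 := by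
      have := schattenNorm_smul_projN_le le_rfl le_rfl 0 (c := 0)
      simpa using this
    simp only [sub_self, h0]
    exact tendsto_const_nhds
  · have h1 := hU.prop
    simp only [Complex.ofReal_mul, mul_smul] at h1
    exact h1
  · rw [mul_smul_comm, smul_mul_assoc]
    congr 1
    unfold projN
    rw [Finset.mul_sum, Finset.sum_mul]
    refine Finset.sum_congr rfl fun n _ => ?_
    rw [mul_ketBra_mul_star]
    obtain ⟨z, hz⟩ := hU.apply_e_of_const ht n
    have hz1 : ‖z‖ = 1 := by
      have h1 := hU.isometry ht (e n)
      rwa [hz, norm_smul, orthonormal_e.1 n, mul_one] at h1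
    rw [hz]
    ext1 x
    have h2 : (starRingEnd ℂ) z * z = 1 := by
      rw [RCLike.conj_mul, hz1]; simp
    rw [ketBra_apply, ketBra_apply, inner_smul_left, smul_smul]
    congr 1
    linear_combination (-inner ℂ (e n) x) * h2

/-! ### Ill-posedness -/

theorem timeMeasure_univ (T : ℝ) : timeMeasure T Set.univ = ENNReal.ofReal T := by
  rw [timeMeasure_eq, Measure.restrict_apply_univ, Real.volume_Ioc, sub_zero]

theorem inv_toReal_lt_one {α : ℝ≥0∞} (hα : 1 < α) : (α⁻¹).toReal < 1 := by
  have h : α⁻¹ < 1 := ENNReal.inv_lt_one.mpr hα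
  simpa using (ENNReal.toReal_lt_toReal (h.trans ENNReal.one_lt_top).ne ENNReal.one_ne_top).mpr h

theorem schattenNorm_zero {α : ℝ≥0∞} (hα : 1 ≤ α) : schattenNorm α (0 : Op) = 0 := by
  have := schattenNorm_smul_projN_le hα le_rfl 0 (c := 0)
  simpa using this

/-- The data R/(N+1) times the projection onto N+1 plane waves stay in the trace-norm ball and tend
to 0 in 𝔖^α, but their density is a fixed nonzero function. Continuity at 0 would force it to equal
the density 0 of the zero solution. -/
theorem not_exists_continuous_extension (σ : ℝ) {α : ℝ≥0∞} (hα : 1 < α) {R : ℝ} (hR : 0 < R)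
    {T : ℝ} (hT : 0 < T) :
    ¬ ∃ F : Op → Lp L2 2 (timeMeasure T),
      SchattenContinuousOn α T (schattenBall α R) F ∧
      ∀ γ₀ ∈ schattenBall 1 R, ∀ γ ϱ, IsSolution σ T γ₀ γ ϱ → F γ₀ =ᵐ[timeMeasure T] ϱ := by
  rintro ⟨F, hF, hsol⟩
  have hα1 := inv_toReal_lt_one hα
  set β := (α⁻¹).toReal with hβ
  have hmem0 : ∀ p : ℝ≥0∞, 1 ≤ p → (0 : Op) ∈ schattenBall p R := fun p hp =>
    ⟨IsSelfAdjoint.zero _, by rw [schattenNorm_zero hp]; exact bot_le⟩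
  let A : ℕ → Op := fun N => ((R / (N + 1) : ℝ) : ℂ) • projN (N + 1)
  have hN : ∀ N : ℕ, (0 : ℝ) < N + 1 := fun N => by positivity
  have hc : ∀ N : ℕ, 0 ≤ R / ((N : ℝ) + 1) := fun N => (div_pos hR (hN N)).le
  have hA1 : ∀ N, A N ∈ schattenBall 1 R := by
    intro N
    refine ⟨isSelfAdjoint_smul_projN _ _, (schattenNorm_smul_projN_le le_rfl (hc N) _).trans ?_⟩
    refine ENNReal.ofReal_le_ofReal (le_of_eq ?_)
    have := hN N
    simp only [inv_one, ENNReal.toReal_one, Real.rpow_one]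
    push_cast
    field_simp
  have hAα : ∀ N, schattenNorm α (A N) ≤ ENNReal.ofReal (R * ((N : ℝ) + 1) ^ (-(1 - β))) := by
    intro N
    refine (schattenNorm_smul_projN_le hα.le (hc N) _).trans
      (ENNReal.ofReal_le_ofReal (le_of_eq ?_))
    rw [← hβ, neg_sub, Real.rpow_sub (hN N), Real.rpow_one]
    push_cast
    ring
  have hAmem : ∀ N, A N ∈ schattenBall α R := by
    intro N
    refine ⟨isSelfAdjoint_smul_projN _ _, (hAα N).trans (ENNReal.ofReal_le_ofReal ?_)⟩
    refine mul_le_of_le_one_right hR.le (Real.rpow_le_one_of_one_le_of_nonpos ?_ (by linarith))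
    have : (0 : ℝ) ≤ N := Nat.cast_nonneg N
    linarith
  have hlim : Tendsto (fun N : ℕ => R * ((N : ℝ) + 1) ^ (-(1 - β))) atTop (𝓝 0) := by
    have h1 : Tendsto (fun N : ℕ => (N : ℝ) + 1) atTop atTop :=
      tendsto_atTop_add_const_right _ _ tendsto_natCast_atTop_atTop
    simpa using ((tendsto_rpow_neg_atTop (by linarith : 0 < 1 - β)).comp h1).const_mul R
  have hF0 : F 0 =ᵐ[timeMeasure T] fun _ => (0 : L2) := by
    have h1 := isSolution_smul_projN σ le_rfl hT.le 0 (c := 0)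
    simp only [Complex.ofReal_zero, zero_smul, zero_mul, zero_div] at h1
    exact hsol 0 (hmem0 1 le_rfl) _ _ h1
  set g : L2 := ((R / √(2 * Real.pi) : ℝ) : ℂ) • e 0 with hg
  have hFA : ∀ N, F (A N) =ᵐ[timeMeasure T] fun _ => g := by
    intro N
    have h1 := isSolution_smul_projN σ (hc N) hT.le (N + 1)
    have h2 : R / ((N : ℝ) + 1) * ((N + 1 : ℕ) : ℝ) = R := by
      have := hN N
      push_cast
      field_simp
    rw [h2] at h1
    exact hsol (A N) (hA1 N) _ _ h1
  have hconst : ∀ N, F (A N) = F (A 0) := fun N => Lp.ext ((hFA N).trans (hFA 0).symm)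
  have hne : F (A 0) - F 0 ≠ 0 := by
    intro h
    have h1 : (fun _ : ℝ => g) =ᵐ[timeMeasure T] fun _ => (0 : L2) := by
      rw [sub_eq_zero] at h
      exact (hFA 0).symm.trans (h ▸ hF0)
    have hμ : timeMeasure T ≠ 0 := by
      rw [← Measure.measure_univ_ne_zero, timeMeasure_univ]
      simpa using hT
    have : (ae (timeMeasure T)).NeBot := ae_neBot.mpr hμ
    obtain ⟨t, ht⟩ := h1.exists
    have h2 : ‖g‖ = R / √(2 * Real.pi) := by
      rw [hg, norm_smul, orthonormal_e.1, mul_one, Complex.norm_real,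
        Real.norm_of_nonneg (by positivity)]
    rw [show g = 0 from ht, norm_zero] at h2
    have : 0 < R / √(2 * Real.pi) := by positivity
    exact this.ne h2
  obtain ⟨δ, hδ, hc'⟩ := hF 0 (hmem0 α hα.le) ‖F (A 0) - F 0‖ (norm_pos_iff.mpr hne)
  obtain ⟨N, hN'⟩ := (hlim.eventually (gt_mem_nhds hδ)).exists
  have h1 := hc' (A N) (hAmem N) (by
    rw [sub_zero]
    exact (hAα N).trans_lt ((ENNReal.ofReal_lt_ofReal_iff hδ).mpr hN'))
  rw [hconst N] at h1
  exact lt_irrefl _ h1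

theorem gammaN_eq (α : ℝ≥0∞) (ε : ℝ) (N : ℕ) :
    gammaN α ε N = (((N : ℝ) ^ (-(α⁻¹).toReal - ε) : ℝ) : ℂ) • projN N := rfl

theorem tendsto_schattenNorm_gammaN {α : ℝ≥0∞} (hα : 1 < α) {ε : ℝ} (hε : 0 < ε) :
    Tendsto (fun N : ℕ => schattenNorm α (gammaN α ε N)) atTop (𝓝 0) := by
  have h1 : Tendsto (fun N : ℕ => ENNReal.ofReal ((N : ℝ) ^ (-ε))) atTop (𝓝 0) := by
    have := ENNReal.tendsto_ofReal
      ((tendsto_rpow_neg_atTop hε).comp tendsto_natCast_atTop_atTop)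
    simpa using this
  refine tendsto_of_tendsto_of_tendsto_of_le_of_le' tendsto_const_nhds h1
    (Eventually.of_forall fun _ => bot_le) ?_
  filter_upwards [eventually_gt_atTop 0] with N hN
  have hN' : (0 : ℝ) < N := by exact_mod_cast hN
  rw [gammaN_eq]
  refine (schattenNorm_smul_projN_le hα.le (by positivity) N).trans
    (ENNReal.ofReal_le_ofReal (le_of_eq ?_))
  rw [← Real.rpow_add hN']
  congr 1
  ring

theorem stationary_gammaN (σ : ℝ) (α : ℝ≥0∞) {ε : ℝ} (hε : ε < 1 - (α⁻¹).toReal) :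
    ∃ ρ : ℕ → L2, ∀ T : ℝ, 0 < T →
      (∀ N : ℕ, IsSelfAdjoint (gammaN α ε N) ∧
        IsSolution σ T (gammaN α ε N) (fun _ => gammaN α ε N) (fun _ => ρ N)) ∧
      Tendsto (fun N : ℕ => eLpNorm (fun _ : ℝ => ρ N) 2 (timeMeasure T)) atTop (𝓝 ⊤) := by
  set β := (α⁻¹).toReal with hβ
  refine ⟨fun N => (((N : ℝ) ^ (-β - ε) * N / √(2 * Real.pi) : ℝ) : ℂ) • e 0, fun T hT =>
    ⟨fun N => ⟨isSelfAdjoint_smul_projN _ _, isSolution_smul_projN σ (by positivity) hT.le N⟩, ?_⟩⟩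
  have hμ : timeMeasure T ≠ 0 := by
    rw [← Measure.measure_univ_ne_zero, timeMeasure_univ]
    simpa using hT
  have h1 : ∀ N : ℕ, eLpNorm (fun _ : ℝ => (((N : ℝ) ^ (-β - ε) * N / √(2 * Real.pi) : ℝ) : ℂ) • e 0)
      2 (timeMeasure T) = ENNReal.ofReal ((N : ℝ) ^ (-β - ε) * N / √(2 * Real.pi)) *
        ENNReal.ofReal T ^ (1 / 2 : ℝ) := by
    intro N
    rw [eLpNorm_const _ (by norm_num) hμ, timeMeasure_univ, ← ofReal_norm, norm_smul,
      orthonormal_e.1, mul_one, Complex.norm_real, Real.norm_of_nonneg (by positivity)]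
    norm_num
  simp only [h1]
  -- The density grows like N^(1 − β − ε), with a positive exponent by the assumption on ε.
  have h2 : Tendsto (fun N : ℕ => (N : ℝ) ^ (-β - ε) * N / √(2 * Real.pi)) atTop atTop := by
    refine Tendsto.atTop_div_const (by positivity) ?_
    refine ((tendsto_rpow_atTop (by linarith : 0 < 1 - β - ε)).comp
      tendsto_natCast_atTop_atTop).congr' ?_
    filter_upwards [eventually_gt_atTop 0] with N hN
    have hN' : (0 : ℝ) < N := by exact_mod_cast hN
    rw [Function.comp_apply, ← Real.rpow_add_one hN'.ne']
    congr 1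
    ring
  have h3 := ENNReal.Tendsto.mul_const (b := ENNReal.ofReal T ^ (1 / 2 : ℝ))
    (ENNReal.tendsto_ofReal_atTop.comp h2) (Or.inl ENNReal.top_ne_zero)
  have h4 : ENNReal.ofReal T ^ (1 / 2 : ℝ) ≠ 0 := by
    refine (ENNReal.rpow_pos ?_ ENNReal.ofReal_ne_top).ne'
    simpa using hT
  rwa [ENNReal.top_mul h4] at h3

end NLSS

/-! ### The main theorem. -/

theorem mainTheorem4 (σ : ℝ) (hσ : σ = 1 ∨ σ = -1) :
    -- local well-posedness, with a time that depends on the size of the data only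
    (∀ R : ℝ, 0 < R → ∃ T : ℝ, 0 < T ∧
      (∀ γ₀ ∈ NLSS.schattenBall 1 R, ∃ γ ϱ, NLSS.IsSolution σ T γ₀ γ ϱ) ∧
      -- Lipschitz continuity of the data-to-solution map
      ∃ L : ℝ≥0, ∀ γ₀ ∈ NLSS.schattenBall 1 R, ∀ γ₀' ∈ NLSS.schattenBall 1 R,
        ∀ γ ϱ γ' ϱ', NLSS.IsSolution σ T γ₀ γ ϱ → NLSS.IsSolution σ T γ₀' γ' ϱ' →
          (∀ t ∈ Set.Icc 0 T,
            NLSS.schattenNorm 1 (γ t - γ' t) ≤ L * NLSS.schattenNorm 1 (γ₀ - γ₀')) ∧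
          eLpNorm (ϱ - ϱ') 2 (NLSS.timeMeasure T) ≤ L * NLSS.schattenNorm 1 (γ₀ - γ₀')) ∧
    (∀ γ₀ : NLSS.Op, IsSelfAdjoint γ₀ → NLSS.schattenNorm 1 γ₀ < ⊤ →
      -- uniqueness on every time interval
      (∀ T : ℝ, 0 < T → ∀ γ ϱ γ' ϱ',
        NLSS.IsSolution σ T γ₀ γ ϱ → NLSS.IsSolution σ T γ₀ γ' ϱ' →
          Set.EqOn γ γ' (Set.Icc 0 T) ∧ ϱ =ᵐ[NLSS.timeMeasure T] ϱ') ∧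
      -- blowup alternative
      (∀ γ ϱ, (∀ T : ℝ, 0 < T → ENNReal.ofReal T < NLSS.maximalTime σ γ₀ →
          NLSS.IsSolution σ T γ₀ γ ϱ) →
        NLSS.maximalTime σ γ₀ < ⊤ →
          Tendsto (fun t => NLSS.schattenNorm 1 (γ t))
            (𝓝[<] (NLSS.maximalTime σ γ₀).toReal) (𝓝 ⊤)) ∧
      -- global existence
      (∃ γ ϱ, ∀ T : ℝ, 0 < T → NLSS.IsSolution σ T γ₀ γ ϱ)) ∧
    -- ill-posedness: no continuous extension of the data-to-density map
    (∀ α : ℝ≥0∞, 1 < α → ∀ R : ℝ, 0 < R → ∀ T : ℝ, 0 < T →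
      ¬ ∃ F : NLSS.Op → Lp NLSS.L2 2 (NLSS.timeMeasure T),
        NLSS.SchattenContinuousOn α T (NLSS.schattenBall α R) F ∧
        ∀ γ₀ ∈ NLSS.schattenBall 1 R, ∀ γ ϱ, NLSS.IsSolution σ T γ₀ γ ϱ →
          F γ₀ =ᵐ[NLSS.timeMeasure T] ϱ) ∧
    -- the stationary states tend to zero in the Schatten class, their densities blow up
    (∀ α : ℝ≥0∞, 1 < α → ∀ ε : ℝ, 0 < ε → ε < 1 - (α⁻¹).toReal →
      Tendsto (fun N : ℕ => NLSS.schattenNorm α (NLSS.gammaN α ε N)) atTop (𝓝 0) ∧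
      ∃ ρ : ℕ → NLSS.L2, ∀ T : ℝ, 0 < T →
        (∀ N : ℕ, IsSelfAdjoint (NLSS.gammaN α ε N) ∧
          NLSS.IsSolution σ T (NLSS.gammaN α ε N) (fun _ => NLSS.gammaN α ε N) (fun _ => ρ N)) ∧
        Tendsto (fun N : ℕ => eLpNorm (fun _ : ℝ => ρ N) 2 (NLSS.timeMeasure T)) atTop (𝓝 ⊤)) := by
  refine ⟨fun R _ => NLSS.local_wellPosed hσ R, fun γ₀ hγ hfin => ⟨?_, ?_,
    NLSS.exists_global_solution hσ hγ hfin⟩, fun α hα R hR T hT =>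
    NLSS.not_exists_continuous_extension σ hα hR hT, fun α hα ε hε hε' =>
    ⟨NLSS.tendsto_schattenNorm_gammaN hα hε, NLSS.stationary_gammaN σ α hε'⟩⟩
  · exact fun T hT γ ϱ γ' ϱ' h h' => h.unique hσ hγ hfin hT.le h'
  · intro γ ϱ _ hlt
    -- The maximal time is infinite, so the blowup alternative is vacuous.
    rw [NLSS.maximalTime_eq_top hσ hγ hfin] at hlt
    exact absurd hlt (lt_irrefl _)
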